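/- **Conventions.** Let $\Bbbk$ be a field. A *pointed rack* is a set $X$ with a product $\lhd$ such that $(k\lhd h)\lhd g=(k\lhd g)\lhd(h\lhd g)$ for all $g,h,k\in X$ and every map $-\lhd g$ is bijective, together with $e\in X$ such that $e\lhd g=e$ and $g\lhd e=g$ for all $g$; morphisms preserve $\lhd$ and $e$. The category is denoted $\mathbf{Rack}$. $\mathrm{Conj}:\mathbf{Grp}\to\mathbf{Rack}$ sends $G$ to $G$ with $h\lhd g=g^{-1}hg$ and $e=1$. For a cubical set $Y$ (faces $d_{i,\epsilon}$, degeneracies $s_i$, $\epsilon\in\{0,1\}$), $C_n(Y)$ is the free $\Bbbk$-module on $Y_n$ modulo the span of the degenerate cubes, with $d=\sum_{i=1}^n(-1)^{i+1}(d_{i,1}-d_{i,0})$, and $H_\bullet(Y,\Bbbk)$ is its homology. The nerve $N^RX$ of a pointed rack has $(N^RX)_n=X^n$, with $$d_{i,0}(x_1,\dots,x_n)=(x_1,\dots,\widehat{x_i},\dots,x_n),\qquad d_{i,1}(x_1,\dots,x_n)=(x_1\lhd x_i,\dots,x_{i-1}\lhd x_i,x_{i+1},\dots,x_n),$$ $$s_i(x_1,\dots,x_n)=(x_1,\dots,x_{i-1},e,x_i,\dots,x_n),$$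 and $HR_\bullet(X,\Bbbk):=H_\bullet(N^RX,\Bbbk)$. For a group $G$, the cubical nerve $N^\square G$ has as $n$-cubes the functors from the poset $\{0,1\}^n$ to the one-object groupoid $G$ in which $g$ followed by $h$ is $gh$. $L(N^\square G)_n$ is the set of $x\in N^\square G_n$ such that for each $1\le k\le n$ the iterated face $d_{1,\epsilon_1}\cdots d_{1,\epsilon_k}x$ does not depend on $(\epsilon_1,\dots,\epsilon_k)\in\{0,1\}^k$; the $L$-homology of $G$ is $HL_\bullet(G,\Bbbk):=H_\bullet(L(N^\square G),\Bbbk)$. A (counital, connected, graded) *coZinbiel coalgebra* is a graded $\Bbbk$-vector space $C=\bigoplus_{n\ge0}C_n$ with a linear isomorphism $c:C_0\to\Bbbk$ (extended by $0$) and a degree $0$ map $\Delta_\prec:C_{\ge1}\to C\otimes C$ with $(c\otimes\mathrm{id})\Delta_\prec=0$, $(\mathrm{id}\otimes c)\Delta_\prec=\mathrm{id}$ and $$(\Delta_\prec\otimes\mathrm{id})\Delta_\prec=\big(\mathrm{id}\otimes\Delta_\prec+\mathrm{id}\otimes(\tau\circ\Delta_\prec)\big)\Delta_\prec,\qquad \tau(x\otimes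 y)=(-1)^{|x||y|}y\otimes x,$$ in every multidegree $(p,q,r)$ with $p+q\ge1$ and $q+r\ge1$ (so $C_{\ge 1}$ with the part of $\Delta_\prec$ in bidegrees $p,q\ge1$ is a coZinbiel coalgebra in the non-counital sense). Morphisms are graded linear maps compatible with $c$ and $\Delta_\prec$; the category is $\mathbf{Zinb}^c$. Let $\mathrm{Sh}^1_{p,q}$ ($p\ge1$, $q\ge0$) be the set of $(p,q)$-shuffles $\sigma$ (permutations of $\{1,\dots,p+q\}$ increasing on $\{1,\dots,p\}$ and on $\{p+1,\dots,p+q\}$) with $\sigma(1)=1$, and let $\epsilon(\sigma)$ be the sign of $\sigma$. **Theorem.** For every pointed rack $X$, the rack homology $HR_\bullet(X,\Bbbk)$ carries a coZinbiel coalgebra structure, natural in $X$, so that there is a functor $$HR_\bullet(-,\Bbbk):\mathbf{Rack}\to\mathbf{Zinb}^c .$$ The counit takes the class of the unique vertex of $N^RX$ to $1$, and for $n\ge1$ the coproduct is induced by the formula $$(\Delta_\prec)_n(x_1,\dots,x_n)=\sum_{p+q=n}\ \sum_{\sigma\in\mathrm{Sh}^1_{p,q}}\epsilon(\sigma)\,(x_1,x_{\sigma(2)},\dots,x_{\sigma(p)})\otimes(x^\sigma_{p+1},\dots,x^\sigma_{p+q}),$$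 where $x_i^\sigma=(\cdots(x_{\sigma(i)}\lhd x_{i_1})\lhd\cdots)\lhd x_{i_r}$ and $i_1<\dots<i_r$ are the elements of $\{\sigma(1),\dots,\sigma(p)\}$ larger than $\sigma(i)$. "Induced" means that for a cycle $z\in C_n(N^RX)$ the class of $\Delta_\prec(z)$ in $H_n(C(N^RX)\otimes C(N^RX))$ corresponds to $\Delta_\prec[z]$ under the Künneth isomorphism $\bigoplus_{p+q=n} HR_p\otimes HR_q\cong H_n(C(N^RX)\otimes C(N^RX))$. Moreover, the $L$-homology $HL_\bullet(G,\Bbbk)$ of groups carries a coZinbiel coalgebra structure, natural in $G$, whose counit takes the class of the vertex to $1$ and whose coproduct is, in the same sense, induced by $$x\mapsto\sum_{p+q=n}\ \sum_{\sigma\in\mathrm{Sh}^1_{p,q}}\epsilon(\sigma)\,(d_{\sigma(p+1),0}\cdots d_{\sigma(p+q),0})(x)\otimes(d_{\sigma(1),1}\cdots d_{\sigma(p),1})(x)\qquad(n\ge1),$$ and the composite $HR_\bullet(-,\Bbbk)\circ\mathrm{Conj}:\mathbf{Grp}\to\mathbf{Zinb}^c$ is naturally isomorphic to $HL_\bullet(-,\Bbbk):\mathbf{Grp}\to\mathbf{Zinb}^c$,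 by an isomorphism induced by a natural isomorphism of cubical sets $N^R(\mathrm{Conj}\,G)\cong L(N^\square G)$. -/

import Mathlib

universe u v w

open CategoryTheory TensorProduct

set_option linter.unusedSimpArgs false
set_option linter.unusedTactic false
set_option linter.unreachableTactic false
set_option linter.unnecessarySeqFocus false

namespace RackHomology

noncomputable section

/-! ### Pointed racks -/

/-- A pointed rack. Mathlib's racks act on the left; the right-handed product `h ◁ g` is
`Shelf.act g h` (see `ract`), so `act_pt` is `e ◁ g = e` and `pt_act` is `g ◁ e = g`. -/
class PointedRack (X : Type u) extends Rack X where
  pt : X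
  act_pt : ∀ g : X, Shelf.act g pt = pt
  pt_act : ∀ g : X, Shelf.act pt g = g

/-- The right-handed rack product `h ◁ g`. -/
def ract {X : Type u} [PointedRack X] (h g : X) : X := Shelf.act g h

theorem ract_ract {X : Type u} [PointedRack X] (k h g : X) :
    ract (ract k h) g = ract (ract k g) (ract h g) :=
  Shelf.self_distrib

theorem pt_ract {X : Type u} [PointedRack X] (g : X) : ract PointedRack.pt g = PointedRack.pt :=
  PointedRack.act_pt g

theorem ract_pt {X : Type u} [PointedRack X] (g : X) : ract g PointedRack.pt = g :=
  PointedRack.pt_act g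

theorem ract_bijective {X : Type u} [PointedRack X] (g : X) :
    Function.Bijective (fun h : X => ract h g) :=
  (Rack.act' g).bijective

/-- The category of pointed racks (written `Rack` in mathematics). -/
structure PRack : Type (u + 1) where
  carrier : Type u
  [str : PointedRack carrier]

attribute [instance] PRack.str

/-- Morphisms of pointed racks: rack morphisms that preserve the neutral element. -/
@[ext]
structure PRackHom (X Y : PRack.{u}) extends ShelfHom X.carrier Y.carrier where
  map_pt : toFun PointedRack.pt = PointedRack.pt

instance : Category PRack.{u} where
  Hom X Y := PRackHom X Y
  id X := { toFun := id, map_act' := rfl, map_pt := rfl }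
  comp f g :=
    { toFun := g.toFun ∘ f.toFun
      map_act' := (congrArg g.toFun f.map_act').trans g.map_act'
      map_pt := (congrArg g.toFun f.map_pt).trans g.map_pt }

/-- A group with `h ◁ g = g⁻¹ h g` and neutral element `1`. -/
@[reducible]
def conjPointedRack (G : Type u) [Group G] : PointedRack G where
  act g h := g⁻¹ * h * g
  self_distrib := by intro x y z; group
  invAct g h := g * h * g⁻¹
  left_inv := by intro x y; group
  right_inv := by intro x y; group
  pt := 1
  act_pt := by intro g; group
  pt_act := by intro g; group

/-- The functor `Conj : Grp ⥤ Rack`. -/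
def conj : GrpCat.{u} ⥤ PRack.{u} where
  obj G := { carrier := G, str := conjPointedRack G }
  map {G H} f :=
    { toFun := f.hom
      map_act' := by
        intro x y
        change f.hom (x⁻¹ * y * x) = (f.hom x)⁻¹ * f.hom y * f.hom x
        simp
      map_pt := map_one f.hom }

/-! ### Cubical sets -/

/-- A cubical set, with faces `d i ε` (`ε = false` for `0` and `ε = true` for `1`) and
degeneracies `s i`; indices start at `0`. -/
structure CubicalSet : Type (u + 1) where
  obj : ℕ → Type u
  d : ∀ {n : ℕ}, Fin (n + 1) → Bool → obj (n + 1) → obj n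
  s : ∀ {n : ℕ}, Fin (n + 1) → obj n → obj (n + 1)
  d_d : ∀ {n : ℕ} (i j : Fin (n + 1)) (ε ω : Bool) (x : obj (n + 2)), i ≤ j →
    d j ω (d i.castSucc ε x) = d i ε (d j.succ ω x)
  s_s : ∀ {n : ℕ} (i j : Fin (n + 1)) (x : obj n), i ≤ j →
    s j.succ (s i x) = s i.castSucc (s j x)
  d_s_lt : ∀ {n : ℕ} (i j : Fin (n + 1)) (ε : Bool) (x : obj (n + 1)), i ≤ j →
    d j.succ ε (s i.castSucc x) = s i (d j ε x)
  d_s_eq : ∀ {n : ℕ} (i : Fin (n + 1)) (ε : Bool) (x : obj n), d i ε (s i x) = x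
  d_s_gt : ∀ {n : ℕ} (i j : Fin (n + 1)) (ε : Bool) (x : obj (n + 1)), j ≤ i →
    d j.castSucc ε (s i.succ x) = s i (d j ε x)

/-- Morphisms of cubical sets. -/
@[ext]
structure CubicalHom (X Y : CubicalSet.{u}) where
  app : ∀ n : ℕ, X.obj n → Y.obj n
  app_d : ∀ {n : ℕ} (i : Fin (n + 1)) (ε : Bool) (x : X.obj (n + 1)),
    app n (X.d i ε x) = Y.d i ε (app (n + 1) x)
  app_s : ∀ {n : ℕ} (i : Fin (n + 1)) (x : X.obj n),
    app (n + 1) (X.s i x) = Y.s i (app n x)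

instance : Category CubicalSet.{u} where
  Hom X Y := CubicalHom X Y
  id X := { app := fun _ x => x, app_d := fun _ _ _ => rfl, app_s := fun _ _ => rfl }
  comp f g :=
    { app := fun n x => g.app n (f.app n x)
      app_d := by intro n i ε x; rw [f.app_d, g.app_d]
      app_s := by intro n i x; rw [f.app_s, g.app_s] }

/-! ### Inserting and removing coordinates -/

/-- `(x_1, …, x_{i-1}, e, x_i, …, x_n)`. -/
def ins {α : Type u} {n : ℕ} (i : Fin (n + 1)) (e : α) (x : Fin n → α) : Fin (n + 1) → α :=
  Fin.insertNth (α := fun _ => α) i e x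

/-- `(x_1, …, x_{i-1}, x_{i+1}, …, x_n)`. -/
def del {α : Type u} {n : ℕ} (i : Fin (n + 1)) (x : Fin (n + 1) → α) : Fin n → α :=
  fun j => x (i.succAbove j)

theorem ins_apply {α : Type u} {n : ℕ} (i : Fin (n + 1)) (e : α) (x : Fin n → α)
    (j : Fin (n + 1)) :
    ins i e x j = if h : j.val < i.val then x ⟨j.val, by omega⟩
      else if h' : i.val < j.val then x ⟨j.val - 1, by omega⟩ else e := by
  induction j using Fin.succAboveCases i with
  | x => simp [ins]
  | p j =>
    simp only [ins, Fin.insertNth_apply_succAbove]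
    by_cases h : j.castSucc < i
    · rw [Fin.succAbove_of_castSucc_lt _ _ h]
      have h1 : j.val < i.val := h
      simp [h1]
    · rw [Fin.succAbove_of_le_castSucc _ _ (not_lt.mp h)]
      have h1 : i.val ≤ j.val := not_lt.mp h
      have h2 : ¬ (j.val + 1 < i.val) := by omega
      have h3 : i.val < j.val + 1 := by omega
      simp [h2, h3]

theorem del_apply {α : Type u} {n : ℕ} (i : Fin (n + 1)) (x : Fin (n + 1) → α) (j : Fin n) :
    del i x j = if j.val < i.val then x j.castSucc else x j.succ := by
  simp only [del, Fin.succAbove, Fin.lt_def, Fin.val_castSucc]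
  split_ifs <;> rfl

theorem ins_ins {α : Type u} {n : ℕ} (i j : Fin (n + 1)) (hij : i ≤ j) (ε ω : α)
    (a : Fin n → α) : ins i.castSucc ε (ins j ω a) = ins j.succ ω (ins i ε a) := by
  have hij' : i.val ≤ j.val := hij
  funext l
  simp only [del_apply, ins_apply, Fin.val_succ, Fin.val_castSucc]
  split_ifs <;> first | omega | rfl | (congr 1; apply Fin.ext; simp; omega)

theorem del_del {α : Type u} {n : ℕ} (i j : Fin (n + 1)) (hij : i ≤ j) (a : Fin (n + 2) → α) :
    del i (del j.succ a) = del j (del i.castSucc a) := by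
  have hij' : i.val ≤ j.val := hij
  funext l
  simp only [del_apply, ins_apply, Fin.val_succ, Fin.val_castSucc]
  split_ifs <;> first | omega | rfl | (congr 1; apply Fin.ext; simp; omega)

theorem del_ins_lt {α : Type u} {n : ℕ} (i j : Fin (n + 1)) (hij : i ≤ j) (ε : α)
    (a : Fin (n + 1) → α) : del i.castSucc (ins j.succ ε a) = ins j ε (del i a) := by
  have hij' : i.val ≤ j.val := hij
  funext l
  simp only [del_apply, ins_apply, Fin.val_succ, Fin.val_castSucc]
  split_ifs <;> first | omega | rfl | (congr 1; apply Fin.ext; simp; omega)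

theorem del_ins_eq {α : Type u} {n : ℕ} (i : Fin (n + 1)) (ε : α) (a : Fin n → α) :
    del i (ins i ε a) = a := by
  funext l
  simp only [del_apply, ins_apply, Fin.val_succ, Fin.val_castSucc]
  split_ifs <;> first | omega | rfl | (congr 1; apply Fin.ext; simp; omega)

theorem del_ins_gt {α : Type u} {n : ℕ} (i j : Fin (n + 1)) (hij : j ≤ i) (ε : α)
    (a : Fin (n + 1) → α) : del i.succ (ins j.castSucc ε a) = ins j ε (del i a) := by
  have hij' : j.val ≤ i.val := hij
  funext l
  simp only [del_apply, ins_apply, Fin.val_succ, Fin.val_castSucc]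
  split_ifs <;> first | omega | rfl | (congr 1; apply Fin.ext; simp; omega)

theorem ins_le_ins {α : Type u} [PartialOrder α] {n : ℕ} (i : Fin (n + 1)) (ε : α)
    {a b : Fin n → α} (h : a ≤ b) : ins i ε a ≤ ins i ε b := by
  intro j
  simp only [ins_apply]
  split_ifs <;> first | exact h _ | exact le_refl _

theorem map_ins {α β : Type u} (f : α → β) {n : ℕ} (i : Fin (n + 1)) (e : α) (x : Fin n → α)
    (j : Fin (n + 1)) : f (ins i e x j) = ins i (f e) (fun l => f (x l)) j := by
  simp only [ins_apply]
  split_ifs <;> rfl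

/-! ### The nerve of a pointed rack -/

/-- Faces of the nerve of a rack: `d i 0` forgets `x_i`; `d i 1` forgets `x_i` and replaces
`x_j` by `x_j ◁ x_i` for `j < i`. -/
def rackFace {X : Type u} [PointedRack X] {n : ℕ} (i : Fin (n + 1)) (ε : Bool)
    (x : Fin (n + 1) → X) : Fin n → X :=
  fun j => if ε = true ∧ j.val < i.val then ract (del i x j) (x i) else del i x j

theorem rackFace_apply {X : Type u} [PointedRack X] {n : ℕ} (i : Fin (n + 1)) (ε : Bool)
    (x : Fin (n + 1) → X) (j : Fin n) :
    rackFace i ε x j = if j.val < i.val then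
      (if ε = true then ract (x j.castSucc) (x i) else x j.castSucc) else x j.succ := by
  unfold rackFace
  rw [del_apply]
  split_ifs <;> simp_all

theorem rackFace_lt {X : Type u} [PointedRack X] {n : ℕ} {i : Fin (n + 1)} {ε : Bool}
    {x : Fin (n + 1) → X} {j : Fin n} (h : j.val < i.val) :
    rackFace i ε x j = if ε = true then ract (x j.castSucc) (x i) else x j.castSucc := by
  rw [rackFace_apply, if_pos h]

theorem rackFace_ge {X : Type u} [PointedRack X] {n : ℕ} {i : Fin (n + 1)} {ε : Bool}
    {x : Fin (n + 1) → X} {j : Fin n} (h : i.val ≤ j.val) :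
    rackFace i ε x j = x j.succ := by
  rw [rackFace_apply, if_neg (not_lt.mpr h)]

theorem map_rackFace {X Y : Type u} [PointedRack X] [PointedRack Y] (f : X → Y)
    (hf : ∀ a b, f (ract a b) = ract (f a) (f b)) {n : ℕ} (i : Fin (n + 1)) (ε : Bool)
    (x : Fin (n + 1) → X) (j : Fin n) :
    f (rackFace i ε x j) = rackFace i ε (fun l => f (x l)) j := by
  simp only [rackFace_apply]
  split_ifs <;> simp [hf]

/-- The nerve of a pointed rack. -/
def rackNerveObj (X : PRack.{u}) : CubicalSet.{u} where
  obj n := Fin n → X.carrier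
  d := rackFace
  s i x := ins i PointedRack.pt x
  d_d := by
    intro n i j ε ω x hij
    have hij' : i.val ≤ j.val := hij
    funext l
    have e1 : rackFace i.castSucc ε x j = x j.succ := rackFace_ge (by simpa using hij')
    rcases lt_or_ge l.val i.val with h | h
    · rw [rackFace_lt (i := j) (by omega), rackFace_lt (i := i) h, e1,
        rackFace_lt (i := i.castSucc) (by simpa using h),
        rackFace_lt (i := j.succ) (j := l.castSucc) (by simp; omega),
        rackFace_lt (i := j.succ) (j := i) (by simp; omega)]
      cases ε <;> cases ω <;> first | rfl | exact ract_ract _ _ _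
    · rw [rackFace_ge (i := i) h]
      rcases lt_or_ge l.val j.val with h2 | h2
      · rw [rackFace_lt (i := j) h2, e1, rackFace_ge (i := i.castSucc) (by simpa using h),
          rackFace_lt (i := j.succ) (by simpa using h2)]
        simp
      · rw [rackFace_ge (i := j) h2, rackFace_ge (i := i.castSucc) (by simp; omega),
          rackFace_ge (i := j.succ) (by simpa using h2)]
  s_s := fun i j x hij => (ins_ins i j hij _ _ x).symm
  d_s_lt := by
    intro n i j ε x hij
    have hij' : i.val ≤ j.val := hij
    funext l
    have e1 : (j.val + 1 < i.val) = False := by simp; omega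
    have e2 : (i.val < j.val + 1) = True := by simp; omega
    cases ε <;>
    simp only [ins_apply, rackFace_apply, Fin.val_succ, Fin.val_castSucc, e1, e2, if_true, if_false,
      dite_true, dite_false, Bool.false_eq_true] <;>
    split_ifs <;> first | omega | rfl | exact pt_ract _ | (congr 1 <;> apply Fin.ext <;> simp <;> omega)
  d_s_eq := by
    intro n i ε x
    funext l
    cases ε <;>
    simp only [ins_apply, rackFace_apply, Fin.val_succ, Fin.val_castSucc, if_true, if_false,
      Bool.false_eq_true] <;>
    split_ifs <;> first | omega | rfl | exact ract_pt _ | (congr 1 <;> apply Fin.ext <;> simp <;> omega)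
  d_s_gt := by
    intro n i j ε x hij
    have hij' : j.val ≤ i.val := hij
    funext l
    cases ε <;>
    simp only [ins_apply, rackFace_apply, Fin.val_succ, Fin.val_castSucc, if_true, if_false,
      Bool.false_eq_true] <;>
    split_ifs <;> first | omega | rfl | exact pt_ract _ | (congr 1 <;> apply Fin.ext <;> simp <;> omega)

/-- The nerve functor `Rack ⥤ cSet`. -/
def rackNerve : PRack.{u} ⥤ CubicalSet.{u} where
  obj := rackNerveObj
  map {X Y} f :=
    { app := fun _ x j => f.toFun (x j)
      app_d := fun i ε x => funext fun j =>
        map_rackFace f.toFun (fun _ _ => f.map_act') i ε x j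
      app_s := fun i x => funext fun j =>
        (map_ins f.toFun i _ x j).trans (congrArg (fun e => ins i e _ j) f.map_pt) }

/-! ### The cubical nerve of a category -/

/-- The poset `{0,1}^n`. -/
def Cube (n : ℕ) : Type := Fin n → Bool

instance (n : ℕ) : PartialOrder (Cube n) := inferInstanceAs (PartialOrder (Fin n → Bool))

theorem ins_monotone {n : ℕ} (i : Fin (n + 1)) (ε : Bool) :
    Monotone (fun a : Cube n => (ins i ε a : Cube (n + 1))) :=
  fun _ _ h => ins_le_ins (α := Bool) i ε h

theorem del_monotone {n : ℕ} (i : Fin (n + 1)) :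
    Monotone (fun a : Cube (n + 1) => (del i a : Cube n)) :=
  fun _ _ h _ => h _

/-- `δ_{i,ε}`, as a functor between posets. -/
def cubeδ {n : ℕ} (i : Fin (n + 1)) (ε : Bool) : Cube n ⥤ Cube (n + 1) :=
  (ins_monotone i ε).functor

/-- `σ_i`, as a functor between posets. -/
def cubeσ {n : ℕ} (i : Fin (n + 1)) : Cube (n + 1) ⥤ Cube n :=
  (del_monotone i).functor

theorem cube_functor_ext {m n : ℕ} {F G : Cube m ⥤ Cube n} (h : ∀ a, F.obj a = G.obj a) : F = G :=
  CategoryTheory.Functor.ext h (fun _ _ _ => Subsingleton.elim _ _)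

/-- The cubical nerve of a category `C`: its `n`-cubes are the functors `{0,1}^n ⥤ C`. -/
def cubicalNerveObj (C : Type v) [Category.{u} C] : CubicalSet.{max u v} where
  obj n := Cube n ⥤ C
  d i ε F := cubeδ i ε ⋙ F
  s i F := cubeσ i ⋙ F
  d_d := by
    intro n i j ε ω x hij
    change (cubeδ j ω ⋙ cubeδ i.castSucc ε) ⋙ x = (cubeδ i ε ⋙ cubeδ j.succ ω) ⋙ x
    congr 1
    apply cube_functor_ext
    intro a
    exact ins_ins i j hij ε ω a
  s_s := by
    intro n i j x hij
    change (cubeσ j.succ ⋙ cubeσ i) ⋙ x = (cubeσ i.castSucc ⋙ cubeσ j) ⋙ x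
    congr 1
    apply cube_functor_ext
    intro a
    exact del_del i j hij a
  d_s_lt := by
    intro n i j ε x hij
    change (cubeδ j.succ ε ⋙ cubeσ i.castSucc) ⋙ x = (cubeσ i ⋙ cubeδ j ε) ⋙ x
    congr 1
    apply cube_functor_ext
    intro a
    exact del_ins_lt i j hij ε a
  d_s_eq := by
    intro n i ε x
    change (cubeδ i ε ⋙ cubeσ i) ⋙ x = 𝟭 _ ⋙ x
    congr 1
    apply cube_functor_ext
    intro a
    exact del_ins_eq i ε a
  d_s_gt := by
    intro n i j ε x hij
    change (cubeδ j.castSucc ε ⋙ cubeσ i.succ) ⋙ x = (cubeσ i ⋙ cubeδ j ε) ⋙ x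
    congr 1
    apply cube_functor_ext
    intro a
    exact del_ins_gt i j hij ε a

/-- The cubical nerve of a group `G`, regarded as a groupoid with one object in which
`g` followed by `h` is `gh` (Mathlib's convention for `SingleObj` is the opposite one). -/
def groupNerve : GrpCat.{u} ⥤ CubicalSet.{u} where
  obj G := cubicalNerveObj (SingleObj Gᵐᵒᵖ)
  map {G H} f :=
    { app := fun _ F => F ⋙ (MonoidHom.op f.hom).toFunctor
      app_d := fun _ _ _ => rfl
      app_s := fun _ _ => rfl }

/-! ### Iterated faces and the functor `L` -/

/-- The iterated face `d_{i_1,ε_1} ⋯ d_{i_r,ε_r}` from `X_n` to `X_m`, `m + r = n`; the face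
`d_{i_r,ε_r}` is applied first. Indices start at `0` and are natural numbers; they are only used
when `i_a ≤ m + a`. -/
def iterFace (X : CubicalSet.{u}) : ∀ (r : ℕ) (_ : Fin r → ℕ) (_ : Fin r → Bool) {m n : ℕ}
    (_ : m + r = n), X.obj n → X.obj m
  | 0, _, _, _, _, h, x => cast (congrArg X.obj h.symm) x
  | _ + 1, _, _, _, 0, h, _ => absurd h (by omega)
  | r + 1, i, ε, _, n + 1, h, x =>
    iterFace X r (fun a => i a.castSucc) (fun a => ε a.castSucc) (by omega)
      (X.d (Fin.ofNat (n + 1) (i (Fin.last r))) (ε (Fin.last r)) x)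

/-- `x ∈ X_n` belongs to `LX_n` if for all `1 ≤ k ≤ n` the iterated faces
`d_{1,ε_1} ⋯ d_{1,ε_k} x` are independent of `ε ∈ {0,1}^k`. -/
def IsLCube (X : CubicalSet.{u}) (n : ℕ) (x : X.obj n) : Prop :=
  ∀ (m k : ℕ) (h : m + k = n) (ε ε' : Fin k → Bool),
    iterFace X k (fun _ => 0) ε h x = iterFace X k (fun _ => 0) ε' h x

theorem isLCube_zero (X : CubicalSet.{u}) (x : X.obj 0) : IsLCube X 0 x := by
  intro m k h ε ε'
  obtain rfl : k = 0 := by omega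
  rfl

theorem isLCube_succ (X : CubicalSet.{u}) (n : ℕ) (x : X.obj (n + 1)) :
    IsLCube X (n + 1) x ↔
      (∀ ε ε' : Bool, X.d 0 ε x = X.d 0 ε' x) ∧ ∀ ε, IsLCube X n (X.d 0 ε x) := by
  constructor
  · intro H
    refine ⟨fun ε ε' => by simpa [iterFace] using H n 1 rfl (fun _ => ε) (fun _ => ε'), ?_⟩
    intro ε m k h ω ω'
    have := H m (k + 1) (by omega) (Fin.snoc (α := fun _ => Bool) ω ε)
      (Fin.snoc (α := fun _ => Bool) ω' ε)
    simpa [iterFace] using this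
  · rintro ⟨h0, h1⟩ m k h ε ε'
    cases k with
    | zero => rfl
    | succ k =>
      change iterFace X k _ _ _ (X.d _ _ x) = iterFace X k _ _ _ (X.d _ _ x)
      have e0 : Fin.ofNat (n + 1) 0 = 0 := rfl
      simp only [e0]
      rw [h0 (ε' (Fin.last k)) (ε (Fin.last k))]
      exact h1 _ m k (by omega) _ _

theorem isLCube_d (X : CubicalSet.{u}) (n : ℕ) (i : Fin (n + 1)) (ε : Bool) (x : X.obj (n + 1))
    (hx : IsLCube X (n + 1) x) : IsLCube X n (X.d i ε x) := by
  induction n with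
  | zero => exact isLCube_zero X _
  | succ n ih =>
    rw [isLCube_succ] at hx
    induction i using Fin.cases with
    | zero => exact hx.2 ε
    | succ j =>
      have key : ∀ ω, X.d 0 ω (X.d j.succ ε x) = X.d j ε (X.d 0 ω x) := fun ω =>
        (X.d_d 0 j ω ε x (Fin.zero_le _)).symm
      rw [isLCube_succ]
      refine ⟨fun ω ω' => by rw [key, key, hx.1 ω ω'], fun ω => ?_⟩
      rw [key]
      exact ih j _ (hx.2 ω)

theorem isLCube_s (X : CubicalSet.{u}) (n : ℕ) (i : Fin (n + 1)) (x : X.obj n)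
    (hx : IsLCube X n x) : IsLCube X (n + 1) (X.s i x) := by
  induction n with
  | zero =>
    obtain rfl : i = 0 := Fin.ext (by omega)
    rw [isLCube_succ]
    refine ⟨fun ω ω' => by rw [X.d_s_eq, X.d_s_eq], fun ω => by rwa [X.d_s_eq]⟩
  | succ n ih =>
    rw [isLCube_succ]
    induction i using Fin.cases with
    | zero => exact ⟨fun ω ω' => by rw [X.d_s_eq, X.d_s_eq], fun ω => by rwa [X.d_s_eq]⟩
    | succ j =>
      have key : ∀ ω, X.d 0 ω (X.s j.succ x) = X.s j (X.d 0 ω x) := fun ω =>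
        X.d_s_gt j 0 ω x (Fin.zero_le _)
      rw [isLCube_succ] at hx
      refine ⟨fun ω ω' => by rw [key, key, hx.1 ω ω'], fun ω => ?_⟩
      rw [key]
      exact ih j _ (hx.2 ω)

theorem iterFace_app {X Y : CubicalSet.{u}} (f : X ⟶ Y) (r : ℕ) : ∀ (i : Fin r → ℕ)
    (ε : Fin r → Bool) {m n : ℕ} (h : m + r = n) (x : X.obj n),
    f.app m (iterFace X r i ε h x) = iterFace Y r i ε h (f.app n x) := by
  induction r with
  | zero =>
    intro i ε m n h x
    subst h
    rfl
  | succ r ih =>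
    intro i ε m n h x
    cases n with
    | zero => omega
    | succ n =>
      simp only [iterFace]
      rw [ih, f.app_d]

/-- The functor `L`. It is used for cubical sets with exactly one vertex, so that `LX_0 = X_0` is
a point. -/
def LFunctor : CubicalSet.{u} ⥤ CubicalSet.{u} where
  obj X :=
    { obj := fun n => {x : X.obj n // IsLCube X n x}
      d := fun i ε x => ⟨X.d i ε x.1, isLCube_d X _ i ε x.1 x.2⟩
      s := fun i x => ⟨X.s i x.1, isLCube_s X _ i x.1 x.2⟩
      d_d := fun i j ε ω x h => Subtype.ext (X.d_d i j ε ω x.1 h)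
      s_s := fun i j x h => Subtype.ext (X.s_s i j x.1 h)
      d_s_lt := fun i j ε x h => Subtype.ext (X.d_s_lt i j ε x.1 h)
      d_s_eq := fun i ε x => Subtype.ext (X.d_s_eq i ε x.1)
      d_s_gt := fun i j ε x h => Subtype.ext (X.d_s_gt i j ε x.1 h) }
  map {X Y} f :=
    { app := fun n x => ⟨f.app n x.1, fun m k h ε ε' => by
        rw [← iterFace_app, ← iterFace_app, x.2 m k h ε ε']⟩
      app_d := fun i ε x => Subtype.ext (f.app_d i ε x.1)
      app_s := fun i x => Subtype.ext (f.app_s i x.1) }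

/-! ### Normalized cubical chains and homology -/

section Homology

variable (k : Type v) [Field k]

/-- The span of the degenerate cubes. -/
def degen (X : CubicalSet.{u}) : ∀ n : ℕ, Submodule k (X.obj n →₀ k)
  | 0 => ⊥
  | n + 1 => Submodule.span k
      (Set.range fun p : Fin (n + 1) × X.obj n => Finsupp.single (X.s p.1 p.2) (1 : k))

/-- Normalized chains `C_n(X)`: free module on `X_n` modulo degenerate cubes. -/
abbrev Chain (X : CubicalSet.{u}) (n : ℕ) : Type (max u v) := (X.obj n →₀ k) ⧸ degen k X n

/-- `∑_i (-1)^{i+1} (d_{i,1} - d_{i,0})` (with `i` starting at `1`) on unnormalized chains. -/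
def preBoundary (X : CubicalSet.{u}) (n : ℕ) : (X.obj (n + 1) →₀ k) →ₗ[k] (X.obj n →₀ k) :=
  ∑ i : Fin (n + 1), (-1 : k) ^ (i : ℕ) •
    (Finsupp.lmapDomain k k (X.d i true) - Finsupp.lmapDomain k k (X.d i false))

theorem single_s_mem_degen (X : CubicalSet.{u}) (n : ℕ) (i : Fin (n + 1)) (x : X.obj n) :
    Finsupp.single (X.s i x) (1 : k) ∈ degen k X (n + 1) :=
  Submodule.subset_span ⟨(i, x), rfl⟩

theorem d_s_mem_degen (X : CubicalSet.{u}) (n : ℕ) (i j : Fin (n + 2)) (hij : i ≠ j) (ε : Bool)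
    (x : X.obj (n + 1)) :
    Finsupp.single (X.d j ε (X.s i x)) (1 : k) ∈ degen k X (n + 1) := by
  rcases lt_or_gt_of_ne hij with h | h
  · have hi : i.val < n + 1 := by have := j.isLt; have : i.val < j.val := h; omega
    have hj : 0 < j.val := by have : i.val < j.val := h; omega
    obtain ⟨j, rfl⟩ : ∃ j' : Fin (n + 1), j = j'.succ := ⟨⟨j.val - 1, by omega⟩, by
      apply Fin.ext; simp; omega⟩
    obtain ⟨i, rfl⟩ : ∃ i' : Fin (n + 1), i = i'.castSucc := ⟨⟨i.val, hi⟩, rfl⟩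
    rw [X.d_s_lt i j ε x (by have : i.val < j.val + 1 := h; exact Nat.lt_succ_iff.mp this)]
    exact single_s_mem_degen k X n _ _
  · have hj : j.val < n + 1 := by have := i.isLt; have : j.val < i.val := h; omega
    have hi : 0 < i.val := by have : j.val < i.val := h; omega
    obtain ⟨i, rfl⟩ : ∃ i' : Fin (n + 1), i = i'.succ := ⟨⟨i.val - 1, by omega⟩, by
      apply Fin.ext; simp; omega⟩
    obtain ⟨j, rfl⟩ : ∃ j' : Fin (n + 1), j = j'.castSucc := ⟨⟨j.val, hj⟩, rfl⟩
    rw [X.d_s_gt i j ε x (by have : j.val < i.val + 1 := h; exact Nat.lt_succ_iff.mp this)]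
    exact single_s_mem_degen k X n _ _

theorem preBoundary_degen (X : CubicalSet.{u}) (n : ℕ) :
    degen k X (n + 1) ≤ (degen k X n).comap (preBoundary k X n) := by
  refine Submodule.span_le.mpr ?_
  rintro _ ⟨⟨i, x⟩, rfl⟩
  change preBoundary k X n (Finsupp.single (X.s i x) 1) ∈ degen k X n
  simp only [preBoundary, LinearMap.sum_apply, LinearMap.smul_apply, LinearMap.sub_apply,
    Finsupp.lmapDomain_apply, Finsupp.mapDomain_single]
  refine Submodule.sum_mem _ fun j _ => Submodule.smul_mem _ _ ?_
  by_cases hij : i = j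
  · subst hij
    rw [X.d_s_eq, X.d_s_eq, sub_self]
    exact Submodule.zero_mem _
  · cases n with
    | zero => exact absurd (Fin.ext (by omega)) hij
    | succ n =>
      exact Submodule.sub_mem _ (d_s_mem_degen k X n i j hij _ x) (d_s_mem_degen k X n i j hij _ x)

/-- The differential `C_{n+1}(X) → C_n(X)`. -/
def boundary (X : CubicalSet.{u}) (n : ℕ) : Chain k X (n + 1) →ₗ[k] Chain k X n :=
  Submodule.mapQ _ _ (preBoundary k X n) (preBoundary_degen k X n)

/-- The cycles `Z_n(X) ⊆ C_n(X)`. -/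
def cycles (X : CubicalSet.{u}) : ∀ n : ℕ, Submodule k (Chain k X n)
  | 0 => ⊤
  | n + 1 => LinearMap.ker (boundary k X n)

/-- The boundaries `B_n(X) ⊆ C_n(X)`. -/
def boundaries (X : CubicalSet.{u}) (n : ℕ) : Submodule k (Chain k X n) :=
  LinearMap.range (boundary k X n)

/-- The homology `H_n(X, k) = Z_n(X) / B_n(X)` of the normalized chains of a cubical set. -/
def Homology (X : CubicalSet.{u}) (n : ℕ) : Type (max u v) :=
  cycles k X n ⧸ (boundaries k X n).submoduleOf (cycles k X n)

instance (X : CubicalSet.{u}) (n : ℕ) : AddCommGroup (Homology k X n) :=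
  inferInstanceAs (AddCommGroup (cycles k X n ⧸ (boundaries k X n).submoduleOf (cycles k X n)))

instance (X : CubicalSet.{u}) (n : ℕ) : Module k (Homology k X n) :=
  inferInstanceAs (Module k (cycles k X n ⧸ (boundaries k X n).submoduleOf (cycles k X n)))

/-- The homology class of a cycle. -/
def homologyClass (X : CubicalSet.{u}) (n : ℕ) : cycles k X n →ₗ[k] Homology k X n :=
  Submodule.mkQ ((boundaries k X n).submoduleOf (cycles k X n))

theorem homologyClass_surjective (X : CubicalSet.{u}) (n : ℕ) :
    Function.Surjective (homologyClass k X n) :=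
  Submodule.mkQ_surjective _

variable {X Y Z : CubicalSet.{u}}

theorem lmapDomain_degen (f : X ⟶ Y) (n : ℕ) :
    degen k X n ≤ (degen k Y n).comap (Finsupp.lmapDomain k k (f.app n)) := by
  cases n with
  | zero => exact bot_le
  | succ n =>
    refine Submodule.span_le.mpr ?_
    rintro _ ⟨⟨i, x⟩, rfl⟩
    change Finsupp.lmapDomain k k (f.app (n + 1)) (Finsupp.single (X.s i x) 1) ∈
      degen k Y (n + 1)
    rw [Finsupp.lmapDomain_apply, Finsupp.mapDomain_single, f.app_s]
    exact single_s_mem_degen k Y n _ _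

/-- The map induced on normalized chains. -/
def chainMap (f : X ⟶ Y) (n : ℕ) : Chain k X n →ₗ[k] Chain k Y n :=
  Submodule.mapQ _ _ (Finsupp.lmapDomain k k (f.app n)) (lmapDomain_degen k f n)

theorem chainMap_boundary (f : X ⟶ Y) (n : ℕ) (c : Chain k X (n + 1)) :
    chainMap k f n (boundary k X n c) = boundary k Y n (chainMap k f (n + 1) c) := by
  have key : Finsupp.lmapDomain k k (f.app n) ∘ₗ preBoundary k X n
      = preBoundary k Y n ∘ₗ Finsupp.lmapDomain k k (f.app (n + 1)) := by
    ext x : 2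
    simp [preBoundary, map_sum, map_sub, Finsupp.mapDomain_sub, Finsupp.mapDomain_single, f.app_d]
  obtain ⟨c, rfl⟩ := Submodule.mkQ_surjective _ c
  exact congrArg (Submodule.mkQ (degen k Y n)) (LinearMap.congr_fun key c)

theorem chainMap_cycles (f : X ⟶ Y) (n : ℕ) :
    cycles k X n ≤ (cycles k Y n).comap (chainMap k f n) := by
  cases n with
  | zero => exact fun _ _ => Submodule.mem_top
  | succ n =>
    intro c hc
    change boundary k Y n (chainMap k f (n + 1) c) = 0
    rw [← chainMap_boundary, (LinearMap.mem_ker.mp hc : boundary k X n c = 0), map_zero]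

/-- The map induced on cycles. -/
def cyclesMap (f : X ⟶ Y) (n : ℕ) : cycles k X n →ₗ[k] cycles k Y n :=
  (chainMap k f n).restrict (chainMap_cycles k f n)

/-- The map induced on homology. -/
def homologyMap (f : X ⟶ Y) (n : ℕ) : Homology k X n →ₗ[k] Homology k Y n :=
  Submodule.mapQ ((boundaries k X n).submoduleOf (cycles k X n))
    ((boundaries k Y n).submoduleOf (cycles k Y n)) (cyclesMap k f n) (by
    rintro ⟨c, hc⟩ ⟨b, hb⟩
    exact ⟨chainMap k f (n + 1) b, by rw [← chainMap_boundary, hb]; rfl⟩)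

theorem chainMap_id (n : ℕ) (c : Chain k X n) : chainMap k (𝟙 X) n c = c := by
  obtain ⟨c, rfl⟩ := Submodule.mkQ_surjective _ c
  exact congrArg (Submodule.mkQ (degen k X n)) (Finsupp.mapDomain_id (v := c))

theorem chainMap_comp (f : X ⟶ Y) (g : Y ⟶ Z) (n : ℕ) (c : Chain k X n) :
    chainMap k (f ≫ g) n c = chainMap k g n (chainMap k f n c) := by
  obtain ⟨c, rfl⟩ := Submodule.mkQ_surjective _ c
  exact congrArg (Submodule.mkQ (degen k Z n))
    (Finsupp.mapDomain_comp (v := c) (f := f.app n) (g := g.app n))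

theorem homologyMap_id (n : ℕ) : homologyMap k (𝟙 X) n = LinearMap.id := by
  refine LinearMap.ext fun a => ?_
  obtain ⟨⟨c, hc⟩, rfl⟩ := homologyClass_surjective k X n a
  exact congrArg (homologyClass k X n) (Subtype.ext (chainMap_id k n c))

theorem homologyMap_comp (f : X ⟶ Y) (g : Y ⟶ Z) (n : ℕ) :
    homologyMap k (f ≫ g) n = homologyMap k g n ∘ₗ homologyMap k f n := by
  refine LinearMap.ext fun a => ?_
  obtain ⟨⟨c, hc⟩, rfl⟩ := homologyClass_surjective k X n a
  exact congrArg (homologyClass k Z n) (Subtype.ext (chainMap_comp k f g n c))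

end Homology

/-! ### Graded coZinbiel coalgebras -/

section CoZinbiel

variable (k : Type v) [Field k]

/-- The component `C_p ⊗ C_q → C_q ⊗ C_p` of the graded flip `τ(x ⊗ y) = (-1)^{|x||y|} y ⊗ x`. -/
def gradedFlip (C : ℕ → Type w) [∀ n, AddCommGroup (C n)] [∀ n, Module k (C n)] (p q : ℕ) :
    C p ⊗[k] C q →ₗ[k] C q ⊗[k] C p :=
  (-1 : k) ^ (p * q) • (TensorProduct.comm k (C p) (C q)).toLinearMap

/-- A counital connected graded coZinbiel coalgebra structure on a graded vector space `C`.
The coproduct `Δ = Δ_≺` is given by its components `C_n → C_p ⊗ C_q`, `p + q = n`. It is only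
defined in positive degrees, because `Δ` is not defined on the unit `1 ∈ C_0`; each identity is
imposed in those multidegrees in which all its terms are defined. In multidegrees `p, q, r ≥ 1`
the identity `coZinbiel` says that the positive part of `C` is a coZinbiel coalgebra. -/
structure CoZinbiel (C : ℕ → Type w) [∀ n, AddCommGroup (C n)] [∀ n, Module k (C n)] where
  comul : ∀ {n : ℕ} (p q : ℕ), 0 < n → p + q = n → C n →ₗ[k] C p ⊗[k] C q
  counit : C 0 →ₗ[k] k
  /-- `C = k ⊕ C_{≥ 1}` -/
  counit_bijective : Function.Bijective counit
  /-- `(c ⊗ id) ∘ Δ = 0` -/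
  counit_left : ∀ {n : ℕ} (hn : 0 < n),
    counit.rTensor (C n) ∘ₗ comul 0 n hn (zero_add n) = 0
  /-- `(id ⊗ c) ∘ Δ = id` -/
  counit_right : ∀ {n : ℕ} (hn : 0 < n),
    (TensorProduct.rid k (C n)).toLinearMap ∘ₗ counit.lTensor (C n) ∘ₗ
      comul n 0 hn (add_zero n) = LinearMap.id
  /-- `(Δ ⊗ id) ∘ Δ = (id ⊗ Δ + id ⊗ (τ ∘ Δ)) ∘ Δ` -/
  coZinbiel : ∀ {n : ℕ} (p q r : ℕ) (hn : 0 < n) (h : p + q + r = n)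
    (hpq : 0 < p + q) (hqr : 0 < q + r),
    (TensorProduct.assoc k (C p) (C q) (C r)).toLinearMap ∘ₗ
        (comul p q hpq rfl).rTensor (C r) ∘ₗ comul (p + q) r hn h =
      (comul q r hqr rfl + gradedFlip k C r q ∘ₗ comul r q hqr (add_comm r q)).lTensor (C p) ∘ₗ
        comul p (q + r) hn ((add_assoc p q r).symm.trans h)

variable {k}

/-- Compatibility of a graded linear map with coproducts and counits. -/
structure IsCoZinbielHom {C D : ℕ → Type w} [∀ n, AddCommGroup (C n)] [∀ n, Module k (C n)]
    [∀ n, AddCommGroup (D n)] [∀ n, Module k (D n)] (δ : CoZinbiel k C) (δ' : CoZinbiel k D)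
    (f : ∀ n, C n →ₗ[k] D n) : Prop where
  map_comul : ∀ {n : ℕ} (p q : ℕ) (hn : 0 < n) (h : p + q = n),
    TensorProduct.map (f p) (f q) ∘ₗ δ.comul p q hn h = δ'.comul p q hn h ∘ₗ f n
  map_counit : δ'.counit ∘ₗ f 0 = δ.counit

variable (k)

/-- The category `Zinb^c` of (counital connected graded) coZinbiel coalgebras over `k`. -/
structure CoZinb : Type (max v (w + 1)) where
  carrier : ℕ → Type w
  [addCommGroup : ∀ n, AddCommGroup (carrier n)]
  [module : ∀ n, Module k (carrier n)]
  str : CoZinbiel k carrier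

attribute [instance] CoZinb.addCommGroup CoZinb.module

/-- Morphisms of coZinbiel coalgebras. -/
@[ext]
structure CoZinbHom (C D : CoZinb.{v, w} k) where
  map : ∀ n, C.carrier n →ₗ[k] D.carrier n
  isHom : IsCoZinbielHom C.str D.str map

instance : Category (CoZinb.{v, w} k) where
  Hom C D := CoZinbHom k C D
  id C :=
    { map := fun _ => LinearMap.id
      isHom :=
        { map_comul := by intros; rw [TensorProduct.map_id]; rfl
          map_counit := rfl } }
  comp f g :=
    { map := fun n => g.map n ∘ₗ f.map n
      isHom :=
        { map_comul := by
            intro n p q hn h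
            rw [TensorProduct.map_comp, LinearMap.comp_assoc, f.isHom.map_comul,
              ← LinearMap.comp_assoc, g.isHom.map_comul, LinearMap.comp_assoc]
          map_counit := by
            rw [← LinearMap.comp_assoc, g.isHom.map_counit, f.isHom.map_counit] } }

/-- The functor to coZinbiel coalgebras given by a natural coZinbiel structure on the homology
of the cubical sets `N c`. -/
def coZinbFunctor {𝒞 : Type*} [Category 𝒞] (N : 𝒞 ⥤ CubicalSet.{u})
    (δ : ∀ c : 𝒞, CoZinbiel k (Homology k (N.obj c)))
    (hδ : ∀ (c c' : 𝒞) (f : c ⟶ c'),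
      IsCoZinbielHom (δ c) (δ c') (fun n => homologyMap k (N.map f) n)) :
    𝒞 ⥤ CoZinb.{v, max u v} k where
  obj c := { carrier := Homology k (N.obj c), str := δ c }
  map {c c'} f := { map := fun n => homologyMap k (N.map f) n, isHom := hδ c c' f }
  map_id c := by
    apply CoZinbHom.ext
    funext n
    simp only [N.map_id]
    exact homologyMap_id k n
  map_comp f g := by
    apply CoZinbHom.ext
    funext n
    simp only [N.map_comp]
    exact homologyMap_comp k _ _ n

end CoZinbiel

/-! ### Half-shuffles and the coproduct -/

section Coproduct

variable (k : Type v) [Field k]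

/-- The index `σ(a)`, `1 ≤ a ≤ p` (with `a` starting at `0`). -/
def shLeft {n p q : ℕ} (h : p + q = n) (σ : Equiv.Perm (Fin n)) (a : Fin p) : Fin n :=
  σ ⟨a.val, by omega⟩

/-- The index `σ(p + b)`, `1 ≤ b ≤ q` (with `b` starting at `0`). -/
def shRight {n p q : ℕ} (h : p + q = n) (σ : Equiv.Perm (Fin n)) (b : Fin q) : Fin n :=
  σ ⟨p + b.val, by omega⟩

/-- `σ ∈ Sh^1_{p,q}`: `σ` is a `(p,q)`-shuffle with `p ≥ 1` and `σ(1) = 1`. -/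
def IsHalfShuffle {n p q : ℕ} (h : p + q = n) (σ : Equiv.Perm (Fin n)) : Prop :=
  StrictMono (shLeft h σ) ∧ StrictMono (shRight h σ) ∧
    ∃ hp : 0 < p, (shLeft h σ ⟨0, hp⟩).val = 0

/-- The class in `C_n(X)` of a cube. -/
def cube (X : CubicalSet.{u}) {n : ℕ} (x : X.obj n) : Chain k X n :=
  Submodule.mkQ _ (Finsupp.single x 1)

open Classical in
/-- The half-shuffle coproduct of a cubical set, on a cube `x ∈ X_n`:
`∑_{σ ∈ Sh^1_{p,q}} ε(σ) (d_{σ(p+1),0} ⋯ d_{σ(p+q),0}) x ⊗ (d_{σ(1),1} ⋯ d_{σ(p),1}) x`. -/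
def halfShuffleFaces (X : CubicalSet.{u}) {n : ℕ} (p q : ℕ) (h : p + q = n) :
    (X.obj n →₀ k) →ₗ[k] Chain k X p ⊗[k] Chain k X q :=
  Finsupp.linearCombination k fun x =>
    ∑ σ : Equiv.Perm (Fin n) with IsHalfShuffle h σ,
      ((Equiv.Perm.sign σ : ℤ) : k) •
        (cube k X (iterFace X q (fun b => (shRight h σ b).val) (fun _ => false) h x) ⊗ₜ[k]
          cube k X (iterFace X p (fun a => (shLeft h σ a).val) (fun _ => true)
            ((add_comm q p).trans h) x))

/-- `x_i^σ = x_{σ(i)} ◁ x_{i_1} ◁ ⋯ ◁ x_{i_r}` for `i = p + b`, where `i_1 < ⋯ < i_r` are the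
elements of `{σ(1), …, σ(p)}` larger than `σ(i)`. -/
def twistedEntry {X : Type u} [PointedRack X] {n p q : ℕ} (h : p + q = n)
    (σ : Equiv.Perm (Fin n)) (x : Fin n → X) (b : Fin q) : X :=
  ((List.finRange n).filter fun j =>
      decide ((∃ a : Fin p, shLeft h σ a = j) ∧ shRight h σ b < j)).foldl
    (fun y j => ract y (x j)) (x (shRight h σ b))

open Classical in
/-- The half-shuffle coproduct of a pointed rack, on `(x_1, …, x_n)`:
`∑_{σ ∈ Sh^1_{p,q}} ε(σ) (x_{σ(1)}, …, x_{σ(p)}) ⊗ (x_{p+1}^σ, …, x_{p+q}^σ)`. -/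
def halfShuffleRack (X : PRack.{u}) {n : ℕ} (p q : ℕ) (h : p + q = n) :
    ((rackNerve.obj X).obj n →₀ k) →ₗ[k]
      Chain k (rackNerve.obj X) p ⊗[k] Chain k (rackNerve.obj X) q :=
  Finsupp.linearCombination k fun x : Fin n → X.carrier =>
    ∑ σ : Equiv.Perm (Fin n) with IsHalfShuffle h σ,
      ((Equiv.Perm.sign σ : ℤ) : k) •
        (cube k (rackNerve.obj X) (n := p) (fun a : Fin p => x (shLeft h σ a)) ⊗ₜ[k]
          cube k (rackNerve.obj X) (n := q) (fun b : Fin q => twistedEntry h σ x b))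

/-- The coZinbiel structure `δ` on the homology of the cubical set `X` is induced by the
chain-level formula `D`: the counit takes the class of a vertex to `1`, and for a cycle represented
by `z`, the family `D z` and a representative in `⨁ Z_p ⊗ Z_q` of the coproduct of the class
of `z` differ by a boundary of the complex `C(X) ⊗ C(X)`. (By the Künneth theorem, over
a field this determines the coproduct.) -/
def IsInducedBy (X : CubicalSet.{u})
    (D : ∀ {n : ℕ} (p q : ℕ), p + q = n → (X.obj n →₀ k) →ₗ[k] Chain k X p ⊗[k] Chain k X q)
    (δ : CoZinbiel k (Homology k X)) : Prop :=
  (∀ x : X.obj 0, δ.counit (homologyClass k X 0 ⟨cube k X x, Submodule.mem_top⟩) = 1) ∧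
  ∀ (n : ℕ) (hn : 0 < n) (z : X.obj n →₀ k) (hz : Submodule.mkQ (degen k X n) z ∈ cycles k X n),
    ∃ (w : ∀ p q : ℕ, cycles k X p ⊗[k] cycles k X q)
      (b : ∀ p q : ℕ, Chain k X p ⊗[k] Chain k X q),
      ∀ (p q : ℕ) (h : p + q = n),
        TensorProduct.map (homologyClass k X p) (homologyClass k X q) (w p q) =
          δ.comul p q hn h (homologyClass k X n ⟨_, hz⟩) ∧
        D p q h z =
          TensorProduct.map (cycles k X p).subtype (cycles k X q).subtype (w p q) +
            ((boundary k X p).rTensor (Chain k X q) (b (p + 1) q) +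
              (-1 : k) ^ p • (boundary k X q).lTensor (Chain k X p) (b p (q + 1)))

end Coproduct

/-! ### Rack homology and the `L`-homology of groups -/

/-- The rack homology `HR_n(X, k)`: the homology of the nerve of the pointed rack `X`. -/
abbrev HR (k : Type v) [Field k] (X : PRack.{u}) (n : ℕ) : Type (max u v) :=
  Homology k (rackNerve.obj X) n

/-- The `L`-homology `HL_n(G, k)` of a group: the homology of `L(N^□ G)`. -/
abbrev HL (k : Type v) [Field k] (G : GrpCat.{u}) (n : ℕ) : Type (max u v) :=
  Homology k ((groupNerve ⋙ LFunctor).obj G) n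

end

end RackHomology

open RackHomology

/-!
The two nerves of the theorem share two properties: they have exactly one vertex, and the two first
faces `d_{1,0}` and `d_{1,1}` of each cube agree (`IsReduced`). For every cubical set `X` with these
properties the homology over a field is a coZinbiel coalgebra, naturally in `X`, and this gives both
structures.

The coproduct is half of the Serre diagonal, the map on chains which on each coordinate of a cube is
the diagonal `e ↦ e ⊗ 1 + 0 ⊗ e` of the interval. It is treated by recursion on the dimension: the
`(n+1)`-cubes of `X` are the `n`-cubes of the cubical set `shift X`, in which the first coordinate
is a parameter, and the diagonal of `X` is the diagonal of `shift X` followed by the diagonal of the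
first coordinate (`serre_susp`). All maps here are natural in `X`, so an identity between them
reduces to an identity in the first coordinate. In this way the Serre diagonal is a chain map
(`tensorBoundary_serre`), it is coassociative (`serre_coassoc`), and it is homotopic to its flip
(`serre_sub_totFlip_serre`), the homotopy in one coordinate being `e ⊗ e`. In positive dimension
the diagonal is the sum of `leftHalf` and `rightHalf`, in which the first coordinate goes to the
left and to the right factor. When the first faces agree, the first coordinate does not contribute
to the boundary; hence `leftHalf` is a chain map, and the homotopy for `shift X` shows that
`rightHalf` is homotopic to the flip of `leftHalf`
(`EqualFirstFaces.rightHalf_sub_totFlip_leftHalf`). Coassociativity,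
restricted to the terms in which the first coordinate goes to the leftmost factor, says that
`(L ⊗ 1) L = (1 ⊗ D) L` for `L = leftHalf` and the full diagonal `D` (`leftHalf_coassoc`). As `D`
is the sum of both halves, on homology this becomes the coZinbiel identity.

These maps respect degenerate cubes, since degeneracies in the first coordinate are killed by the
last step of the recursion (`IsNormalStep`), so they descend to normalized chains. Over a field the
complex `C` of normalized chains splits, and its splitting yields a homotopy from the
identity of `C ⊗ C` to the projection onto the tensor product of the homologies
(`IsTensorCycle.kuenneth`). This realizes the Künneth isomorphism: the class of a cycle of `C ⊗ C`
is read off by the tensor square of a retraction of `C` onto its homology.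

A shuffle `σ` with `σ 0 = 0` is the record of the factor to which each coordinate is sent;
removing the first coordinate from it matches the sum over shuffles with the recursion, which gives
the formula by iterated faces (`halfShuffleFaces_single`). Evaluating the iterated faces of the
nerve of a rack gives the formula with the products `x_i^σ` (`halfShuffleRack_eq_halfShuffleFaces`).

A tuple `x` in a group `G` defines the function `f(a) = ∏ x_i ^ a_i` on the vertices of a cube, and
the functor `(a ≤ b) ↦ f(a)⁻¹ f(b)` is an `L`-cube. Each vertex `a` is
reached from the initial vertex by raising its coordinates one after the other, and in an `L`-cube
the value on the `i`-th edge of this path depends on `i` alone. So an `L`-cube is determined by the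
tuple of its edges at the initial vertex (`edge_eq_vertexProd`), which gives the isomorphism of
nerves (`nerveIso`).
-/

namespace RackHomology

noncomputable section

/-! ### Splitting off the first coordinate of a cubical set -/

/-- The cubical set whose `n`-cubes are the `(n+1)`-cubes of `X`, the first coordinate being
regarded as a parameter. -/
def shift (X : CubicalSet.{u}) : CubicalSet.{u} where
  obj n := X.obj (n + 1)
  d i ε x := X.d i.succ ε x
  s i x := X.s i.succ x
  d_d i j ε ω x h := X.d_d i.succ j.succ ε ω x (Fin.succ_le_succ_iff.mpr h)
  s_s i j x h := X.s_s i.succ j.succ x (Fin.succ_le_succ_iff.mpr h)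
  d_s_lt i j ε x h := X.d_s_lt i.succ j.succ ε x (Fin.succ_le_succ_iff.mpr h)
  d_s_eq i ε x := X.d_s_eq i.succ ε x
  d_s_gt i j ε x h := X.d_s_gt i.succ j.succ ε x (Fin.succ_le_succ_iff.mpr h)

/-- An `n`-cube of `shift X`, as an `(n+1)`-cube of `X`. -/
def ofShift {X : CubicalSet.{u}} {n : ℕ} (x : (shift X).obj n) : X.obj (n + 1) := x

/-- An `(n+1)`-cube of `X`, as an `n`-cube of `shift X`. -/
def toShift {X : CubicalSet.{u}} {n : ℕ} (x : X.obj (n + 1)) : (shift X).obj n := x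

@[simp]
theorem ofShift_toShift {X : CubicalSet.{u}} {n : ℕ} (x : X.obj (n + 1)) :
    ofShift (toShift x) = x := rfl

/-- The face `d_{1,ε}` in the split-off coordinate. -/
def firstFace (X : CubicalSet.{u}) (ε : Bool) : shift X ⟶ X where
  app _ x := X.d 0 ε (ofShift x)
  app_d i ω x := (X.d_d 0 i ε ω x (Fin.zero_le _)).symm
  app_s i x := X.d_s_gt i 0 ε x (Fin.zero_le _)

/-- The degeneracy `s_1` in the split-off coordinate. -/
def firstDegen (X : CubicalSet.{u}) : X ⟶ shift X where
  app _ x := toShift (X.s 0 x)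
  app_d := by
    intro n i ε x
    exact (X.d_s_lt 0 i ε x (Fin.zero_le _)).symm
  app_s i x := (X.s_s 0 i x (Fin.zero_le _)).symm

/-- Functoriality of `shift`. -/
def shiftMap {X Y : CubicalSet.{u}} (f : X ⟶ Y) : shift X ⟶ shift Y where
  app n x := toShift (f.app (n + 1) (ofShift x))
  app_d i ε x := f.app_d i.succ ε x
  app_s i x := f.app_s i.succ x

/-! ### Unnormalized total chains -/

section Total

variable (k : Type v) [Field k]

/-- The free module on all cubes of `X`, of all dimensions. -/
def Tot (X : CubicalSet.{u}) : Type (max u v) := (Σ n : ℕ, X.obj n) →₀ k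

instance (X : CubicalSet.{u}) : AddCommGroup (Tot k X) :=
  inferInstanceAs (AddCommGroup ((Σ n : ℕ, X.obj n) →₀ k))

instance (X : CubicalSet.{u}) : Module k (Tot k X) :=
  inferInstanceAs (Module k ((Σ n : ℕ, X.obj n) →₀ k))

/-- The basis element of `Tot k X` given by a cube. -/
def totCube {X : CubicalSet.{u}} {n : ℕ} (x : X.obj n) : Tot k X :=
  (Finsupp.single ⟨n, x⟩ 1 : (Σ n : ℕ, X.obj n) →₀ k)

variable {k} {X Y Z : CubicalSet.{u}} {M N : Type w} [AddCommGroup M] [Module k M]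
  [AddCommGroup N] [Module k N]

/-- The linear map with prescribed values on cubes. -/
def totLift (F : ∀ n : ℕ, X.obj n → M) : Tot k X →ₗ[k] M :=
  (Finsupp.linearCombination k fun c : Σ n : ℕ, X.obj n => F c.1 c.2 :
    ((Σ n : ℕ, X.obj n) →₀ k) →ₗ[k] M)

@[simp]
theorem totLift_totCube (F : ∀ n : ℕ, X.obj n → M) {n : ℕ} (x : X.obj n) :
    totLift F (totCube k x) = F n x :=
  (Finsupp.linearCombination_single k _ _).trans (one_smul k _)

theorem tot_ext {f g : Tot k X →ₗ[k] M}
    (h : ∀ (n : ℕ) (x : X.obj n), f (totCube k x) = g (totCube k x)) : f = g := by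
  refine Finsupp.lhom_ext' fun c => LinearMap.ext_ring ?_
  exact h c.1 c.2

theorem tot_tensor_ext {f g : Tot k X ⊗[k] Tot k Y →ₗ[k] M}
    (h : ∀ (m n : ℕ) (x : X.obj m) (y : Y.obj n),
      f (totCube k x ⊗ₜ totCube k y) = g (totCube k x ⊗ₜ totCube k y)) : f = g := by
  refine TensorProduct.ext (tot_ext fun m x => tot_ext fun n y => ?_)
  exact h m n x y

variable (k)

/-- The map induced by a morphism of cubical sets. -/
def totMap (f : X ⟶ Y) : Tot k X →ₗ[k] Tot k Y :=
  totLift fun n x => totCube k (f.app n x)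

/-- The degree one map which regards an `n`-cube of `shift X` as an `(n+1)`-cube of `X`. -/
def susp (X : CubicalSet.{u}) : Tot k (shift X) →ₗ[k] Tot k X :=
  totLift fun _ x => totCube k (ofShift x)

/-- The grading involution, multiplication by `(-1)^n` in degree `n`. -/
def signMap (X : CubicalSet.{u}) : Tot k X →ₗ[k] Tot k X :=
  totLift fun n x => (-1 : k) ^ n • totCube k x

/-- The boundary of a cube. -/
def cubeBoundary (X : CubicalSet.{u}) : ∀ n : ℕ, X.obj n → Tot k X
  | 0, _ => 0
  | n + 1, x => ∑ i : Fin (n + 1), (-1 : k) ^ (i : ℕ) •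
      (totCube k (X.d i true x) - totCube k (X.d i false x))

/-- The differential on total chains. -/
def totBoundary (X : CubicalSet.{u}) : Tot k X →ₗ[k] Tot k X :=
  totLift (cubeBoundary k X)

variable {k}

@[simp]
theorem totMap_totCube (f : X ⟶ Y) {n : ℕ} (x : X.obj n) :
    totMap k f (totCube k x) = totCube k (f.app n x) := by simp [totMap]

@[simp]
theorem susp_totCube {n : ℕ} (x : (shift X).obj n) :
    susp k X (totCube k x) = totCube k (ofShift x) := by simp [susp]

theorem totCube_eq_susp {n : ℕ} (x : X.obj (n + 1)) :
    totCube k x = susp k X (totCube k (toShift x)) := by simp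

@[simp]
theorem signMap_totCube {n : ℕ} (x : X.obj n) :
    signMap k X (totCube k x) = (-1 : k) ^ n • totCube k x := by simp [signMap]

theorem totBoundary_vertex (x : X.obj 0) : totBoundary k X (totCube k x) = 0 := by
  simp [totBoundary, cubeBoundary]

theorem totBoundary_totCube {n : ℕ} (x : X.obj (n + 1)) :
    totBoundary k X (totCube k x) = ∑ i : Fin (n + 1), (-1 : k) ^ (i : ℕ) •
      (totCube k (X.d i true x) - totCube k (X.d i false x)) := by
  simp [totBoundary, cubeBoundary]

@[simp]
theorem signMap_signMap (a : Tot k X) : signMap k X (signMap k X a) = a := by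
  refine LinearMap.congr_fun (f := signMap k X ∘ₗ signMap k X) (g := LinearMap.id)
    (tot_ext fun n x => ?_) a
  simp [smul_smul, ← mul_pow]

theorem signMap_susp (a : Tot k (shift X)) :
    signMap k X (susp k X a) = -susp k X (signMap k (shift X) a) := by
  refine LinearMap.congr_fun (f := signMap k X ∘ₗ susp k X)
    (g := -(susp k X ∘ₗ signMap k (shift X))) (tot_ext fun n x => ?_) a
  simp [pow_succ]

theorem signMap_totMap (f : X ⟶ Y) (a : Tot k X) :
    signMap k Y (totMap k f a) = totMap k f (signMap k X a) := by
  refine LinearMap.congr_fun (f := signMap k Y ∘ₗ totMap k f)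
    (g := totMap k f ∘ₗ signMap k X) (tot_ext fun n x => ?_) a
  simp

theorem totBoundary_totMap (f : X ⟶ Y) (a : Tot k X) :
    totBoundary k Y (totMap k f a) = totMap k f (totBoundary k X a) := by
  refine LinearMap.congr_fun (f := totBoundary k Y ∘ₗ totMap k f)
    (g := totMap k f ∘ₗ totBoundary k X) (tot_ext fun n x => ?_) a
  cases n with
  | zero => simp [totBoundary_vertex]
  | succ n => simp [totBoundary_totCube, f.app_d]

theorem totBoundary_signMap (a : Tot k X) :
    totBoundary k X (signMap k X a) = -signMap k X (totBoundary k X a) := by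
  refine LinearMap.congr_fun (f := totBoundary k X ∘ₗ signMap k X)
    (g := -(signMap k X ∘ₗ totBoundary k X)) (tot_ext fun n x => ?_) a
  cases n with
  | zero => simp [totBoundary_vertex]
  | succ n =>
    simp only [LinearMap.comp_apply, signMap_totCube, map_smul, totBoundary_totCube,
      LinearMap.neg_apply, map_sum, map_sub, Finset.smul_sum, ← Finset.sum_neg_distrib]
    refine Finset.sum_congr rfl fun i _ => ?_
    module

theorem totBoundary_susp (a : Tot k (shift X)) :
    totBoundary k X (susp k X a) = totMap k (firstFace X true) a - totMap k (firstFace X false) a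
      - susp k X (totBoundary k (shift X) a) := by
  refine LinearMap.congr_fun (f := totBoundary k X ∘ₗ susp k X)
    (g := totMap k (firstFace X true) - totMap k (firstFace X false)
      - susp k X ∘ₗ totBoundary k (shift X)) (tot_ext fun n x => ?_) a
  cases n with
  | zero => simp [totBoundary_vertex, totBoundary_totCube, firstFace]
  | succ n =>
    simp only [LinearMap.comp_apply, susp_totCube, LinearMap.sub_apply, totMap_totCube]
    rw [totBoundary_totCube, totBoundary_totCube, Fin.sum_univ_succ]
    simp only [Fin.val_zero, pow_zero, one_smul, Fin.val_succ, map_sum, map_smul, map_sub,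
      susp_totCube, sub_eq_add_neg, ← Finset.sum_neg_distrib]
    congr 1
    all_goals refine Finset.sum_congr rfl fun i _ => ?_
    rw [map_add, map_neg, susp_totCube, susp_totCube]
    change _ = -((-1 : k) ^ (i : ℕ) • (totCube k (X.d i.succ true (ofShift x)) +
      -totCube k (X.d i.succ false (ofShift x))))
    module

theorem susp_totMap (f : X ⟶ Y) (a : Tot k (shift X)) :
    susp k Y (totMap k (shiftMap f) a) = totMap k f (susp k X a) := by
  refine LinearMap.congr_fun (f := susp k Y ∘ₗ totMap k (shiftMap f))
    (g := totMap k f ∘ₗ susp k X) (tot_ext fun n x => ?_) a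
  simp [shiftMap]

theorem totMap_firstFace (f : X ⟶ Y) (ε : Bool) (a : Tot k (shift X)) :
    totMap k (firstFace Y ε) (totMap k (shiftMap f) a) =
      totMap k f (totMap k (firstFace X ε) a) := by
  refine LinearMap.congr_fun (f := totMap k (firstFace Y ε) ∘ₗ totMap k (shiftMap f))
    (g := totMap k f ∘ₗ totMap k (firstFace X ε)) (tot_ext fun n x => ?_) a
  simp only [LinearMap.comp_apply, totMap_totCube]
  exact congrArg (totCube k) (f.app_d 0 ε x).symm

/-- The differential of the tensor square of total chains. -/
def tensorBoundary (k : Type v) [Field k] (X : CubicalSet.{u}) :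
    Tot k X ⊗[k] Tot k X →ₗ[k] Tot k X ⊗[k] Tot k X :=
  (totBoundary k X).rTensor _ + TensorProduct.map (signMap k X) (totBoundary k X)

theorem tensorBoundary_tmul (a b : Tot k X) : tensorBoundary k X (a ⊗ₜ b) =
    totBoundary k X a ⊗ₜ b + signMap k X a ⊗ₜ totBoundary k X b := by
  simp [tensorBoundary]

end Total

/-! ### The Serre diagonal -/

section Serre

variable (k : Type v) [Field k]

/-- The product with `e ⊗ ε`, where `e` is the interval of the first coordinate. -/
def leftStep (X : CubicalSet.{u}) (ε : Bool) :
    Tot k (shift X) ⊗[k] Tot k (shift X) →ₗ[k] Tot k X ⊗[k] Tot k X :=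
  TensorProduct.map (susp k X) (totMap k (firstFace X ε))

/-- The product with `ε ⊗ e`, where `e` is the interval of the first coordinate. -/
def rightStep (X : CubicalSet.{u}) (ε : Bool) :
    Tot k (shift X) ⊗[k] Tot k (shift X) →ₗ[k] Tot k X ⊗[k] Tot k X :=
  TensorProduct.map (totMap k (firstFace X ε) ∘ₗ signMap k (shift X)) (susp k X)

/-- The product with the diagonal `e ⊗ 1 + 0 ⊗ e` of the first coordinate. -/
def serreStep (X : CubicalSet.{u}) :
    Tot k (shift X) ⊗[k] Tot k (shift X) →ₗ[k] Tot k X ⊗[k] Tot k X :=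
  leftStep k X true + rightStep k X false

/-- The product with the flipped diagonal `1 ⊗ e + e ⊗ 0` of the first coordinate. -/
def serreStepFlip (X : CubicalSet.{u}) :
    Tot k (shift X) ⊗[k] Tot k (shift X) →ₗ[k] Tot k X ⊗[k] Tot k X :=
  rightStep k X true + leftStep k X false

/-- The product with `e ⊗ e`, the homotopy between the diagonal of the first coordinate and its
flip. -/
def squareStep (X : CubicalSet.{u}) :
    Tot k (shift X) ⊗[k] Tot k (shift X) →ₗ[k] Tot k X ⊗[k] Tot k X :=
  TensorProduct.map (susp k X ∘ₗ signMap k (shift X)) (susp k X)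

/-- The Serre diagonal of a cube. -/
def serreCube : ∀ (n : ℕ) (X : CubicalSet.{u}), X.obj n → Tot k X ⊗[k] Tot k X
  | 0, _, x => totCube k x ⊗ₜ totCube k x
  | n + 1, X, x => serreStep k X (serreCube n (shift X) (toShift x))

/-- The Serre diagonal on total chains. -/
def serre (X : CubicalSet.{u}) : Tot k X →ₗ[k] Tot k X ⊗[k] Tot k X :=
  totLift fun n => serreCube k n X

/-- The homotopy between the Serre diagonal and its flip, on a cube. -/
def homotopyCube : ∀ (n : ℕ) (X : CubicalSet.{u}), X.obj n → Tot k X ⊗[k] Tot k X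
  | 0, _, _ => 0
  | n + 1, X, x => -(squareStep k X (serreCube k n (shift X) (toShift x)) +
      serreStepFlip k X (homotopyCube n (shift X) (toShift x)))

/-- The homotopy between the Serre diagonal and its flip. -/
def homotopy (X : CubicalSet.{u}) : Tot k X →ₗ[k] Tot k X ⊗[k] Tot k X :=
  totLift fun n => homotopyCube k n X

/-- The graded flip. -/
def totFlip (X : CubicalSet.{u}) : Tot k X ⊗[k] Tot k X →ₗ[k] Tot k X ⊗[k] Tot k X :=
  TensorProduct.lift (totLift fun p x => totLift fun q y =>
    (-1 : k) ^ (p * q) • (totCube k y ⊗ₜ[k] totCube k x))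

variable {k} {X Y : CubicalSet.{u}}

theorem totFlip_tmul {p q : ℕ} (x : X.obj p) (y : X.obj q) :
    totFlip k X (totCube k x ⊗ₜ totCube k y) =
      (-1 : k) ^ (p * q) • (totCube k y ⊗ₜ totCube k x) := by
  simp [totFlip]

theorem serre_vertex (x : X.obj 0) : serre k X (totCube k x) = totCube k x ⊗ₜ totCube k x := by
  simp [serre, serreCube]

theorem serre_susp (a : Tot k (shift X)) :
    serre k X (susp k X a) = serreStep k X (serre k (shift X) a) := by
  refine LinearMap.congr_fun (f := serre k X ∘ₗ susp k X)
    (g := serreStep k X ∘ₗ serre k (shift X)) (tot_ext fun n x => ?_) a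
  simp only [LinearMap.comp_apply, susp_totCube, serre, totLift_totCube]
  rfl

theorem homotopy_vertex (x : X.obj 0) : homotopy k X (totCube k x) = 0 := by
  simp [homotopy, homotopyCube]

theorem homotopy_susp (a : Tot k (shift X)) :
    homotopy k X (susp k X a) = -(squareStep k X (serre k (shift X) a) +
      serreStepFlip k X (homotopy k (shift X) a)) := by
  refine LinearMap.congr_fun (f := homotopy k X ∘ₗ susp k X)
    (g := -(squareStep k X ∘ₗ serre k (shift X) + serreStepFlip k X ∘ₗ homotopy k (shift X)))
    (tot_ext fun n x => ?_) a
  simp only [LinearMap.comp_apply, susp_totCube, serre, homotopy, totLift_totCube,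
    LinearMap.neg_apply, LinearMap.add_apply]
  rfl

/-- Induction on dimension for identities that hold for all cubical sets: the inductive step
passes from a cube of `shift X` to the same cube in `X`. -/
theorem cube_induction {P : ∀ X : CubicalSet.{u}, Tot k X → Prop}
    (vertex : ∀ (X : CubicalSet.{u}) (x : X.obj 0), P X (totCube k x))
    (step : ∀ (X : CubicalSet.{u}) (a : Tot k (shift X)), P (shift X) a → P X (susp k X a)) :
    ∀ (X : CubicalSet.{u}) (n : ℕ) (x : X.obj n), P X (totCube k x) := by
  intro X n
  induction n generalizing X with
  | zero => exact vertex X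
  | succ n ih =>
    intro x
    rw [totCube_eq_susp]
    exact step X _ (ih (shift X) (toShift x))

theorem tot_ext_induction {M : CubicalSet.{u} → Type w} [∀ X, AddCommGroup (M X)]
    [∀ X, Module k (M X)] (f g : ∀ X : CubicalSet.{u}, Tot k X →ₗ[k] M X)
    (vertex : ∀ (X : CubicalSet.{u}) (x : X.obj 0), f X (totCube k x) = g X (totCube k x))
    (step : ∀ (X : CubicalSet.{u}) (a : Tot k (shift X)), f (shift X) a = g (shift X) a →
      f X (susp k X a) = g X (susp k X a)) (X : CubicalSet.{u}) : f X = g X :=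
  tot_ext (cube_induction (P := fun X a => f X a = g X a) vertex step X)

theorem serreStep_totMap (f : X ⟶ Y) (t : Tot k (shift X) ⊗[k] Tot k (shift X)) :
    serreStep k Y (TensorProduct.map (totMap k (shiftMap f)) (totMap k (shiftMap f)) t) =
      TensorProduct.map (totMap k f) (totMap k f) (serreStep k X t) := by
  induction t with
  | zero => simp
  | add s t hs ht => simp only [map_add, hs, ht]
  | tmul a b =>
    simp [serreStep, leftStep, rightStep, susp_totMap, totMap_firstFace, signMap_totMap]

theorem serre_totMap (f : X ⟶ Y) (a : Tot k X) :
    serre k Y (totMap k f a) = TensorProduct.map (totMap k f) (totMap k f) (serre k X a) := by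
  refine LinearMap.congr_fun (f := serre k Y ∘ₗ totMap k f)
    (g := TensorProduct.map (totMap k f) (totMap k f) ∘ₗ serre k X) (tot_ext fun n => ?_) a
  clear a
  induction n generalizing X Y with
  | zero => intro x; simp [serre_vertex]
  | succ n ih =>
    intro x
    have := ih (shiftMap f) (toShift x)
    simp only [LinearMap.comp_apply] at this ⊢
    rw [totCube_eq_susp x, ← susp_totMap, serre_susp, this, serreStep_totMap, serre_susp]

theorem tensorBoundary_serreStep (t : Tot k (shift X) ⊗[k] Tot k (shift X)) :
    tensorBoundary k X (serreStep k X t) =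
      TensorProduct.map (totMap k (firstFace X true)) (totMap k (firstFace X true)) t -
      TensorProduct.map (totMap k (firstFace X false)) (totMap k (firstFace X false)) t -
      serreStep k X (tensorBoundary k (shift X) t) := by
  induction t with
  | zero => simp
  | add s t hs ht => simp only [map_add, hs, ht]; abel
  | tmul a b =>
    simp only [serreStep, leftStep, rightStep, LinearMap.add_apply, TensorProduct.map_tmul,
      LinearMap.comp_apply,
      map_add, tensorBoundary_tmul, totBoundary_susp, totBoundary_totMap, signMap_susp,
      signMap_totMap, signMap_signMap, totBoundary_signMap, map_neg, TensorProduct.tmul_sub,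
      TensorProduct.sub_tmul, TensorProduct.neg_tmul]
    abel

theorem tensorBoundary_serreStepFlip (t : Tot k (shift X) ⊗[k] Tot k (shift X)) :
    tensorBoundary k X (serreStepFlip k X t) =
      TensorProduct.map (totMap k (firstFace X true)) (totMap k (firstFace X true)) t -
      TensorProduct.map (totMap k (firstFace X false)) (totMap k (firstFace X false)) t -
      serreStepFlip k X (tensorBoundary k (shift X) t) := by
  induction t with
  | zero => simp
  | add s t hs ht => simp only [map_add, hs, ht]; abel
  | tmul a b =>
    simp only [serreStepFlip, leftStep, rightStep, LinearMap.add_apply, TensorProduct.map_tmul,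
      LinearMap.comp_apply,
      map_add, tensorBoundary_tmul, totBoundary_susp, totBoundary_totMap, signMap_susp,
      signMap_totMap, signMap_signMap, totBoundary_signMap, map_neg, TensorProduct.tmul_sub,
      TensorProduct.sub_tmul, TensorProduct.neg_tmul]
    abel

theorem tensorBoundary_squareStep (t : Tot k (shift X) ⊗[k] Tot k (shift X)) :
    tensorBoundary k X (squareStep k X t) =
      squareStep k X (tensorBoundary k (shift X) t) + serreStepFlip k X t - serreStep k X t := by
  induction t with
  | zero => simp
  | add s t hs ht => simp only [map_add, hs, ht]; abel
  | tmul a b =>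
    simp only [serreStepFlip, serreStep, leftStep, rightStep, squareStep, LinearMap.add_apply,
      TensorProduct.map_tmul,
      LinearMap.comp_apply,
      map_add, tensorBoundary_tmul, totBoundary_susp, totBoundary_totMap, signMap_susp,
      signMap_totMap, signMap_signMap, totBoundary_signMap, map_neg, TensorProduct.tmul_sub,
      TensorProduct.sub_tmul, TensorProduct.neg_tmul]
    abel

/-- The Serre diagonal is a chain map. -/
theorem tensorBoundary_serre (X : CubicalSet.{u}) (a : Tot k X) :
    tensorBoundary k X (serre k X a) = serre k X (totBoundary k X a) := by
  refine LinearMap.congr_fun (tot_ext_induction (fun X => tensorBoundary k X ∘ₗ serre k X)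
    (fun X => serre k X ∘ₗ totBoundary k X) (fun X x => ?_) (fun X a ih => ?_) X) a
  · simp [serre_vertex, tensorBoundary_tmul, totBoundary_vertex]
  · simp only [LinearMap.comp_apply] at ih ⊢
    rw [serre_susp, tensorBoundary_serreStep, ih, totBoundary_susp]
    simp only [map_sub, serre_totMap, serre_susp]

theorem signMap_serreStep (t : Tot k (shift X) ⊗[k] Tot k (shift X)) :
    TensorProduct.map (signMap k X) (signMap k X) (serreStep k X t) =
      -serreStep k X (TensorProduct.map (signMap k (shift X)) (signMap k (shift X)) t) := by
  induction t with
  | zero => simp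
  | add s t hs ht => simp only [map_add, hs, ht]; abel
  | tmul a b =>
    simp [serreStep, leftStep, rightStep, signMap_susp, signMap_totMap, TensorProduct.neg_tmul,
      TensorProduct.tmul_neg]
    abel

theorem serre_signMap (X : CubicalSet.{u}) (a : Tot k X) :
    serre k X (signMap k X a) =
      TensorProduct.map (signMap k X) (signMap k X) (serre k X a) := by
  refine LinearMap.congr_fun (tot_ext_induction (fun X => serre k X ∘ₗ signMap k X)
    (fun X => TensorProduct.map (signMap k X) (signMap k X) ∘ₗ serre k X)
    (fun X x => ?_) (fun X a ih => ?_) X) a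
  · simp [serre_vertex]
  · simp only [LinearMap.comp_apply] at ih ⊢
    rw [serre_susp, signMap_serreStep, signMap_susp, map_neg, serre_susp, ih]

/-- The flip exchanges the two kinds of products. -/
theorem totFlip_leftStep (ε : Bool) (t : Tot k (shift X) ⊗[k] Tot k (shift X)) :
    totFlip k X (leftStep k X ε t) = rightStep k X ε (totFlip k (shift X) t) := by
  refine LinearMap.congr_fun (f := totFlip k X ∘ₗ leftStep k X ε)
    (g := rightStep k X ε ∘ₗ totFlip k (shift X)) (tot_tensor_ext fun p q x y => ?_) t
  simp only [leftStep, rightStep, LinearMap.comp_apply, TensorProduct.map_tmul, susp_totCube,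
    totMap_totCube, totFlip_tmul, map_smul, signMap_totCube, TensorProduct.smul_tmul', smul_smul]
  rw [add_mul, one_mul, pow_add]

theorem totFlip_rightStep (ε : Bool) (t : Tot k (shift X) ⊗[k] Tot k (shift X)) :
    totFlip k X (rightStep k X ε t) = leftStep k X ε (totFlip k (shift X) t) := by
  refine LinearMap.congr_fun (f := totFlip k X ∘ₗ rightStep k X ε)
    (g := leftStep k X ε ∘ₗ totFlip k (shift X)) (tot_tensor_ext fun p q x y => ?_) t
  simp only [leftStep, rightStep, LinearMap.comp_apply, TensorProduct.map_tmul, susp_totCube,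
    totMap_totCube, totFlip_tmul, map_smul, signMap_totCube, ← TensorProduct.smul_tmul', smul_smul]
  congr 1
  have : (-1 : k) ^ p * (-1 : k) ^ p = 1 := by rw [← mul_pow]; simp
  calc (-1 : k) ^ p * (-1 : k) ^ (p * (q + 1)) = (-1 : k) ^ (p * q) * ((-1) ^ p * (-1) ^ p) := by
        rw [mul_add, mul_one, pow_add, mul_comm, mul_assoc]
    _ = _ := by rw [this, mul_one]

theorem totFlip_serreStep (t : Tot k (shift X) ⊗[k] Tot k (shift X)) :
    totFlip k X (serreStep k X t) = serreStepFlip k X (totFlip k (shift X) t) := by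
  simp only [serreStep, serreStepFlip, LinearMap.add_apply, map_add, totFlip_leftStep,
    totFlip_rightStep]

theorem squareStep_totMap (f : X ⟶ Y) (t : Tot k (shift X) ⊗[k] Tot k (shift X)) :
    squareStep k Y (TensorProduct.map (totMap k (shiftMap f)) (totMap k (shiftMap f)) t) =
      TensorProduct.map (totMap k f) (totMap k f) (squareStep k X t) := by
  induction t with
  | zero => simp
  | add s t hs ht => simp only [map_add, hs, ht]
  | tmul a b => simp [squareStep, susp_totMap, signMap_totMap]

theorem serreStepFlip_totMap (f : X ⟶ Y) (t : Tot k (shift X) ⊗[k] Tot k (shift X)) :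
    serreStepFlip k Y (TensorProduct.map (totMap k (shiftMap f)) (totMap k (shiftMap f)) t) =
      TensorProduct.map (totMap k f) (totMap k f) (serreStepFlip k X t) := by
  induction t with
  | zero => simp
  | add s t hs ht => simp only [map_add, hs, ht]
  | tmul a b => simp [serreStepFlip, leftStep, rightStep, susp_totMap, totMap_firstFace,
      signMap_totMap]

theorem homotopy_totMap (f : X ⟶ Y) (a : Tot k X) :
    homotopy k Y (totMap k f a) =
      TensorProduct.map (totMap k f) (totMap k f) (homotopy k X a) := by
  refine LinearMap.congr_fun (f := homotopy k Y ∘ₗ totMap k f)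
    (g := TensorProduct.map (totMap k f) (totMap k f) ∘ₗ homotopy k X) (tot_ext fun n => ?_) a
  clear a
  induction n generalizing X Y with
  | zero => intro x; simp [homotopy_vertex]
  | succ n ih =>
    intro x
    have := ih (shiftMap f) (toShift x)
    simp only [LinearMap.comp_apply] at this ⊢
    rw [totCube_eq_susp x, ← susp_totMap, homotopy_susp, this, serre_totMap, squareStep_totMap,
      serreStepFlip_totMap, homotopy_susp, map_neg, map_add]

/-- The Serre diagonal is cocommutative up to the homotopy `homotopy`. -/
theorem serre_sub_totFlip_serre (X : CubicalSet.{u}) (a : Tot k X) :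
    serre k X a - totFlip k X (serre k X a) =
      tensorBoundary k X (homotopy k X a) + homotopy k X (totBoundary k X a) := by
  refine LinearMap.congr_fun (tot_ext_induction (fun X => serre k X - totFlip k X ∘ₗ serre k X)
    (fun X => tensorBoundary k X ∘ₗ homotopy k X + homotopy k X ∘ₗ totBoundary k X)
    (fun X x => ?_) (fun X a ih => ?_) X) a
  · simp [serre_vertex, homotopy_vertex, totBoundary_vertex, totFlip_tmul]
  · simp only [LinearMap.comp_apply, LinearMap.sub_apply, LinearMap.add_apply] at ih ⊢
    have ih' := congrArg (serreStepFlip k X) ih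
    simp only [map_sub, map_add] at ih'
    rw [serre_susp, homotopy_susp, totFlip_serreStep, totBoundary_susp]
    simp only [map_neg, map_add, map_sub, homotopy_totMap, homotopy_susp,
      tensorBoundary_squareStep, tensorBoundary_serreStepFlip, tensorBoundary_serre]
    rw [sub_eq_iff_eq_add] at ih'
    rw [ih']
    abel

/-- The product with the threefold diagonal `e ⊗ 1 ⊗ 1 + 0 ⊗ e ⊗ 1 + 0 ⊗ 0 ⊗ e` of the first
coordinate. -/
def serreStep₃ (k : Type v) [Field k] (X : CubicalSet.{u}) :
    Tot k (shift X) ⊗[k] (Tot k (shift X) ⊗[k] Tot k (shift X)) →ₗ[k]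
      Tot k X ⊗[k] (Tot k X ⊗[k] Tot k X) :=
  TensorProduct.map (susp k X)
      (TensorProduct.map (totMap k (firstFace X true)) (totMap k (firstFace X true))) +
    TensorProduct.map (totMap k (firstFace X false) ∘ₗ signMap k (shift X)) (serreStep k X)

theorem serre_lTensor_serreStep (t : Tot k (shift X) ⊗[k] Tot k (shift X)) :
    (serre k X).lTensor _ (serreStep k X t) =
      serreStep₃ k X ((serre k (shift X)).lTensor _ t) := by
  induction t with
  | zero => simp
  | add s t hs ht => simp only [map_add, hs, ht]
  | tmul a b => simp [serreStep, leftStep, rightStep, serreStep₃, serre_totMap, serre_susp,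
      TensorProduct.tmul_add]

theorem serre_rTensor_serreStep (t : Tot k (shift X) ⊗[k] Tot k (shift X)) :
    TensorProduct.assoc k _ _ _ ((serre k X).rTensor _ (serreStep k X t)) =
      serreStep₃ k X (TensorProduct.assoc k _ _ _ ((serre k (shift X)).rTensor _ t)) := by
  induction t with
  | zero => simp
  | add s t hs ht => simp only [map_add, hs, ht]
  | tmul a b =>
    simp only [serreStep, leftStep, rightStep, serre_susp, serre_totMap, serre_signMap,
      LinearMap.add_apply, map_add,
      TensorProduct.map_tmul, LinearMap.rTensor_tmul, LinearMap.comp_apply]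
    induction serre k (shift X) a with
    | zero => simp
    | add s t hs ht =>
      simp only [map_add, TensorProduct.add_tmul, ← hs, ← ht]
      abel
    | tmul a c =>
      simp only [serreStep, leftStep, rightStep, serreStep₃, TensorProduct.map_tmul,
        LinearMap.add_apply,
        TensorProduct.add_tmul, TensorProduct.assoc_tmul, map_add, LinearMap.comp_apply,
        TensorProduct.tmul_add]
      abel

/-- The Serre diagonal is coassociative. -/
theorem serre_coassoc (X : CubicalSet.{u}) (a : Tot k X) :
    TensorProduct.assoc k _ _ _ ((serre k X).rTensor _ (serre k X a)) =
      (serre k X).lTensor _ (serre k X a) := by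
  refine LinearMap.congr_fun (tot_ext_induction
    (fun X => (TensorProduct.assoc k _ _ _).toLinearMap ∘ₗ (serre k X).rTensor _ ∘ₗ serre k X)
    (fun X => (serre k X).lTensor _ ∘ₗ serre k X)
    (fun X x => ?_) (fun X a ih => ?_) X) a
  · simp [serre_vertex]
  · simp only [LinearMap.comp_apply, LinearEquiv.coe_coe] at ih ⊢
    rw [serre_susp, serre_rTensor_serreStep, ih, serre_lTensor_serreStep]

end Serre

/-! ### The half-shuffle coproduct -/

section Half

variable (k : Type v) [Field k]

/-- The map on total chains which vanishes on vertices and is given on an `(n+1)`-cube of `X` by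
a linear map from the chains of `shift X`. -/
def suspLift {M : Type w} [AddCommGroup M] [Module k M] (X : CubicalSet.{u})
    (f : Tot k (shift X) →ₗ[k] M) : Tot k X →ₗ[k] M :=
  totLift fun n => match n with
    | 0 => fun _ => 0
    | _ + 1 => fun x => f (totCube k (toShift x))

/-- The part of the Serre diagonal in which the first coordinate belongs to the left factor. -/
def leftHalf (X : CubicalSet.{u}) : Tot k X →ₗ[k] Tot k X ⊗[k] Tot k X :=
  suspLift k X (leftStep k X true ∘ₗ serre k (shift X))

/-- The part of the Serre diagonal in which the first coordinate belongs to the right factor. -/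
def rightHalf (X : CubicalSet.{u}) : Tot k X →ₗ[k] Tot k X ⊗[k] Tot k X :=
  suspLift k X (rightStep k X false ∘ₗ serre k (shift X))

/-- The homotopy between the right half of the Serre diagonal and the flip of the left half. -/
def halfHomotopy (X : CubicalSet.{u}) : Tot k X →ₗ[k] Tot k X ⊗[k] Tot k X :=
  suspLift k X (-(rightStep k X false ∘ₗ homotopy k (shift X)))

variable {k} {X Y : CubicalSet.{u}}

theorem suspLift_vertex {M : Type w} [AddCommGroup M] [Module k M]
    (f : Tot k (shift X) →ₗ[k] M) (x : X.obj 0) : suspLift k X f (totCube k x) = 0 := by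
  simp [suspLift]

theorem suspLift_susp {M : Type w} [AddCommGroup M] [Module k M]
    (f : Tot k (shift X) →ₗ[k] M) (a : Tot k (shift X)) :
    suspLift k X f (susp k X a) = f a := by
  refine LinearMap.congr_fun (f := suspLift k X f ∘ₗ susp k X) (tot_ext fun n x => ?_) a
  simp only [LinearMap.comp_apply, susp_totCube, suspLift, totLift_totCube]
  rfl

theorem leftHalf_vertex (x : X.obj 0) : leftHalf k X (totCube k x) = 0 := suspLift_vertex _ x

theorem leftHalf_susp (a : Tot k (shift X)) :
    leftHalf k X (susp k X a) = leftStep k X true (serre k (shift X) a) := suspLift_susp _ a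

theorem rightHalf_vertex (x : X.obj 0) : rightHalf k X (totCube k x) = 0 := suspLift_vertex _ x

theorem rightHalf_susp (a : Tot k (shift X)) :
    rightHalf k X (susp k X a) = rightStep k X false (serre k (shift X) a) := suspLift_susp _ a

theorem halfHomotopy_vertex (x : X.obj 0) : halfHomotopy k X (totCube k x) = 0 :=
  suspLift_vertex _ x

theorem halfHomotopy_susp (a : Tot k (shift X)) :
    halfHomotopy k X (susp k X a) = -rightStep k X false (homotopy k (shift X) a) :=
      suspLift_susp _ a

/-- Two linear maps on total chains agree if they agree on vertices and on suspensions. -/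
theorem tot_ext_susp {M : Type w} [AddCommGroup M] [Module k M] {f g : Tot k X →ₗ[k] M}
    (vertex : ∀ x : X.obj 0, f (totCube k x) = g (totCube k x))
    (step : ∀ a : Tot k (shift X), f (susp k X a) = g (susp k X a)) : f = g := by
  refine tot_ext fun n x => ?_
  cases n with
  | zero => exact vertex x
  | succ n => rw [totCube_eq_susp]; exact step _

theorem leftHalf_totMap (f : X ⟶ Y) (a : Tot k X) :
    leftHalf k Y (totMap k f a) =
      TensorProduct.map (totMap k f) (totMap k f) (leftHalf k X a) := by
  refine LinearMap.congr_fun (f := leftHalf k Y ∘ₗ totMap k f)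
    (g := TensorProduct.map (totMap k f) (totMap k f) ∘ₗ leftHalf k X)
    (tot_ext_susp (fun x => ?_) fun a => ?_) a
  · simp [leftHalf_vertex]
  · simp only [LinearMap.comp_apply]
    rw [← susp_totMap, leftHalf_susp, leftHalf_susp, serre_totMap]
    induction serre k (shift X) a with
    | zero => simp
    | add s t hs ht => simp only [map_add, hs, ht]
    | tmul a b => simp [leftStep, susp_totMap, totMap_firstFace]

/-- In positive degrees the Serre diagonal is the sum of its two halves. -/
theorem serre_susp_eq_add (a : Tot k (shift X)) : serre k X (susp k X a) =
    leftHalf k X (susp k X a) + rightHalf k X (susp k X a) := by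
  rw [serre_susp, leftHalf_susp, rightHalf_susp]
  rfl

/-- The left half of the Serre diagonal satisfies the coZinbiel identity with the full
diagonal on the right. -/
theorem leftHalf_coassoc (X : CubicalSet.{u}) (a : Tot k X) :
    TensorProduct.assoc k _ _ _ ((leftHalf k X).rTensor _ (leftHalf k X a)) =
      (serre k X).lTensor _ (leftHalf k X a) := by
  refine LinearMap.congr_fun (f := (TensorProduct.assoc k _ _ _).toLinearMap ∘ₗ
      (leftHalf k X).rTensor _ ∘ₗ leftHalf k X) (g := (serre k X).lTensor _ ∘ₗ leftHalf k X)
    (tot_ext_susp (fun x => ?_) fun a => ?_) a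
  · simp [leftHalf_vertex]
  · have h1 : ∀ t, TensorProduct.assoc k _ _ _ ((leftHalf k X).rTensor _ (leftStep k X true t)) =
        TensorProduct.map (susp k X) (TensorProduct.map (totMap k (firstFace X true))
          (totMap k (firstFace X true))) (TensorProduct.assoc k _ _ _
            ((serre k (shift X)).rTensor _ t)) := by
      intro t
      induction t with
      | zero => simp
      | add s t hs ht => simp only [map_add, hs, ht]
      | tmul a b =>
        simp only [leftStep, TensorProduct.map_tmul, LinearMap.rTensor_tmul, leftHalf_susp]
        induction serre k (shift X) a with
        | zero => simp
        | add s t hs ht => simp only [map_add, TensorProduct.add_tmul, hs, ht]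
        | tmul a c => simp [leftStep]
    have h2 : ∀ t, (serre k X).lTensor _ (leftStep k X true t) =
        TensorProduct.map (susp k X) (TensorProduct.map (totMap k (firstFace X true))
          (totMap k (firstFace X true))) ((serre k (shift X)).lTensor _ t) := by
      intro t
      induction t with
      | zero => simp
      | add s t hs ht => simp only [map_add, hs, ht]
      | tmul a b => simp [leftStep, serre_totMap]
    simp only [LinearMap.comp_apply, LinearEquiv.coe_coe, leftHalf_susp]
    rw [h1, h2, serre_coassoc]

/-- The two faces of every cube in the first direction agree. -/
def EqualFirstFaces (X : CubicalSet.{u}) : Prop :=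
  ∀ (n : ℕ) (x : X.obj (n + 1)), X.d 0 true x = X.d 0 false x

theorem EqualFirstFaces.firstFace_eq (hX : EqualFirstFaces X) :
    firstFace X false = firstFace X true :=
  CubicalHom.ext (funext fun n => funext fun x => (hX n x).symm)

theorem EqualFirstFaces.totBoundary_susp (hX : EqualFirstFaces X) (a : Tot k (shift X)) :
    totBoundary k X (susp k X a) = -susp k X (totBoundary k (shift X) a) := by
  rw [RackHomology.totBoundary_susp, hX.firstFace_eq]
  abel

theorem EqualFirstFaces.tensorBoundary_leftStep (hX : EqualFirstFaces X)
    (t : Tot k (shift X) ⊗[k] Tot k (shift X)) :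
    tensorBoundary k X (leftStep k X true t) =
      -leftStep k X true (tensorBoundary k (shift X) t) := by
  induction t with
  | zero => simp
  | add s t hs ht => simp only [map_add, hs, ht]; abel
  | tmul a b =>
    simp only [leftStep, TensorProduct.map_tmul, map_add, tensorBoundary_tmul, hX.totBoundary_susp,
      totBoundary_totMap, signMap_susp, TensorProduct.neg_tmul]
    abel

theorem EqualFirstFaces.tensorBoundary_rightStep (hX : EqualFirstFaces X)
    (t : Tot k (shift X) ⊗[k] Tot k (shift X)) :
    tensorBoundary k X (rightStep k X false t) =
      -rightStep k X false (tensorBoundary k (shift X) t) := by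
  induction t with
  | zero => simp
  | add s t hs ht => simp only [map_add, hs, ht]; abel
  | tmul a b =>
    simp only [rightStep, TensorProduct.map_tmul, map_add, tensorBoundary_tmul,
      hX.totBoundary_susp, totBoundary_totMap, signMap_totMap, signMap_signMap, map_neg,
      totBoundary_signMap, LinearMap.comp_apply, TensorProduct.neg_tmul, TensorProduct.tmul_neg]
    abel

/-- If the first faces agree, the left half of the Serre diagonal is a chain map. -/
theorem EqualFirstFaces.tensorBoundary_leftHalf (hX : EqualFirstFaces X) (a : Tot k X) :
    tensorBoundary k X (leftHalf k X a) = leftHalf k X (totBoundary k X a) := by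
  refine LinearMap.congr_fun (f := tensorBoundary k X ∘ₗ leftHalf k X)
    (g := leftHalf k X ∘ₗ totBoundary k X) (tot_ext_susp (fun x => ?_) fun a => ?_) a
  · simp [leftHalf_vertex, totBoundary_vertex]
  · simp only [LinearMap.comp_apply]
    rw [leftHalf_susp, hX.tensorBoundary_leftStep, tensorBoundary_serre, hX.totBoundary_susp,
      map_neg, leftHalf_susp]

/-- If the first faces agree, the right half of the Serre diagonal is homotopic to the flip of
the left half. -/
theorem EqualFirstFaces.rightHalf_sub_totFlip_leftHalf (hX : EqualFirstFaces X) (a : Tot k X) :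
    rightHalf k X a - totFlip k X (leftHalf k X a) =
      tensorBoundary k X (halfHomotopy k X a) + halfHomotopy k X (totBoundary k X a) := by
  refine LinearMap.congr_fun (f := rightHalf k X - totFlip k X ∘ₗ leftHalf k X)
    (g := tensorBoundary k X ∘ₗ halfHomotopy k X + halfHomotopy k X ∘ₗ totBoundary k X)
    (tot_ext_susp (fun x => ?_) fun a => ?_) a
  · simp [leftHalf_vertex, rightHalf_vertex, halfHomotopy_vertex, totBoundary_vertex]
  · simp only [LinearMap.comp_apply, LinearMap.sub_apply, LinearMap.add_apply]
    have key : totFlip k X (leftStep k X true (serre k (shift X) a)) =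
        rightStep k X false (totFlip k (shift X) (serre k (shift X) a)) := by
      rw [totFlip_leftStep, rightStep, rightStep, hX.firstFace_eq]
    rw [rightHalf_susp, leftHalf_susp, key, ← map_sub, serre_sub_totFlip_serre,
      halfHomotopy_susp, hX.totBoundary_susp, map_neg, map_neg, halfHomotopy_susp,
      hX.tensorBoundary_rightStep, map_add, neg_neg, neg_neg]

end Half

/-! ### Passage to normalized chains -/

section Normalization

variable (k : Type v) [Field k]

/-- The projection of total chains onto the normalized chains of degree `p`. -/
def toChain (X : CubicalSet.{u}) (p : ℕ) : Tot k X →ₗ[k] Chain k X p :=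
  totLift fun n x => if h : n = p then cube k X (h ▸ x : X.obj p) else 0

/-- The inclusion of the unnormalized chains of degree `n`. -/
def ofDegree (X : CubicalSet.{u}) (n : ℕ) : (X.obj n →₀ k) →ₗ[k] Tot k X :=
  Finsupp.linearCombination k fun x => totCube k x

/-- The degree one map which regards an `n`-chain of `shift X` as an `(n+1)`-chain of `X`. -/
def chainSusp (X : CubicalSet.{u}) (n : ℕ) : Chain k (shift X) n →ₗ[k] Chain k X (n + 1) :=
  Submodule.mapQ _ _ (Finsupp.lmapDomain k k ofShift) (by
    cases n with
    | zero => exact bot_le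
    | succ n =>
      refine Submodule.span_le.mpr ?_
      rintro _ ⟨⟨i, x⟩, rfl⟩
      change Finsupp.lmapDomain k k ofShift (Finsupp.single ((shift X).s i x) 1) ∈
        degen k X (n + 2)
      rw [Finsupp.lmapDomain_apply, Finsupp.mapDomain_single]
      exact single_s_mem_degen k X _ i.succ (ofShift x))

variable {k} {X Y : CubicalSet.{u}}

theorem chain_ext {M : Type w} [AddCommGroup M] [Module k M] {n : ℕ} {f g : Chain k X n →ₗ[k] M}
    (h : ∀ x : X.obj n, f (cube k X x) = g (cube k X x)) : f = g :=
  Submodule.linearMap_qext _ (Finsupp.lhom_ext' fun x => LinearMap.ext_ring (h x))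

@[simp]
theorem toChain_totCube {n : ℕ} (x : X.obj n) : toChain k X n (totCube k x) = cube k X x := by
  simp [toChain]

theorem toChain_totCube_of_ne {n p : ℕ} (h : n ≠ p) (x : X.obj n) :
    toChain k X p (totCube k x) = 0 := by
  simp [toChain, h]

theorem cube_degen {n : ℕ} (i : Fin (n + 1)) (x : X.obj n) : cube k X (X.s i x) = 0 :=
  (Submodule.Quotient.mk_eq_zero _).mpr (single_s_mem_degen k X n i x)

theorem ofDegree_single {n : ℕ} (x : X.obj n) :
    ofDegree k X n (Finsupp.single x 1) = totCube k x := by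
  simp [ofDegree]

theorem chainMap_cube (f : X ⟶ Y) {n : ℕ} (x : X.obj n) :
    chainMap k f n (cube k X x) = cube k Y (f.app n x) := by
  refine congrArg (Submodule.mkQ (degen k Y n)) ?_
  simp

theorem chainSusp_cube {n : ℕ} (x : (shift X).obj n) :
    chainSusp k X n (cube k (shift X) x) = cube k X (ofShift x) := by
  refine congrArg (Submodule.mkQ (degen k X (n + 1))) ?_
  simp

theorem boundary_cube {n : ℕ} (x : X.obj (n + 1)) :
    boundary k X n (cube k X x) = ∑ i : Fin (n + 1), (-1 : k) ^ (i : ℕ) •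
      (cube k X (X.d i true x) - cube k X (X.d i false x)) := by
  have : boundary k X n (cube k X x) =
      Submodule.mkQ (degen k X n) (preBoundary k X n (Finsupp.single x 1)) := rfl
  rw [this]
  simp only [preBoundary, LinearMap.sum_apply, LinearMap.smul_apply, LinearMap.sub_apply,
    Finsupp.lmapDomain_apply, Finsupp.mapDomain_single, map_sum, map_smul, map_sub]
  rfl

theorem toChain_totMap (f : X ⟶ Y) (p : ℕ) (a : Tot k X) :
    toChain k Y p (totMap k f a) = chainMap k f p (toChain k X p a) := by
  refine LinearMap.congr_fun (f := toChain k Y p ∘ₗ totMap k f)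
    (g := chainMap k f p ∘ₗ toChain k X p) (tot_ext fun n x => ?_) a
  simp only [LinearMap.comp_apply, totMap_totCube]
  by_cases h : n = p
  · subst h
    simp [chainMap_cube]
  · simp [toChain_totCube_of_ne h]

theorem toChain_signMap (p : ℕ) (a : Tot k X) :
    toChain k X p (signMap k X a) = (-1 : k) ^ p • toChain k X p a := by
  refine LinearMap.congr_fun (f := toChain k X p ∘ₗ signMap k X)
    (g := (-1 : k) ^ p • toChain k X p) (tot_ext fun n x => ?_) a
  simp only [LinearMap.comp_apply, signMap_totCube, LinearMap.smul_apply, map_smul]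
  by_cases h : n = p
  · subst h
    rfl
  · simp [toChain_totCube_of_ne h]

theorem toChain_zero_susp (a : Tot k (shift X)) : toChain k X 0 (susp k X a) = 0 := by
  refine LinearMap.congr_fun (f := toChain k X 0 ∘ₗ susp k X)
    (g := 0) (tot_ext fun n x => ?_) a
  simp [toChain_totCube_of_ne]

theorem toChain_succ_susp (p : ℕ) (a : Tot k (shift X)) :
    toChain k X (p + 1) (susp k X a) = chainSusp k X p (toChain k (shift X) p a) := by
  refine LinearMap.congr_fun (f := toChain k X (p + 1) ∘ₗ susp k X)
    (g := chainSusp k X p ∘ₗ toChain k (shift X) p) (tot_ext fun n x => ?_) a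
  simp only [LinearMap.comp_apply, susp_totCube]
  by_cases h : n = p
  · subst h
    simp [chainSusp_cube]
  · rw [toChain_totCube_of_ne h, toChain_totCube_of_ne (by omega), map_zero]

theorem toChain_totBoundary (p : ℕ) (a : Tot k X) :
    toChain k X p (totBoundary k X a) = boundary k X p (toChain k X (p + 1) a) := by
  refine LinearMap.congr_fun (f := toChain k X p ∘ₗ totBoundary k X)
    (g := boundary k X p ∘ₗ toChain k X (p + 1)) (tot_ext fun n x => ?_) a
  simp only [LinearMap.comp_apply]
  cases n with
  | zero => rw [totBoundary_vertex, toChain_totCube_of_ne (by omega), map_zero, map_zero]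
  | succ n =>
    rw [totBoundary_totCube]
    by_cases h : n = p
    · subst h
      simp [boundary_cube]
    · have h' : n + 1 ≠ p + 1 := by omega
      simp [toChain_totCube_of_ne h, toChain_totCube_of_ne h']

theorem chainSusp_firstDegen (p : ℕ) (c : Chain k X p) :
    chainSusp k X p (chainMap k (firstDegen X) p c) = 0 := by
  refine LinearMap.congr_fun (f := chainSusp k X p ∘ₗ chainMap k (firstDegen X) p) (g := 0)
    (chain_ext fun x => ?_) c
  simp only [LinearMap.comp_apply, chainMap_cube, chainSusp_cube, LinearMap.zero_apply]
  exact cube_degen 0 x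

/-- The component of bidegree `(p, q)` of a tensor of total chains. -/
def toBichain (k : Type v) [Field k] (X : CubicalSet.{u}) (p q : ℕ) :
    Tot k X ⊗[k] Tot k X →ₗ[k] Chain k X p ⊗[k] Chain k X q :=
  TensorProduct.map (toChain k X p) (toChain k X q)

theorem toBichain_tmul (p q : ℕ) (a b : Tot k X) :
    toBichain k X p q (a ⊗ₜ b) = toChain k X p a ⊗ₜ toChain k X q b := rfl

theorem toBichain_totMap (f : X ⟶ Y) (p q : ℕ) (t : Tot k X ⊗[k] Tot k X) :
    toBichain k Y p q (TensorProduct.map (totMap k f) (totMap k f) t) =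
      TensorProduct.map (chainMap k f p) (chainMap k f q) (toBichain k X p q t) := by
  induction t with
  | zero => simp
  | add s t hs ht => simp only [map_add, hs, ht]
  | tmul a b => simp [toBichain_tmul, toChain_totMap]

theorem toBichain_zero_leftStep (q : ℕ) (ε : Bool) (t : Tot k (shift X) ⊗[k] Tot k (shift X)) :
    toBichain k X 0 q (leftStep k X ε t) = 0 := by
  induction t with
  | zero => simp
  | add s t hs ht => simp only [map_add, hs, ht, add_zero]
  | tmul a b => simp [toBichain_tmul, leftStep, toChain_zero_susp]

theorem toBichain_succ_leftStep (p q : ℕ) (ε : Bool)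
    (t : Tot k (shift X) ⊗[k] Tot k (shift X)) :
    toBichain k X (p + 1) q (leftStep k X ε t) =
      TensorProduct.map (chainSusp k X p) (chainMap k (firstFace X ε) q)
        (toBichain k (shift X) p q t) := by
  induction t with
  | zero => simp
  | add s t hs ht => simp only [map_add, hs, ht]
  | tmul a b => simp [toBichain_tmul, leftStep, toChain_succ_susp, toChain_totMap]

theorem toBichain_zero_rightStep (p : ℕ) (ε : Bool) (t : Tot k (shift X) ⊗[k] Tot k (shift X)) :
    toBichain k X p 0 (rightStep k X ε t) = 0 := by
  induction t with
  | zero => simp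
  | add s t hs ht => simp only [map_add, hs, ht, add_zero]
  | tmul a b => simp [toBichain_tmul, rightStep, toChain_zero_susp]

theorem toBichain_succ_rightStep (p q : ℕ) (ε : Bool)
    (t : Tot k (shift X) ⊗[k] Tot k (shift X)) :
    toBichain k X p (q + 1) (rightStep k X ε t) =
      (-1 : k) ^ p • TensorProduct.map (chainMap k (firstFace X ε) p) (chainSusp k X q)
        (toBichain k (shift X) p q t) := by
  induction t with
  | zero => simp
  | add s t hs ht => simp only [map_add, hs, ht, smul_add]
  | tmul a b =>
    simp [toBichain_tmul, rightStep, toChain_succ_susp, toChain_totMap, toChain_signMap,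
      TensorProduct.smul_tmul']

/-- The component of a tensor vanishes in all bidegrees; that is, the tensor becomes zero in the
tensor product of normalized chains. -/
def IsDegenerate (t : Tot k X ⊗[k] Tot k X) : Prop := ∀ p q : ℕ, toBichain k X p q t = 0

/-- The linear maps from tensors on `shift X` to tensors on `X` which pass to normalized chains
and which are degenerate on tensors whose split-off coordinate is degenerate. -/
structure IsNormalStep (S : Tot k (shift X) ⊗[k] Tot k (shift X) →ₗ[k] Tot k X ⊗[k] Tot k X) :
    Prop where
  isDegenerate : ∀ t, IsDegenerate t → IsDegenerate (S t)
  firstDegen : ∀ t : Tot k X ⊗[k] Tot k X, IsDegenerate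
    (S (TensorProduct.map (totMap k (firstDegen X)) (totMap k (firstDegen X)) t))

theorem isNormalStep_leftStep (X : CubicalSet.{u}) (ε : Bool) :
    IsNormalStep (leftStep k X ε) where
  isDegenerate t ht p q := by
    cases p with
    | zero => exact toBichain_zero_leftStep q ε t
    | succ p => rw [toBichain_succ_leftStep, ht, map_zero]
  firstDegen t p q := by
    cases p with
    | zero => exact toBichain_zero_leftStep q ε _
    | succ p =>
      rw [toBichain_succ_leftStep, toBichain_totMap]
      generalize toBichain k X p q t = c
      induction c with
      | zero => simp
      | add s t hs ht => simp only [map_add, hs, ht, add_zero]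
      | tmul a b => simp [chainSusp_firstDegen]

theorem isNormalStep_rightStep (X : CubicalSet.{u}) (ε : Bool) :
    IsNormalStep (rightStep k X ε) where
  isDegenerate t ht p q := by
    cases q with
    | zero => exact toBichain_zero_rightStep p ε t
    | succ q => rw [toBichain_succ_rightStep, ht, map_zero, smul_zero]
  firstDegen t p q := by
    cases q with
    | zero => exact toBichain_zero_rightStep p ε _
    | succ q =>
      rw [toBichain_succ_rightStep, toBichain_totMap]
      generalize toBichain k X p q t = c
      induction c with
      | zero => simp
      | add s t hs ht => simp only [map_add, smul_add, hs, ht, add_zero]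
      | tmul a b => simp [chainSusp_firstDegen]

theorem isNormalStep_squareStep (X : CubicalSet.{u}) : IsNormalStep (squareStep k X) := by
  have zero_left : ∀ q t, toBichain k X 0 q (squareStep k X t) = 0 := by
    intro q t
    induction t with
    | zero => simp
    | add s t hs ht => simp only [map_add, hs, ht, add_zero]
    | tmul a b => simp [toBichain_tmul, squareStep, toChain_zero_susp]
  have zero_right : ∀ p t, toBichain k X p 0 (squareStep k X t) = 0 := by
    intro q t
    induction t with
    | zero => simp
    | add s t hs ht => simp only [map_add, hs, ht, add_zero]
    | tmul a b => simp [toBichain_tmul, squareStep, toChain_zero_susp]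
  have succ_succ : ∀ p q t, toBichain k X (p + 1) (q + 1) (squareStep k X t) =
      (-1 : k) ^ p • TensorProduct.map (chainSusp k X p) (chainSusp k X q)
        (toBichain k (shift X) p q t) := by
    intro p q t
    induction t with
    | zero => simp
    | add s t hs ht => simp only [map_add, hs, ht, smul_add]
    | tmul a b =>
      simp [toBichain_tmul, squareStep, toChain_succ_susp, toChain_signMap,
        TensorProduct.smul_tmul']
  refine ⟨fun t ht p q => ?_, fun t p q => ?_⟩
  · rcases p with _ | p
    · exact zero_left q t
    rcases q with _ | q
    · exact zero_right (p + 1) t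
    rw [succ_succ, ht, map_zero, smul_zero]
  · rcases p with _ | p
    · exact zero_left q _
    rcases q with _ | q
    · exact zero_right (p + 1) _
    rw [succ_succ, toBichain_totMap]
    generalize toBichain k X p q t = c
    induction c with
    | zero => simp
    | add s t hs ht => simp only [map_add, smul_add, hs, ht, add_zero]
    | tmul a b => simp [chainSusp_firstDegen]

theorem IsNormalStep.add {S T : Tot k (shift X) ⊗[k] Tot k (shift X) →ₗ[k] Tot k X ⊗[k] Tot k X}
    (hS : IsNormalStep S) (hT : IsNormalStep T) : IsNormalStep (S + T) where
  isDegenerate t ht p q := by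
    rw [LinearMap.add_apply, map_add, hS.isDegenerate t ht, hT.isDegenerate t ht, add_zero]
  firstDegen t p q := by
    rw [LinearMap.add_apply, map_add, hS.firstDegen t, hT.firstDegen t, add_zero]

/-- If a natural map `F` is degenerate on the degenerate cubes of dimension `n`, then its composite
with a normal step is degenerate on the degenerate cubes of dimension `n + 1`. -/
theorem IsNormalStep.isDegenerate_comp
    {S : Tot k (shift X) ⊗[k] Tot k (shift X) →ₗ[k] Tot k X ⊗[k] Tot k X} (hS : IsNormalStep S)
    (F : ∀ X : CubicalSet.{u}, Tot k X →ₗ[k] Tot k X ⊗[k] Tot k X)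
    (hF : ∀ a : Tot k X, F (shift X) (totMap k (RackHomology.firstDegen X) a) =
      TensorProduct.map (totMap k (RackHomology.firstDegen X))
        (totMap k (RackHomology.firstDegen X)) (F X a)) {n : ℕ} (i : Fin (n + 1)) (x : X.obj n)
    (ih : ∀ (m : ℕ), n = m + 1 → ∀ (j : Fin (m + 1)) (y : (shift X).obj m),
      IsDegenerate (F (shift X) (totCube k ((shift X).s j y)))) :
    IsDegenerate (S (F (shift X) (totCube k (toShift (X.s i x))))) := by
  induction i using Fin.cases with
  | zero =>
    have : totCube k (toShift (X.s 0 x)) =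
      totMap k (RackHomology.firstDegen X) (totCube k x) := by simp [RackHomology.firstDegen]
    rw [this, hF]
    exact hS.firstDegen _
  | succ j =>
    cases n with
    | zero => exact j.elim0
    | succ m => exact hS.isDegenerate _ (ih m rfl j (toShift x))

theorem isNormalStep_serreStep (X : CubicalSet.{u}) : IsNormalStep (serreStep k X) :=
  (isNormalStep_leftStep X true).add (isNormalStep_rightStep X false)

theorem isNormalStep_serreStepFlip (X : CubicalSet.{u}) : IsNormalStep (serreStepFlip k X) :=
  (isNormalStep_rightStep X true).add (isNormalStep_leftStep X false)

theorem isDegenerate_serre {n : ℕ} (X : CubicalSet.{u}) (i : Fin (n + 1)) (x : X.obj n) :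
    IsDegenerate (serre k X (totCube k (X.s i x))) := by
  induction n generalizing X with
  | zero =>
    rw [totCube_eq_susp, serre_susp]
    exact (isNormalStep_serreStep X).isDegenerate_comp
      (serre k) (serre_totMap _) i x (fun m hm => by omega)
  | succ n ih =>
    rw [totCube_eq_susp, serre_susp]
    refine (isNormalStep_serreStep X).isDegenerate_comp (serre k) (serre_totMap _) i x
      (fun m hm => ?_)
    obtain rfl : n = m := by omega
    exact ih (shift X)

theorem isDegenerate_homotopy {n : ℕ} (X : CubicalSet.{u}) (i : Fin (n + 1)) (x : X.obj n) :
    IsDegenerate (homotopy k X (totCube k (X.s i x))) := by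
  induction n generalizing X with
  | zero =>
    intro p q
    rw [totCube_eq_susp, homotopy_susp, map_neg, map_add,
      (isNormalStep_squareStep X).isDegenerate_comp (serre k) (serre_totMap _) i x
        (fun m _ => isDegenerate_serre (shift X)),
      (isNormalStep_serreStepFlip X).isDegenerate_comp
        (homotopy k) (homotopy_totMap _) i x (fun m hm => by omega), add_zero, neg_zero]
  | succ n ih =>
    intro p q
    rw [totCube_eq_susp, homotopy_susp, map_neg, map_add,
      (isNormalStep_squareStep X).isDegenerate_comp (serre k) (serre_totMap _) i x
        (fun m _ => isDegenerate_serre (shift X)),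
      (isNormalStep_serreStepFlip X).isDegenerate_comp
        (homotopy k) (homotopy_totMap _) i x (fun m hm => ?_), add_zero, neg_zero]
    obtain rfl : n = m := by omega
    exact ih (shift X)

/-- A map on total chains which is degenerate on all degenerate cubes. -/
def PreservesDegenerates (F : Tot k X →ₗ[k] Tot k X ⊗[k] Tot k X) : Prop :=
  ∀ (n : ℕ) (i : Fin (n + 1)) (x : X.obj n), IsDegenerate (F (totCube k (X.s i x)))

theorem preservesDegenerates_leftHalf (X : CubicalSet.{u}) :
    PreservesDegenerates (leftHalf k X) := by
  intro n i x
  rw [totCube_eq_susp, leftHalf_susp]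
  exact (isNormalStep_leftStep X true).isDegenerate_comp (serre k) (serre_totMap _) i x
    (fun m _ => isDegenerate_serre (shift X))

theorem preservesDegenerates_rightHalf (X : CubicalSet.{u}) :
    PreservesDegenerates (rightHalf k X) := by
  intro n i x
  rw [totCube_eq_susp, rightHalf_susp]
  exact (isNormalStep_rightStep X false).isDegenerate_comp (serre k) (serre_totMap _) i x
    (fun m _ => isDegenerate_serre (shift X))

theorem preservesDegenerates_halfHomotopy (X : CubicalSet.{u}) :
    PreservesDegenerates (halfHomotopy k X) := by
  intro n i x p q
  rw [totCube_eq_susp, halfHomotopy_susp, map_neg,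
    (isNormalStep_rightStep X false).isDegenerate_comp (homotopy k) (homotopy_totMap _) i x
      (fun m _ => isDegenerate_homotopy (shift X)), neg_zero]

theorem PreservesDegenerates.degen_le {F : Tot k X →ₗ[k] Tot k X ⊗[k] Tot k X}
    (hF : PreservesDegenerates F) (n p q : ℕ) :
    degen k X n ≤ LinearMap.ker (toBichain k X p q ∘ₗ F ∘ₗ ofDegree k X n) := by
  cases n with
  | zero => exact bot_le
  | succ n =>
    refine Submodule.span_le.mpr ?_
    rintro _ ⟨⟨i, x⟩, rfl⟩
    change toBichain k X p q (F (ofDegree k X (n + 1) (Finsupp.single (X.s i x) 1))) = 0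
    rw [ofDegree_single]
    exact hF n i x p q

/-- The component `C_n → C_p ⊗ C_q` of a map on total chains. -/
def PreservesDegenerates.component {F : Tot k X →ₗ[k] Tot k X ⊗[k] Tot k X}
    (hF : PreservesDegenerates F) (n p q : ℕ) : Chain k X n →ₗ[k] Chain k X p ⊗[k] Chain k X q :=
  Submodule.liftQ _ (toBichain k X p q ∘ₗ F ∘ₗ ofDegree k X n) (hF.degen_le n p q)

theorem PreservesDegenerates.component_mkQ {F : Tot k X →ₗ[k] Tot k X ⊗[k] Tot k X}
    (hF : PreservesDegenerates F) (n p q : ℕ) (z : X.obj n →₀ k) :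
    hF.component n p q (Submodule.mkQ _ z) = toBichain k X p q (F (ofDegree k X n z)) := rfl

theorem PreservesDegenerates.component_cube {F : Tot k X →ₗ[k] Tot k X ⊗[k] Tot k X}
    (hF : PreservesDegenerates F) (n p q : ℕ) (x : X.obj n) :
    hF.component n p q (cube k X x) = toBichain k X p q (F (totCube k x)) := by
  rw [cube, component_mkQ, ofDegree_single]

/-- A map from chains to tensors of chains which preserves the degree. -/
def PreservesDegree (F : Tot k X →ₗ[k] Tot k X ⊗[k] Tot k X) : Prop :=
  ∀ (n : ℕ) (x : X.obj n) (p q : ℕ), p + q ≠ n → toBichain k X p q (F (totCube k x)) = 0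

theorem preservesDegree_serre (X : CubicalSet.{u}) : PreservesDegree (serre k X) := by
  intro n
  induction n generalizing X with
  | zero =>
    intro x p q h
    rw [serre_vertex, toBichain_tmul]
    by_cases hp : p = 0
    · rw [toChain_totCube_of_ne (p := q) (by omega), TensorProduct.tmul_zero]
    · rw [toChain_totCube_of_ne (p := p) (by omega), TensorProduct.zero_tmul]
  | succ n ih =>
    intro x p q h
    rw [totCube_eq_susp, serre_susp, serreStep, LinearMap.add_apply, map_add]
    have h1 : toBichain k X p q (leftStep k X true (serre k (shift X) (totCube k (toShift x)))) =
        0 := by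
      cases p with
      | zero => exact toBichain_zero_leftStep _ _ _
      | succ p => rw [toBichain_succ_leftStep, ih _ _ _ _ (by omega), map_zero]
    have h2 : toBichain k X p q (rightStep k X false (serre k (shift X) (totCube k (toShift x)))) =
        0 := by
      cases q with
      | zero => exact toBichain_zero_rightStep _ _ _
      | succ q => rw [toBichain_succ_rightStep, ih _ _ _ _ (by omega), map_zero, smul_zero]
    rw [h1, h2, add_zero]

theorem preservesDegree_leftHalf (X : CubicalSet.{u}) : PreservesDegree (leftHalf k X) := by
  intro n x p q h
  cases n with
  | zero => rw [leftHalf_vertex, map_zero]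
  | succ n =>
    rw [totCube_eq_susp, leftHalf_susp]
    cases p with
    | zero => exact toBichain_zero_leftStep _ _ _
    | succ p =>
      rw [toBichain_succ_leftStep, preservesDegree_serre _ _ _ _ _ (by omega), map_zero]

theorem preservesDegree_rightHalf (X : CubicalSet.{u}) : PreservesDegree (rightHalf k X) := by
  intro n x p q h
  cases n with
  | zero => rw [rightHalf_vertex, map_zero]
  | succ n =>
    rw [totCube_eq_susp, rightHalf_susp]
    cases q with
    | zero => exact toBichain_zero_rightStep _ _ _
    | succ q =>
      rw [toBichain_succ_rightStep, preservesDegree_serre _ _ _ _ _ (by omega), map_zero,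
        smul_zero]

theorem PreservesDegenerates.component_toChain {F : Tot k X →ₗ[k] Tot k X ⊗[k] Tot k X}
    (hF : PreservesDegenerates F) (hF' : PreservesDegree F) (p q : ℕ) (a : Tot k X) :
    hF.component (p + q) p q (toChain k X (p + q) a) = toBichain k X p q (F a) := by
  refine LinearMap.congr_fun (f := hF.component (p + q) p q ∘ₗ toChain k X (p + q))
    (g := toBichain k X p q ∘ₗ F) (tot_ext fun n x => ?_) a
  simp only [LinearMap.comp_apply]
  by_cases h : n = p + q
  · subst h
    rw [toChain_totCube, hF.component_cube]
  · rw [toChain_totCube_of_ne h, map_zero, hF' n x p q (Ne.symm h)]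

/-- The half-shuffle coproduct on normalized chains. -/
def halfComul (k : Type v) [Field k] (X : CubicalSet.{u}) (n p q : ℕ) :
    Chain k X n →ₗ[k] Chain k X p ⊗[k] Chain k X q :=
  (preservesDegenerates_leftHalf X).component n p q

theorem halfComul_mkQ (n p q : ℕ) (z : X.obj n →₀ k) :
    halfComul k X n p q (Submodule.mkQ _ z) =
      toBichain k X p q (leftHalf k X (ofDegree k X n z)) := rfl

theorem halfComul_toChain (p q : ℕ) (a : Tot k X) :
    halfComul k X (p + q) p q (toChain k X (p + q) a) = toBichain k X p q (leftHalf k X a) :=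
  (preservesDegenerates_leftHalf X).component_toChain (preservesDegree_leftHalf X) p q a

theorem toBichain_tensorBoundary (p q : ℕ) (t : Tot k X ⊗[k] Tot k X) :
    toBichain k X p q (tensorBoundary k X t) =
      (boundary k X p).rTensor _ (toBichain k X (p + 1) q t) +
        (-1 : k) ^ p • (boundary k X q).lTensor _ (toBichain k X p (q + 1) t) := by
  induction t with
  | zero => simp
  | add s t hs ht => simp only [map_add, hs, ht, smul_add]; abel
  | tmul a b =>
    simp [tensorBoundary_tmul, toBichain_tmul, toChain_totBoundary, toChain_signMap,
      TensorProduct.smul_tmul']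

theorem toBichain_totFlip (p q : ℕ) (t : Tot k X ⊗[k] Tot k X) :
    toBichain k X q p (totFlip k X t) =
      gradedFlip k (Chain k X) p q (toBichain k X p q t) := by
  refine LinearMap.congr_fun (f := toBichain k X q p ∘ₗ totFlip k X)
    (g := gradedFlip k (Chain k X) p q ∘ₗ toBichain k X p q)
    (tot_tensor_ext fun m n x y => ?_) t
  simp only [LinearMap.comp_apply, totFlip_tmul, map_smul, toBichain_tmul, gradedFlip,
    LinearMap.smul_apply, LinearEquiv.coe_coe, TensorProduct.comm_tmul]
  by_cases hm : m = p
  · by_cases hn : n = q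
    · subst hm hn
      rfl
    · simp [toChain_totCube_of_ne hn]
  · simp [toChain_totCube_of_ne hm]

theorem totBoundary_ofDegree (n : ℕ) (z : X.obj (n + 1) →₀ k) :
    totBoundary k X (ofDegree k X (n + 1) z) = ofDegree k X n (preBoundary k X n z) := by
  refine LinearMap.congr_fun (f := totBoundary k X ∘ₗ ofDegree k X (n + 1))
    (g := ofDegree k X n ∘ₗ preBoundary k X n)
    (Finsupp.lhom_ext' fun x => LinearMap.ext_ring ?_) z
  simp only [LinearMap.comp_apply, Finsupp.lsingle_apply, ofDegree_single, totBoundary_totCube,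
    preBoundary, LinearMap.sum_apply, LinearMap.smul_apply, LinearMap.sub_apply,
    Finsupp.lmapDomain_apply, Finsupp.mapDomain_single, map_sum, map_smul, map_sub]

theorem totBoundary_ofDegree_zero (z : X.obj 0 →₀ k) :
    totBoundary k X (ofDegree k X 0 z) = 0 := by
  refine LinearMap.congr_fun (f := totBoundary k X ∘ₗ ofDegree k X 0)
    (g := 0) (Finsupp.lhom_ext' fun x => LinearMap.ext_ring ?_) z
  simp only [LinearMap.comp_apply, Finsupp.lsingle_apply, ofDegree_single, totBoundary_vertex]
  rfl

/-- The differential of a lift of a normalized cycle is degenerate, so that maps which preserve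
degenerates do not see it. -/
theorem PreservesDegenerates.isDegenerate_totBoundary {F : Tot k X →ₗ[k] Tot k X ⊗[k] Tot k X}
    (hF : PreservesDegenerates F) {n : ℕ} (z : X.obj n →₀ k)
    (hz : Submodule.mkQ (degen k X n) z ∈ cycles k X n) :
    IsDegenerate (F (totBoundary k X (ofDegree k X n z))) := by
  intro p q
  cases n with
  | zero => rw [totBoundary_ofDegree_zero, map_zero, map_zero]
  | succ n =>
    rw [totBoundary_ofDegree]
    exact hF.degen_le n p q ((Submodule.Quotient.mk_eq_zero _).mp hz)

end Normalization

/-! ### Splitting the normalized chains over a field -/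

section Splitting

variable (k : Type v) [Field k] (X : CubicalSet.{u})

theorem exists_quasi_inverse {V : Type*} {W : Type*} [AddCommGroup V] [Module k V] [AddCommGroup W]
    [Module k W] (f : V →ₗ[k] W) : ∃ g : W →ₗ[k] V, ∀ v, f (g (f v)) = f v := by
  obtain ⟨g, hg⟩ := f.rangeRestrict.exists_rightInverse_of_surjective f.range_rangeRestrict
  obtain ⟨h, hh⟩ := LinearMap.exists_extend g
  refine ⟨h, fun v => ?_⟩
  have h1 : h (f v) = g (f.rangeRestrict v) := LinearMap.congr_fun hh (f.rangeRestrict v)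
  rw [h1]
  exact congrArg Subtype.val (LinearMap.congr_fun hg (f.rangeRestrict v))

/-- A linear choice of primitives of boundaries. -/
def primitive (n : ℕ) : Chain k X n →ₗ[k] Chain k X (n + 1) :=
  (exists_quasi_inverse k (boundary k X n)).choose

theorem boundary_primitive (n : ℕ) (c : Chain k X (n + 1)) :
    boundary k X n (primitive k X n (boundary k X n c)) = boundary k X n c :=
  (exists_quasi_inverse k (boundary k X n)).choose_spec c

/-- The projection of `C_n` onto the complement of the cycles that consists of chosen
primitives. -/
def primitivePart : ∀ n : ℕ, Chain k X n →ₗ[k] Chain k X n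
  | 0 => 0
  | n + 1 => primitive k X n ∘ₗ boundary k X n

theorem sub_primitivePart_mem (n : ℕ) (c : Chain k X n) :
    c - primitivePart k X n c ∈ cycles k X n := by
  cases n with
  | zero => exact Submodule.mem_top
  | succ n =>
    change boundary k X n (c - primitive k X n (boundary k X n c)) = 0
    rw [map_sub, boundary_primitive, sub_self]

theorem primitivePart_of_mem {n : ℕ} {c : Chain k X n} (hc : c ∈ cycles k X n) :
    primitivePart k X n c = 0 := by
  cases n with
  | zero => rfl
  | succ n =>
    change primitive k X n (boundary k X n c) = 0
    rw [(hc : boundary k X n c = 0), map_zero]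

/-- A projection of the chains onto the cycles. -/
def toCycle (n : ℕ) : Chain k X n →ₗ[k] cycles k X n :=
  LinearMap.codRestrict _ (LinearMap.id - primitivePart k X n) (sub_primitivePart_mem k X n)

/-- A chain map from the chains to the homology, extending the map from cycles to their classes. -/
def retract (n : ℕ) : Chain k X n →ₗ[k] Homology k X n :=
  homologyClass k X n ∘ₗ toCycle k X n

/-- A linear choice of representatives of homology classes. -/
def representative (n : ℕ) : Homology k X n →ₗ[k] cycles k X n :=
  ((homologyClass k X n).exists_rightInverse_of_surjective
    (LinearMap.range_eq_top.mpr (homologyClass_surjective k X n))).choose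

theorem homologyClass_representative (n : ℕ) (a : Homology k X n) :
    homologyClass k X n (representative k X n a) = a :=
  LinearMap.congr_fun ((homologyClass k X n).exists_rightInverse_of_surjective
    (LinearMap.range_eq_top.mpr (homologyClass_surjective k X n))).choose_spec a

variable {k X}

theorem toCycle_of_mem {n : ℕ} (c : cycles k X n) : toCycle k X n c = c := by
  apply Subtype.ext
  change c.1 - primitivePart k X n c.1 = c.1
  rw [primitivePart_of_mem k X c.2, sub_zero]

theorem retract_cycle {n : ℕ} (c : cycles k X n) : retract k X n c = homologyClass k X n c := by
  rw [retract, LinearMap.comp_apply, toCycle_of_mem]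

theorem totBoundary_totBoundary (X : CubicalSet.{u}) (a : Tot k X) :
    totBoundary k X (totBoundary k X a) = 0 := by
  refine LinearMap.congr_fun (tot_ext_induction
    (fun X => totBoundary k X ∘ₗ totBoundary k X) (fun X => 0) (fun X x => ?_)
    (fun X a ih => ?_) X) a
  · simp [totBoundary_vertex]
  · simp only [LinearMap.comp_apply, LinearMap.zero_apply] at ih ⊢
    simp only [totBoundary_susp, map_sub, totBoundary_totMap, ih, map_zero]
    abel

theorem boundary_boundary (n : ℕ) (c : Chain k X (n + 2)) :
    boundary k X n (boundary k X (n + 1) c) = 0 := by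
  refine LinearMap.congr_fun (f := boundary k X n ∘ₗ boundary k X (n + 1)) (g := 0)
    (chain_ext fun x => ?_) c
  rw [LinearMap.comp_apply, ← toChain_totCube, ← toChain_totBoundary, ← toChain_totBoundary,
    totBoundary_totBoundary, map_zero, LinearMap.zero_apply]

theorem boundary_mem_cycles (n : ℕ) (c : Chain k X (n + 1)) :
    boundary k X n c ∈ cycles k X n := by
  cases n with
  | zero => exact Submodule.mem_top
  | succ n => exact boundary_boundary n c

theorem homologyClass_boundary (n : ℕ) (c : Chain k X (n + 1)) :
    homologyClass k X n ⟨boundary k X n c, boundary_mem_cycles n c⟩ = 0 :=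
  (Submodule.Quotient.mk_eq_zero _).mpr ⟨c, rfl⟩

theorem retract_boundary (n : ℕ) (c : Chain k X (n + 1)) :
    retract k X n (boundary k X n c) = 0 :=
  (retract_cycle ⟨boundary k X n c, boundary_mem_cycles n c⟩).trans (homologyClass_boundary n c)

theorem boundary_cycle (n : ℕ) (c : cycles k X (n + 1)) : boundary k X n c = 0 := c.2

variable (k X)

/-- The projection of the chains onto the chosen representatives of homology classes. -/
def harmonic (n : ℕ) : Chain k X n →ₗ[k] Chain k X n :=
  (cycles k X n).subtype ∘ₗ representative k X n ∘ₗ retract k X n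

/-- The contracting homotopy from the identity to `harmonic`. -/
def contraction (n : ℕ) : Chain k X n →ₗ[k] Chain k X (n + 1) :=
  primitive k X n ∘ₗ ((cycles k X n).subtype ∘ₗ toCycle k X n - harmonic k X n)

variable {k X}

theorem boundary_harmonic (n : ℕ) (c : Chain k X (n + 1)) :
    boundary k X n (harmonic k X (n + 1) c) = 0 :=
  boundary_cycle n (representative k X (n + 1) (retract k X (n + 1) c))

theorem harmonic_boundary (n : ℕ) (c : Chain k X (n + 1)) :
    harmonic k X n (boundary k X n c) = 0 := by
  simp [harmonic, retract_boundary]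

theorem contraction_boundary (n : ℕ) (c : Chain k X (n + 1)) :
    contraction k X n (boundary k X n c) = primitivePart k X (n + 1) c := by
  have h : (toCycle k X n (boundary k X n c) : Chain k X n) = boundary k X n c :=
    congrArg Subtype.val (toCycle_of_mem ⟨boundary k X n c, boundary_mem_cycles n c⟩)
  simp [contraction, h, harmonic_boundary, primitivePart]

/-- A cycle that represents zero is the boundary of its contraction. -/
theorem boundary_contraction (n : ℕ) (c : Chain k X n) :
    boundary k X n (contraction k X n c) = c - primitivePart k X n c - harmonic k X n c := by
  have h : ∃ b, boundary k X n b = (toCycle k X n c : Chain k X n) - harmonic k X n c := by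
    have h0 : homologyClass k X n
        (toCycle k X n c - representative k X n (retract k X n c)) = 0 := by
      rw [map_sub, homologyClass_representative, retract, LinearMap.comp_apply, sub_self]
    exact (Submodule.Quotient.mk_eq_zero _).mp h0
  obtain ⟨b, hb⟩ := h
  have h1 : contraction k X n c = primitive k X n (boundary k X n b) := by rw [hb]; rfl
  rw [h1, boundary_primitive, hb]
  rfl

theorem eq_harmonic_add (n : ℕ) (c : Chain k X n) :
    c = harmonic k X n c + boundary k X n (contraction k X n c) + primitivePart k X n c := by
  rw [boundary_contraction]
  abel

/-- A family of tensors of chains which is a cycle of the total complex. -/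
def IsTensorCycle (w : ∀ p q : ℕ, Chain k X p ⊗[k] Chain k X q) : Prop :=
  ∀ p q : ℕ, (boundary k X p).rTensor _ (w (p + 1) q) +
    (-1 : k) ^ p • (boundary k X q).lTensor _ (w p (q + 1)) = 0

/-- The homotopy from the identity of `C ⊗ C` to `harmonic ⊗ harmonic`: its first summand. -/
def contractLeft (w : ∀ p q : ℕ, Chain k X p ⊗[k] Chain k X q) :
    ∀ p q : ℕ, Chain k X p ⊗[k] Chain k X q
  | 0, _ => 0
  | p + 1, q => (contraction k X p).rTensor _ (w p q)

/-- The homotopy from the identity of `C ⊗ C` to `harmonic ⊗ harmonic`: its second summand. -/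
def contractRight (w : ∀ p q : ℕ, Chain k X p ⊗[k] Chain k X q) :
    ∀ p q : ℕ, Chain k X p ⊗[k] Chain k X q
  | _, 0 => 0
  | p, q + 1 => (-1 : k) ^ p • TensorProduct.map (harmonic k X p) (contraction k X q) (w p q)

/-- The Künneth decomposition of a tensor cycle into a tensor of cycles and a boundary. -/
theorem IsTensorCycle.kuenneth {w : ∀ p q : ℕ, Chain k X p ⊗[k] Chain k X q}
    (hw : IsTensorCycle w) (p q : ℕ) :
    w p q = TensorProduct.map (harmonic k X p) (harmonic k X q) (w p q) +
      ((boundary k X p).rTensor _ ((contractLeft w + contractRight w) (p + 1) q) +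
        (-1 : k) ^ p •
          (boundary k X q).lTensor _ ((contractLeft w + contractRight w) p (q + 1))) := by
  have decomp : ∀ c : Chain k X p ⊗[k] Chain k X q,
      c = TensorProduct.map (harmonic k X p) (harmonic k X q) c +
        (boundary k X p).rTensor _ ((contraction k X p).rTensor _ c) +
        (primitivePart k X p).rTensor _ c +
        (boundary k X q).lTensor _ (TensorProduct.map (harmonic k X p) (contraction k X q) c) +
        TensorProduct.map (harmonic k X p) (primitivePart k X q) c := by
    intro c
    induction c with
    | zero => simp
    | add s t hs ht =>
      conv_lhs => rw [hs, ht]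
      simp only [map_add]
      abel
    | tmul a b =>
      conv_lhs => rw [eq_harmonic_add p a, TensorProduct.add_tmul, TensorProduct.add_tmul]
      conv_lhs => enter [1, 1, 3]; rw [eq_harmonic_add q b]
      simp only [TensorProduct.tmul_add, TensorProduct.map_tmul, LinearMap.rTensor_tmul,
        LinearMap.lTensor_tmul]
      abel
  have one : (-1 : k) ^ p * (-1 : k) ^ p = 1 := by rw [← mul_pow]; simp
  -- the part of the left homotopy that compensates `primitivePart ⊗ 1`
  have left : (-1 : k) ^ p • (boundary k X q).lTensor _ (contractLeft w p (q + 1)) =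
      (primitivePart k X p).rTensor _ (w p q) := by
    cases p with
    | zero => simp [contractLeft, primitivePart]
    | succ p =>
      have h1 : ∀ c : Chain k X (p + 1) ⊗[k] Chain k X q,
          (primitivePart k X (p + 1)).rTensor _ c =
            (contraction k X p).rTensor _ ((boundary k X p).rTensor _ c) := by
        intro c
        induction c with
        | zero => simp
        | add s t hs ht => simp only [map_add, hs, ht]
        | tmul a b => simp [contraction_boundary]
      have h2 : ∀ c : Chain k X p ⊗[k] Chain k X (q + 1),
          (boundary k X q).lTensor _ ((contraction k X p).rTensor _ c) =
            (contraction k X p).rTensor _ ((boundary k X q).lTensor _ c) := by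
        intro c
        induction c with
        | zero => simp
        | add s t hs ht => simp only [map_add, hs, ht]
        | tmul a b => simp
      rw [h1, eq_neg_of_add_eq_zero_left (hw p q), contractLeft, h2, map_neg, map_smul, pow_succ]
      module
  have right : (boundary k X p).rTensor _ (contractRight w (p + 1) q) = 0 := by
    cases q with
    | zero => simp [contractRight]
    | succ q =>
      rw [contractRight, map_smul]
      generalize w (p + 1) q = c
      induction c with
      | zero => simp
      | add s t hs ht => simp only [map_add, smul_add, hs, ht, add_zero]
      | tmul a b => simp [boundary_harmonic]
  have zero : TensorProduct.map (harmonic k X p) (primitivePart k X q) (w p q) = 0 := by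
    cases q with
    | zero => simp [primitivePart]
    | succ q =>
      have h1 : ∀ c : Chain k X p ⊗[k] Chain k X (q + 1),
          TensorProduct.map (harmonic k X p) (primitivePart k X (q + 1)) c =
            TensorProduct.map (harmonic k X p) (contraction k X q)
              ((boundary k X q).lTensor _ c) := by
        intro c
        induction c with
        | zero => simp
        | add s t hs ht => simp only [map_add, hs, ht]
        | tmul a b => simp [contraction_boundary]
      have h2 : ∀ c : Chain k X (p + 1) ⊗[k] Chain k X q,
          TensorProduct.map (harmonic k X p) (contraction k X q)
              ((boundary k X p).rTensor _ c) = 0 := by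
        intro c
        induction c with
        | zero => simp
        | add s t hs ht => simp only [map_add, hs, ht, add_zero]
        | tmul a b => simp [harmonic_boundary]
      have h3 : (boundary k X q).lTensor _ (w p (q + 1)) =
          -((-1 : k) ^ p • (boundary k X p).rTensor _ (w (p + 1) q)) := by
        rw [eq_neg_of_add_eq_zero_left (hw p q), smul_neg, smul_smul, one, one_smul, neg_neg]
      rw [h1, h3, map_neg, map_smul, h2, smul_zero, neg_zero]
  have right' : (-1 : k) ^ p • (boundary k X q).lTensor _ (contractRight w p (q + 1)) =
      (boundary k X q).lTensor _
        (TensorProduct.map (harmonic k X p) (contraction k X q) (w p q)) := by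
    rw [contractRight, map_smul, smul_smul, one, one_smul]
  have left' : (boundary k X p).rTensor (Chain k X q) (contractLeft w (p + 1) q) =
      (boundary k X p).rTensor _ ((contraction k X p).rTensor _ (w p q)) := rfl
  conv_lhs => rw [decomp (w p q)]
  simp only [Pi.add_apply, map_add, smul_add, left, right, right', left', zero]
  abel

/-- If `f` vanishes on cycles and `g` vanishes on boundaries, then `f ⊗ g` vanishes on tensor
cycles. -/
theorem IsTensorCycle.map_eq_zero_of_left {w : ∀ p q : ℕ, Chain k X p ⊗[k] Chain k X q}
    (hw : IsTensorCycle w) {p q : ℕ} {V W : Type*} [AddCommGroup V] [Module k V] [AddCommGroup W]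
    [Module k W] (f : Chain k X p →ₗ[k] V) (g : Chain k X q →ₗ[k] W)
    (hf : ∀ c : cycles k X p, f c = 0) (hg : ∀ c, g (boundary k X q c) = 0) :
    TensorProduct.map f g (w p q) = 0 := by
  have h1 : ∀ c, TensorProduct.map f g (TensorProduct.map (harmonic k X p) (harmonic k X q) c) =
      0 := by
    intro c
    induction c with
    | zero => simp
    | add s t hs ht => simp only [map_add, hs, ht, add_zero]
    | tmul a b =>
      have := hf (representative k X p (retract k X p a))
      simp [harmonic, this]
  have h2 : ∀ c, TensorProduct.map f g ((boundary k X p).rTensor _ c) = 0 := by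
    intro c
    induction c with
    | zero => simp
    | add s t hs ht => simp only [map_add, hs, ht, add_zero]
    | tmul a b =>
      have := hf ⟨_, boundary_mem_cycles p a⟩
      simp at this
      simp [this]
  have h3 : ∀ c, TensorProduct.map f g ((boundary k X q).lTensor _ c) = 0 := by
    intro c
    induction c with
    | zero => simp
    | add s t hs ht => simp only [map_add, hs, ht, add_zero]
    | tmul a b => simp [hg]
  rw [hw.kuenneth p q, map_add, map_add, map_smul, h1, h2, h3, smul_zero, add_zero, add_zero]

/-- If `f` vanishes on boundaries and `g` vanishes on cycles, then `f ⊗ g` vanishes on tensor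
cycles. -/
theorem IsTensorCycle.map_eq_zero_of_right {w : ∀ p q : ℕ, Chain k X p ⊗[k] Chain k X q}
    (hw : IsTensorCycle w) {p q : ℕ} {V W : Type*} [AddCommGroup V] [Module k V] [AddCommGroup W]
    [Module k W] (f : Chain k X p →ₗ[k] V) (g : Chain k X q →ₗ[k] W)
    (hf : ∀ c, f (boundary k X p c) = 0) (hg : ∀ c : cycles k X q, g c = 0) :
    TensorProduct.map f g (w p q) = 0 := by
  have h1 : ∀ c, TensorProduct.map f g (TensorProduct.map (harmonic k X p) (harmonic k X q) c) =
      0 := by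
    intro c
    induction c with
    | zero => simp
    | add s t hs ht => simp only [map_add, hs, ht, add_zero]
    | tmul a b =>
      have := hg (representative k X q (retract k X q b))
      simp [harmonic, this]
  have h2 : ∀ c, TensorProduct.map f g ((boundary k X p).rTensor _ c) = 0 := by
    intro c
    induction c with
    | zero => simp
    | add s t hs ht => simp only [map_add, hs, ht, add_zero]
    | tmul a b => simp [hf]
  have h3 : ∀ c, TensorProduct.map f g ((boundary k X q).lTensor _ c) = 0 := by
    intro c
    induction c with
    | zero => simp
    | add s t hs ht => simp only [map_add, hs, ht, add_zero]
    | tmul a b =>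
      have := hg ⟨_, boundary_mem_cycles q b⟩
      simp at this
      simp [this]
  rw [hw.kuenneth p q, map_add, map_add, map_smul, h1, h2, h3, smul_zero, add_zero, add_zero]

end Splitting

/-! ### The coZinbiel structure on homology -/

section Structure

variable {k : Type v} [Field k] {X Y : CubicalSet.{u}}

/-- A cubical set with exactly one vertex, in which the two first faces of each cube agree. -/
structure IsReduced (X : CubicalSet.{u}) : Prop where
  equalFirstFaces : EqualFirstFaces X
  existsUnique_vertex : ∃ v : X.obj 0, ∀ x : X.obj 0, x = v

/-- The tensor square of the maps `retract`, which sends a cycle of `C ⊗ C` to its class under the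
Künneth isomorphism. -/
def tensorRetract (k : Type v) [Field k] (X : CubicalSet.{u}) (p q : ℕ) :
    Chain k X p ⊗[k] Chain k X q →ₗ[k] Homology k X p ⊗[k] Homology k X q :=
  TensorProduct.map (retract k X p) (retract k X q)

theorem tensorRetract_rTensor_boundary (p q : ℕ) (c : Chain k X (p + 1) ⊗[k] Chain k X q) :
    tensorRetract k X p q ((boundary k X p).rTensor _ c) = 0 := by
  induction c with
  | zero => simp
  | add s t hs ht => simp only [map_add, hs, ht, add_zero]
  | tmul a b => simp [tensorRetract, retract_boundary]

theorem tensorRetract_lTensor_boundary (p q : ℕ) (c : Chain k X p ⊗[k] Chain k X (q + 1)) :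
    tensorRetract k X p q ((boundary k X q).lTensor _ c) = 0 := by
  induction c with
  | zero => simp
  | add s t hs ht => simp only [map_add, hs, ht, add_zero]
  | tmul a b => simp [tensorRetract, retract_boundary]

theorem tensorRetract_tensorBoundary (p q : ℕ) (t : Tot k X ⊗[k] Tot k X) :
    tensorRetract k X p q (toBichain k X p q (tensorBoundary k X t)) = 0 := by
  rw [toBichain_tensorBoundary, map_add, map_smul, tensorRetract_rTensor_boundary,
    tensorRetract_lTensor_boundary, smul_zero, add_zero]

theorem IsReduced.tensorRetract_halfComul_boundary (hX : IsReduced X) (n p q : ℕ)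
    (c : Chain k X (n + 1)) :
    tensorRetract k X p q (halfComul k X n p q (boundary k X n c)) = 0 := by
  obtain ⟨z, rfl⟩ := Submodule.mkQ_surjective _ c
  have h : boundary k X n (Submodule.mkQ _ z) = Submodule.mkQ _ (preBoundary k X n z) := rfl
  rw [h, halfComul_mkQ, ← totBoundary_ofDegree, ← hX.equalFirstFaces.tensorBoundary_leftHalf,
    tensorRetract_tensorBoundary]

/-- The component `H_n → H_p ⊗ H_q` of the coproduct on homology. -/
def homologyComul (k : Type v) [Field k] {X : CubicalSet.{u}} (hX : IsReduced X) (n p q : ℕ) :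
    Homology k X n →ₗ[k] Homology k X p ⊗[k] Homology k X q :=
  Submodule.liftQ _ (tensorRetract k X p q ∘ₗ halfComul k X n p q ∘ₗ (cycles k X n).subtype) (by
    rintro ⟨c, hc⟩ ⟨b, hb⟩
    obtain rfl : boundary k X n b = c := hb
    exact hX.tensorRetract_halfComul_boundary n p q b)

theorem homologyComul_class (hX : IsReduced X) (n p q : ℕ) (c : cycles k X n) :
    homologyComul k hX n p q (homologyClass k X n c) =
      tensorRetract k X p q (halfComul k X n p q c) := rfl

/-- The sum of the coefficients of a `0`-chain. -/
def augmentation (k : Type v) [Field k] (X : CubicalSet.{u}) : Chain k X 0 →ₗ[k] k :=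
  Submodule.liftQ _ (Finsupp.linearCombination k fun _ => (1 : k)) bot_le

theorem augmentation_cube (x : X.obj 0) : augmentation k X (cube k X x) = 1 := by
  change Finsupp.linearCombination k (fun _ => (1 : k)) (Finsupp.single x 1) = 1
  simp

theorem augmentation_boundary (c : Chain k X 1) :
    augmentation k X (boundary k X 0 c) = 0 := by
  refine LinearMap.congr_fun (f := augmentation k X ∘ₗ boundary k X 0) (g := 0)
    (chain_ext fun x => ?_) c
  simp [boundary_cube, augmentation_cube]

theorem augmentation_chainMap (f : X ⟶ Y) (c : Chain k X 0) :
    augmentation k Y (chainMap k f 0 c) = augmentation k X c := by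
  refine LinearMap.congr_fun (f := augmentation k Y ∘ₗ chainMap k f 0) (g := augmentation k X)
    (chain_ext fun x => ?_) c
  simp [chainMap_cube, augmentation_cube]

/-- The augmentation on homology. -/
def homologyCounit (k : Type v) [Field k] (X : CubicalSet.{u}) : Homology k X 0 →ₗ[k] k :=
  Submodule.liftQ _ (augmentation k X ∘ₗ (cycles k X 0).subtype) (by
    rintro ⟨c, hc⟩ ⟨b, hb⟩
    obtain rfl : boundary k X 0 b = c := hb
    exact augmentation_boundary b)

theorem homologyCounit_class (c : cycles k X 0) :
    homologyCounit k X (homologyClass k X 0 c) = augmentation k X c := rfl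

theorem homologyCounit_retract (c : Chain k X 0) :
    homologyCounit k X (retract k X 0 c) = augmentation k X c := by
  have : c ∈ cycles k X 0 := Submodule.mem_top
  rw [retract_cycle ⟨c, this⟩, homologyCounit_class]

theorem IsReduced.homologyCounit_bijective (hX : IsReduced X) :
    Function.Bijective (homologyCounit k X) := by
  obtain ⟨v, hv⟩ := hX.existsUnique_vertex
  constructor
  · rw [injective_iff_map_eq_zero]
    intro a ha
    obtain ⟨c, rfl⟩ := homologyClass_surjective k X 0 a
    rw [homologyCounit_class] at ha
    have h : (c : Chain k X 0) = augmentation k X c • cube k X v := by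
      refine LinearMap.congr_fun (f := LinearMap.id)
        (g := (augmentation k X).smulRight (cube k X v)) (chain_ext fun x => ?_) c.1
      simp [augmentation_cube, hv x]
    have : c = 0 := Subtype.ext (by rw [h, ha, zero_smul]; rfl)
    rw [this, map_zero]
  · intro a
    refine ⟨homologyClass k X 0 ⟨a • cube k X v, Submodule.mem_top⟩, ?_⟩
    rw [homologyCounit_class, map_smul, augmentation_cube, smul_eq_mul, mul_one]

/-- The Serre diagonal is counital on the right. -/
theorem augmentation_serre (X : CubicalSet.{u}) (n : ℕ) (x : X.obj n) :
    (augmentation k X).lTensor _ (toBichain k X n 0 (serre k X (totCube k x))) =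
      cube k X x ⊗ₜ 1 := by
  induction n generalizing X with
  | zero => simp [serre_vertex, toBichain_tmul, augmentation_cube]
  | succ n ih =>
    have h : ∀ c, (augmentation k X).lTensor _ (TensorProduct.map (chainSusp k X n)
        (chainMap k (firstFace X true) 0) c) =
          (chainSusp k X n).rTensor _ ((augmentation k (shift X)).lTensor _ c) := by
      intro c
      induction c with
      | zero => simp
      | add s t hs ht => simp only [map_add, hs, ht]
      | tmul a b => simp [augmentation_chainMap]
    rw [totCube_eq_susp, serre_susp, serreStep, LinearMap.add_apply, map_add,
      toBichain_zero_rightStep, add_zero, toBichain_succ_leftStep, h, ih, LinearMap.rTensor_tmul,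
      chainSusp_cube, ofShift_toShift]

theorem augmentation_halfComul {n : ℕ} (hn : 0 < n) (c : Chain k X n) :
    (augmentation k X).lTensor _ (halfComul k X n n 0 c) = c ⊗ₜ 1 := by
  obtain ⟨n, rfl⟩ := Nat.exists_eq_succ_of_ne_zero hn.ne'
  refine LinearMap.congr_fun (f := (augmentation k X).lTensor _ ∘ₗ halfComul k X (n + 1) (n + 1) 0)
    (g := (TensorProduct.mk k _ _).flip 1) (chain_ext fun x => ?_) c
  have h : toBichain k X (n + 1) 0 (leftHalf k X (totCube k x)) =
      toBichain k X (n + 1) 0 (serre k X (totCube k x)) := by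
    rw [totCube_eq_susp, serre_susp_eq_add, map_add, rightHalf_susp, toBichain_zero_rightStep,
      add_zero]
  have h' : halfComul k X (n + 1) (n + 1) 0 (cube k X x) =
      toBichain k X (n + 1) 0 (leftHalf k X (totCube k x)) :=
    (preservesDegenerates_leftHalf X).component_cube _ _ _ x
  rw [LinearMap.comp_apply, h', h, augmentation_serre]
  rfl

theorem halfComul_zero_left (n q : ℕ) : halfComul k X n 0 q = 0 := by
  refine chain_ext fun x => ?_
  have h' : halfComul k X n 0 q (cube k X x) =
      toBichain k X 0 q (leftHalf k X (totCube k x)) :=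
    (preservesDegenerates_leftHalf X).component_cube _ _ _ x
  rw [h']
  cases n with
  | zero => rw [leftHalf_vertex, map_zero]; rfl
  | succ n => rw [totCube_eq_susp, leftHalf_susp, toBichain_zero_leftStep]; rfl

/-- The coproduct of a lift of a normalized cycle is a cycle in `C ⊗ C`. -/
theorem IsReduced.isTensorCycle (hX : IsReduced X) {n : ℕ} (z : X.obj n →₀ k)
    (hz : Submodule.mkQ (degen k X n) z ∈ cycles k X n) :
    IsTensorCycle fun p q => toBichain k X p q (leftHalf k X (ofDegree k X n z)) := by
  intro p q
  rw [← toBichain_tensorBoundary, hX.equalFirstFaces.tensorBoundary_leftHalf,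
    (preservesDegenerates_leftHalf X).isDegenerate_totBoundary z hz]

/-- The chain level coproduct and the coproduct on homology correspond under `retract`. -/
theorem homologyComul_retract_sub (hX : IsReduced X) (n p q : ℕ) (c : cycles k X n) :
    (homologyComul k hX n p q ∘ₗ retract k X n -
      tensorRetract k X p q ∘ₗ halfComul k X n p q) c = 0 := by
  rw [LinearMap.sub_apply, LinearMap.comp_apply, retract_cycle, homologyComul_class,
    LinearMap.comp_apply, sub_self]

/-- On homology the right half of the Serre diagonal and the flip of the left half agree. -/
theorem IsReduced.tensorRetract_rightHalf (hX : IsReduced X) {n : ℕ} (p q : ℕ) (z : X.obj n →₀ k)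
    (hz : Submodule.mkQ (degen k X n) z ∈ cycles k X n) :
    tensorRetract k X p q (toBichain k X p q (rightHalf k X (ofDegree k X n z))) =
      tensorRetract k X p q (gradedFlip k (Chain k X) q p
        (toBichain k X q p (leftHalf k X (ofDegree k X n z)))) := by
  rw [← toBichain_totFlip, ← sub_eq_zero, ← map_sub, ← map_sub,
    hX.equalFirstFaces.rightHalf_sub_totFlip_leftHalf, map_add, map_add,
    tensorRetract_tensorBoundary,
    (preservesDegenerates_halfHomotopy X).isDegenerate_totBoundary z hz, map_zero, add_zero]

theorem gradedFlip_tensorRetract (p q : ℕ) (c : Chain k X p ⊗[k] Chain k X q) :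
    gradedFlip k (Homology k X) p q (tensorRetract k X p q c) =
      tensorRetract k X q p (gradedFlip k (Chain k X) p q c) := by
  induction c with
  | zero => simp
  | add s t hs ht => simp only [map_add, hs, ht]
  | tmul a b => simp [gradedFlip, tensorRetract]

/-- In positive total degree the Serre diagonal is the sum of its two halves. -/
theorem toBichain_serre (p q : ℕ) (h : 0 < p + q) (a : Tot k X) :
    toBichain k X p q (serre k X a) =
      toBichain k X p q (leftHalf k X a) + toBichain k X p q (rightHalf k X a) := by
  refine LinearMap.congr_fun (f := toBichain k X p q ∘ₗ serre k X)
    (g := toBichain k X p q ∘ₗ leftHalf k X + toBichain k X p q ∘ₗ rightHalf k X)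
    (tot_ext_susp (fun x => ?_) fun a => ?_) a
  · simp only [LinearMap.comp_apply, LinearMap.add_apply, leftHalf_vertex, rightHalf_vertex,
      map_zero, add_zero]
    exact preservesDegree_serre X 0 x p q h.ne'
  · simp only [LinearMap.comp_apply, LinearMap.add_apply]
    rw [serre_susp_eq_add, map_add]

/-- The right half of the coproduct on normalized chains. -/
def rightComul (k : Type v) [Field k] (X : CubicalSet.{u}) (n p q : ℕ) :
    Chain k X n →ₗ[k] Chain k X p ⊗[k] Chain k X q :=
  (preservesDegenerates_rightHalf X).component n p q

theorem rightComul_toChain (p q : ℕ) (a : Tot k X) :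
    rightComul k X (p + q) p q (toChain k X (p + q) a) = toBichain k X p q (rightHalf k X a) :=
  (preservesDegenerates_rightHalf X).component_toChain (preservesDegree_rightHalf X) p q a

variable (k) in
/-- The tri-degree `(p, q, r)` part of a threefold tensor, in homology. -/
def tripleRetract (X : CubicalSet.{u}) (p q r : ℕ) : Tot k X ⊗[k] (Tot k X ⊗[k] Tot k X) →ₗ[k]
    Homology k X p ⊗[k] (Homology k X q ⊗[k] Homology k X r) :=
  TensorProduct.map (retract k X p ∘ₗ toChain k X p)
    (tensorRetract k X q r ∘ₗ toBichain k X q r)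

theorem IsReduced.coZinbiel_left (hX : IsReduced X) {n : ℕ} (p q r : ℕ) (z : X.obj n →₀ k)
    (hz : Submodule.mkQ (degen k X n) z ∈ cycles k X n) :
    TensorProduct.assoc k _ _ _ ((homologyComul k hX (p + q) p q).rTensor _
      (homologyComul k hX n (p + q) r (homologyClass k X n ⟨_, hz⟩))) =
    tripleRetract k X p q r (TensorProduct.assoc k _ _ _
      ((leftHalf k X).rTensor _ (leftHalf k X (ofDegree k X n z)))) := by
  have h1 : ∀ c : Chain k X (p + q) ⊗[k] Chain k X r,
      (homologyComul k hX (p + q) p q).rTensor _ (tensorRetract k X (p + q) r c) =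
        TensorProduct.map (homologyComul k hX (p + q) p q ∘ₗ retract k X (p + q) -
          tensorRetract k X p q ∘ₗ halfComul k X (p + q) p q) (retract k X r) c +
        TensorProduct.map (tensorRetract k X p q ∘ₗ halfComul k X (p + q) p q)
          (retract k X r) c := by
    intro c
    rw [← LinearMap.add_apply, ← TensorProduct.map_add_left, sub_add_cancel]
    induction c with
    | zero => simp
    | add s t hs ht => simp only [map_add, hs, ht]
    | tmul a b => simp [tensorRetract]
  have h2 : ∀ t : Tot k X ⊗[k] Tot k X,
      TensorProduct.assoc k _ _ _ (TensorProduct.map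
        (tensorRetract k X p q ∘ₗ halfComul k X (p + q) p q)
          (retract k X r) (toBichain k X (p + q) r t)) =
      tripleRetract k X p q r (TensorProduct.assoc k _ _ _ ((leftHalf k X).rTensor _ t)) := by
    intro t
    induction t with
    | zero => simp
    | add s t hs ht => simp only [map_add, hs, ht]
    | tmul a b =>
      rw [toBichain_tmul, TensorProduct.map_tmul, LinearMap.comp_apply, halfComul_toChain,
        LinearMap.rTensor_tmul]
      generalize leftHalf k X a = c
      induction c with
      | zero => simp
      | add s t hs ht => simp only [map_add, TensorProduct.add_tmul, hs, ht]
      | tmul a c => simp [tripleRetract, tensorRetract, toBichain_tmul]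
  rw [homologyComul_class, halfComul_mkQ, h1,
    (hX.isTensorCycle z hz).map_eq_zero_of_left _ _ (homologyComul_retract_sub hX _ _ _)
      (retract_boundary r), zero_add, h2]

theorem IsReduced.coZinbiel_right (hX : IsReduced X) {n : ℕ} (p q r : ℕ) (hqr : 0 < q + r)
    (z : X.obj n →₀ k) (hz : Submodule.mkQ (degen k X n) z ∈ cycles k X n) :
    (homologyComul k hX (q + r) q r + gradedFlip k (Homology k X) r q ∘ₗ
      homologyComul k hX (q + r) r q).lTensor _
      (homologyComul k hX n p (q + r) (homologyClass k X n ⟨_, hz⟩)) =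
    tripleRetract k X p q r ((serre k X).lTensor _ (leftHalf k X (ofDegree k X n z))) := by
  set A := homologyComul k hX (q + r) q r + gradedFlip k (Homology k X) r q ∘ₗ
      homologyComul k hX (q + r) r q with hA
  set B := tensorRetract k X q r ∘ₗ halfComul k X (q + r) q r +
    tensorRetract k X q r ∘ₗ rightComul k X (q + r) q r with hB
  have hAB : ∀ c : cycles k X (q + r), (A ∘ₗ retract k X (q + r) - B) c = 0 := by
    rintro ⟨c, hc⟩
    obtain ⟨y, rfl⟩ := Submodule.mkQ_surjective _ c
    have e : rightComul k X (q + r) q r (Submodule.mkQ _ y) =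
      toBichain k X q r (rightHalf k X (ofDegree k X (q + r) y)) := rfl
    rw [LinearMap.sub_apply, LinearMap.comp_apply, retract_cycle ⟨_, hc⟩]
    simp only [hA, hB, LinearMap.add_apply, LinearMap.comp_apply, homologyComul_class]
    rw [e, hX.tensorRetract_rightHalf q r y hc, gradedFlip_tensorRetract]
    exact sub_self _
  have h1 : ∀ c : Chain k X p ⊗[k] Chain k X (q + r),
      A.lTensor _ (tensorRetract k X p (q + r) c) =
        TensorProduct.map (retract k X p) (A ∘ₗ retract k X (q + r) - B) c +
        TensorProduct.map (retract k X p) B c := by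
    intro c
    rw [← LinearMap.add_apply, ← TensorProduct.map_add_right, sub_add_cancel]
    induction c with
    | zero => simp
    | add s t hs ht => simp only [map_add, hs, ht]
    | tmul a b => simp [tensorRetract]
  have h2 : ∀ t : Tot k X ⊗[k] Tot k X,
      TensorProduct.map (retract k X p) B (toBichain k X p (q + r) t) =
      tripleRetract k X p q r ((serre k X).lTensor _ t) := by
    intro t
    induction t with
    | zero => simp
    | add s t hs ht => simp only [map_add, hs, ht]
    | tmul a b =>
      simp only [toBichain_tmul, TensorProduct.map_tmul, hB, LinearMap.add_apply,
        LinearMap.comp_apply, halfComul_toChain, rightComul_toChain, LinearMap.lTensor_tmul,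
        tripleRetract]
      rw [toBichain_serre q r hqr, map_add]
  rw [homologyComul_class, halfComul_mkQ, h1,
    (hX.isTensorCycle z hz).map_eq_zero_of_right _ _ (retract_boundary p) hAB, zero_add, h2]

/-- The coZinbiel structure on the homology of a reduced cubical set. -/
def homologyCoZinbiel (k : Type v) [Field k] {X : CubicalSet.{u}} (hX : IsReduced X) :
    CoZinbiel k (Homology k X) where
  comul {n} p q _ _ := homologyComul k hX n p q
  counit := homologyCounit k X
  counit_bijective := hX.homologyCounit_bijective
  counit_left {n} hn := by
    refine LinearMap.ext fun a => ?_
    obtain ⟨c, rfl⟩ := homologyClass_surjective k X n a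
    rw [LinearMap.comp_apply, homologyComul_class, halfComul_zero_left, LinearMap.zero_apply,
      map_zero, map_zero, LinearMap.zero_apply]
  counit_right {n} hn := by
    refine LinearMap.ext fun a => ?_
    obtain ⟨c, rfl⟩ := homologyClass_surjective k X n a
    have h : ∀ t, (homologyCounit k X).lTensor _ (tensorRetract k X n 0 t) =
        (retract k X n).rTensor _ ((augmentation k X).lTensor _ t) := by
      intro t
      induction t with
      | zero => simp
      | add s t hs ht => simp only [map_add, hs, ht]
      | tmul a b => simp [tensorRetract, homologyCounit_retract]
    simp only [LinearMap.comp_apply, LinearEquiv.coe_coe]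
    rw [homologyComul_class, h, augmentation_halfComul hn]
    simp [retract_cycle]
  coZinbiel {n} p q r hn h hpq hqr := by
    refine LinearMap.ext fun a => ?_
    obtain ⟨⟨c, hc⟩, rfl⟩ := homologyClass_surjective k X n a
    obtain ⟨z, rfl⟩ := Submodule.mkQ_surjective _ c
    simp only [LinearMap.comp_apply, LinearEquiv.coe_coe]
    rw [hX.coZinbiel_left p q r z hc, hX.coZinbiel_right p q r hqr z hc, leftHalf_coassoc]

theorem chainMap_halfComul (f : X ⟶ Y) (n p q : ℕ) (c : Chain k X n) :
    TensorProduct.map (chainMap k f p) (chainMap k f q) (halfComul k X n p q c) =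
      halfComul k Y n p q (chainMap k f n c) := by
  refine LinearMap.congr_fun (f := TensorProduct.map (chainMap k f p) (chainMap k f q) ∘ₗ
    halfComul k X n p q) (g := halfComul k Y n p q ∘ₗ chainMap k f n) (chain_ext fun x => ?_) c
  have h : ∀ (X : CubicalSet.{u}) (x : X.obj n), halfComul k X n p q (cube k X x) =
      toBichain k X p q (leftHalf k X (totCube k x)) :=
    fun X x => (preservesDegenerates_leftHalf X).component_cube _ _ _ x
  rw [LinearMap.comp_apply, LinearMap.comp_apply, chainMap_cube, h, h, ← totMap_totCube,
    leftHalf_totMap, toBichain_totMap]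

theorem homologyMap_class (f : X ⟶ Y) (n : ℕ) (c : cycles k X n) :
    homologyMap k f n (homologyClass k X n c) = homologyClass k Y n (cyclesMap k f n c) := rfl

/-- The coZinbiel structure is natural. -/
theorem isCoZinbielHom_homologyMap (hX : IsReduced X) (hY : IsReduced Y) (f : X ⟶ Y) :
    IsCoZinbielHom (homologyCoZinbiel k hX) (homologyCoZinbiel k hY) (homologyMap k f) where
  map_comul {n} p q hn h := by
    refine LinearMap.ext fun a => ?_
    obtain ⟨⟨c, hc⟩, rfl⟩ := homologyClass_surjective k X n a
    obtain ⟨z, rfl⟩ := Submodule.mkQ_surjective _ c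
    have on_cycles : ∀ m (c : cycles k X m), (homologyMap k f m ∘ₗ retract k X m -
        retract k Y m ∘ₗ chainMap k f m) c = 0 := by
      intro m c
      rw [LinearMap.sub_apply, LinearMap.comp_apply, LinearMap.comp_apply, retract_cycle,
        homologyMap_class, ← retract_cycle]
      exact sub_self _
    have split : ∀ t, TensorProduct.map (homologyMap k f p) (homologyMap k f q)
        (tensorRetract k X p q t) =
          TensorProduct.map (homologyMap k f p ∘ₗ retract k X p - retract k Y p ∘ₗ chainMap k f p)
            (homologyMap k f q ∘ₗ retract k X q) t +
          (TensorProduct.map (retract k Y p ∘ₗ chainMap k f p)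
            (homologyMap k f q ∘ₗ retract k X q - retract k Y q ∘ₗ chainMap k f q) t +
          tensorRetract k Y p q (TensorProduct.map (chainMap k f p) (chainMap k f q) t)) := by
      intro t
      induction t with
      | zero => simp
      | add s t hs ht => simp only [map_add, hs, ht]; abel
      | tmul a b =>
        simp only [tensorRetract, TensorProduct.map_tmul, LinearMap.sub_apply,
          LinearMap.comp_apply, TensorProduct.sub_tmul, TensorProduct.tmul_sub]
        abel
    change TensorProduct.map (homologyMap k f p) (homologyMap k f q)
      (tensorRetract k X p q (halfComul k X n p q (Submodule.mkQ _ z))) =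
        tensorRetract k Y p q (halfComul k Y n p q (chainMap k f n (Submodule.mkQ _ z)))
    rw [split, ← chainMap_halfComul, halfComul_mkQ,
      (hX.isTensorCycle z hc).map_eq_zero_of_left _ _ (on_cycles p)
        (fun c => by rw [LinearMap.comp_apply, retract_boundary, map_zero]),
      (hX.isTensorCycle z hc).map_eq_zero_of_right _ _
        (fun c => by rw [LinearMap.comp_apply, chainMap_boundary, retract_boundary])
        (on_cycles q), zero_add, zero_add]
  map_counit := by
    refine LinearMap.ext fun a => ?_
    obtain ⟨c, rfl⟩ := homologyClass_surjective k X 0 a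
    exact augmentation_chainMap f c.1

/-- The coZinbiel structure is induced by every formula that computes the left half of the Serre
diagonal. -/
theorem isInducedBy_homologyCoZinbiel (hX : IsReduced X)
    (D : ∀ {n : ℕ} (p q : ℕ), p + q = n → (X.obj n →₀ k) →ₗ[k] Chain k X p ⊗[k] Chain k X q)
    (hD : ∀ {n : ℕ} (p q : ℕ) (h : p + q = n) (x : X.obj n), 0 < n →
      D p q h (Finsupp.single x 1) = toBichain k X p q (leftHalf k X (totCube k x))) :
    IsInducedBy k X D (homologyCoZinbiel k hX) := by
  refine ⟨fun x => augmentation_cube x, fun n hn z hz => ?_⟩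
  set w : ∀ p q, Chain k X p ⊗[k] Chain k X q :=
    fun p q => toBichain k X p q (leftHalf k X (ofDegree k X n z)) with hw
  have hcycle : IsTensorCycle w := hX.isTensorCycle z hz
  refine ⟨fun p q => TensorProduct.map (representative k X p) (representative k X q)
    (tensorRetract k X p q (w p q)), contractLeft w + contractRight w, fun p q h => ⟨?_, ?_⟩⟩
  · have key : ∀ t, TensorProduct.map (homologyClass k X p) (homologyClass k X q)
        (TensorProduct.map (representative k X p) (representative k X q) t) = t := by
      intro t
      induction t with
      | zero => simp
      | add s t hs ht => simp only [map_add, hs, ht]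
      | tmul a b => simp [homologyClass_representative]
    rw [key]
    rfl
  · have hDz : D p q h z = w p q := by
      refine LinearMap.congr_fun (f := D p q h)
        (g := toBichain k X p q ∘ₗ leftHalf k X ∘ₗ ofDegree k X n)
        (Finsupp.lhom_ext' fun x => LinearMap.ext_ring ?_) z
      simp only [LinearMap.comp_apply, Finsupp.lsingle_apply, ofDegree_single]
      exact hD p q h x hn
    have key : ∀ t, TensorProduct.map (harmonic k X p) (harmonic k X q) t =
        TensorProduct.map (cycles k X p).subtype (cycles k X q).subtype
        (TensorProduct.map (representative k X p) (representative k X q)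
          (tensorRetract k X p q t)) := by
      intro t
      induction t with
      | zero => simp
      | add s t hs ht => simp only [map_add, hs, ht]
      | tmul a b => simp [harmonic, tensorRetract]
    rw [hDz, ← key]
    exact hcycle.kuenneth p q

end Structure

/-! ### Shuffles and the Serre diagonal -/

section Shuffles

/-- The permutation of `{0, …, n}` which fixes `0` and is `e` on `{1, …, n}`. -/
def consPerm {n : ℕ} (e : Equiv.Perm (Fin n)) : Equiv.Perm (Fin (n + 1)) :=
  Equiv.Perm.decomposeFin.symm (0, e)

@[simp]
theorem consPerm_zero {n : ℕ} (e : Equiv.Perm (Fin n)) : consPerm e 0 = 0 := by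
  simp [consPerm]

@[simp]
theorem consPerm_succ {n : ℕ} (e : Equiv.Perm (Fin n)) (i : Fin n) :
    consPerm e i.succ = (e i).succ := by
  simp [consPerm]

theorem consPerm_injective {n : ℕ} : Function.Injective (consPerm (n := n)) :=
  fun _ _ h => congrArg Prod.snd (Equiv.Perm.decomposeFin.symm.injective h)

theorem exists_consPerm {n : ℕ} (σ : Equiv.Perm (Fin (n + 1))) (h : σ 0 = 0) :
    ∃ e, consPerm e = σ := by
  obtain ⟨⟨i, e⟩, rfl⟩ := Equiv.Perm.decomposeFin.symm.surjective σ
  rw [Equiv.Perm.decomposeFin_symm_apply_zero] at h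
  exact ⟨e, by rw [h]; rfl⟩

theorem sign_consPerm {n : ℕ} (e : Equiv.Perm (Fin n)) :
    Equiv.Perm.sign (consPerm e) = Equiv.Perm.sign e := by
  simp [consPerm]

/-- The permutation `σ` with `σ(i) = 0` which is obtained from `e` by inserting the value `0` at
the position `i`. -/
def insertPerm {n : ℕ} (i : Fin (n + 1)) (e : Equiv.Perm (Fin n)) : Equiv.Perm (Fin (n + 1)) :=
  consPerm e * i.cycleRange

theorem insertPerm_self {n : ℕ} (i : Fin (n + 1)) (e : Equiv.Perm (Fin n)) :
    insertPerm i e i = 0 := by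
  simp [insertPerm]

theorem insertPerm_succAbove {n : ℕ} (i : Fin (n + 1)) (e : Equiv.Perm (Fin n)) (j : Fin n) :
    insertPerm i e (i.succAbove j) = (e j).succ := by
  simp [insertPerm]

theorem insertPerm_injective {n : ℕ} (i : Fin (n + 1)) : Function.Injective (insertPerm i) :=
  fun _ _ h => consPerm_injective (mul_right_cancel h)

theorem exists_insertPerm {n : ℕ} (i : Fin (n + 1)) (σ : Equiv.Perm (Fin (n + 1)))
    (h : σ i = 0) : ∃ e, insertPerm i e = σ := by
  obtain ⟨e, he⟩ := exists_consPerm (σ * i.cycleRange⁻¹) (by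
    rw [Equiv.Perm.mul_apply, Equiv.Perm.inv_def, Fin.cycleRange_symm_zero, h])
  exact ⟨e, by rw [insertPerm, he, inv_mul_cancel_right]⟩

theorem sign_insertPerm {n : ℕ} (i : Fin (n + 1)) (e : Equiv.Perm (Fin n)) :
    Equiv.Perm.sign (insertPerm i e) = (-1) ^ (i : ℕ) * Equiv.Perm.sign e := by
  rw [insertPerm, map_mul, sign_consPerm, Fin.sign_cycleRange, mul_comm]

/-- `σ` is a `(p, q)`-shuffle. -/
def IsShuffle {n p q : ℕ} (h : p + q = n) (σ : Equiv.Perm (Fin n)) : Prop :=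
  StrictMono (shLeft h σ) ∧ StrictMono (shRight h σ)

variable {n p q : ℕ}

theorem shLeft_consPerm_zero (h : p + 1 + q = n + 1) (e : Equiv.Perm (Fin n)) :
    shLeft h (consPerm e) 0 = 0 := consPerm_zero e

theorem shLeft_consPerm_succ (h : p + 1 + q = n + 1) (h' : p + q = n) (e : Equiv.Perm (Fin n))
    (a : Fin p) : shLeft h (consPerm e) a.succ = (shLeft h' e a).succ :=
  consPerm_succ e ⟨a.val, by omega⟩

theorem shRight_consPerm (h : p + 1 + q = n + 1) (h' : p + q = n) (e : Equiv.Perm (Fin n))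
    (b : Fin q) : shRight h (consPerm e) b = (shRight h' e b).succ := by
  rw [shRight, shRight, ← consPerm_succ]
  congr 1
  apply Fin.ext
  simp
  omega

theorem shRight_insertPerm_zero (h : p + (q + 1) = n + 1) (e : Equiv.Perm (Fin n)) :
    shRight h (insertPerm ⟨p, by omega⟩ e) 0 = 0 := insertPerm_self _ e

theorem shRight_insertPerm_succ (h : p + (q + 1) = n + 1) (h' : p + q = n)
    (e : Equiv.Perm (Fin n)) (b : Fin q) :
    shRight h (insertPerm ⟨p, by omega⟩ e) b.succ = (shRight h' e b).succ := by
  rw [shRight, shRight, ← insertPerm_succAbove ⟨p, by omega⟩]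
  congr 1
  rw [Fin.succAbove_of_le_castSucc _ _ (by rw [Fin.le_def]; simp)]
  apply Fin.ext
  simp
  omega

theorem shLeft_insertPerm (h : p + (q + 1) = n + 1) (h' : p + q = n) (e : Equiv.Perm (Fin n))
    (a : Fin p) : shLeft h (insertPerm ⟨p, by omega⟩ e) a = (shLeft h' e a).succ := by
  rw [shLeft, shLeft, ← insertPerm_succAbove ⟨p, by omega⟩]
  congr 1
  rw [Fin.succAbove_of_castSucc_lt _ _ (by rw [Fin.lt_def]; simp)]
  rfl

theorem strictMono_cons_iff {f : Fin (p + 1) → Fin (n + 1)} {g : Fin p → Fin n} (h0 : f 0 = 0)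
    (hs : ∀ a, f a.succ = (g a).succ) : StrictMono f ↔ StrictMono g := by
  constructor
  · intro hf a b hab
    have := hf (Fin.succ_lt_succ_iff.mpr hab)
    rwa [hs, hs, Fin.succ_lt_succ_iff] at this
  · intro hg a b hab
    induction b using Fin.cases with
    | zero => exact absurd hab (Fin.not_lt_zero _)
    | succ b =>
      rw [hs]
      induction a using Fin.cases with
      | zero => rw [h0]; exact Fin.succ_pos _
      | succ a => rw [hs, Fin.succ_lt_succ_iff]; exact hg (Fin.succ_lt_succ_iff.mp hab)

theorem strictMono_succ_iff {f : Fin p → Fin (n + 1)} {g : Fin p → Fin n}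
    (hs : ∀ a, f a = (g a).succ) : StrictMono f ↔ StrictMono g := by
  constructor
  · intro hf a b hab
    have := hf hab
    rwa [hs, hs, Fin.succ_lt_succ_iff] at this
  · intro hg a b hab
    rw [hs, hs, Fin.succ_lt_succ_iff]
    exact hg hab

theorem isHalfShuffle_consPerm (h : p + 1 + q = n + 1) (h' : p + q = n)
    (e : Equiv.Perm (Fin n)) : IsHalfShuffle h (consPerm e) ↔ IsShuffle h' e := by
  rw [IsHalfShuffle, IsShuffle,
    strictMono_cons_iff (shLeft_consPerm_zero h e) (shLeft_consPerm_succ h h' e),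
    strictMono_succ_iff (shRight_consPerm h h' e)]
  refine ⟨fun H => ⟨H.1, H.2.1⟩, fun H => ⟨H.1, H.2, Nat.succ_pos p, ?_⟩⟩
  exact congrArg Fin.val (shLeft_consPerm_zero h e)

theorem isShuffle_insertPerm (h : p + (q + 1) = n + 1) (h' : p + q = n)
    (e : Equiv.Perm (Fin n)) :
    IsShuffle h (insertPerm ⟨p, by omega⟩ e) ↔ IsShuffle h' e := by
  rw [IsShuffle, IsShuffle, strictMono_succ_iff (shLeft_insertPerm h h' e),
    strictMono_cons_iff (shRight_insertPerm_zero h e) (shRight_insertPerm_succ h h' e)]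

/-- A shuffle takes the value `0` at the first position of one of the two blocks. -/
theorem IsShuffle.half_or {h : p + q = n + 1} {σ : Equiv.Perm (Fin (n + 1))}
    (hσ : IsShuffle h σ) : IsHalfShuffle h σ ∨ ∃ hq : 0 < q, shRight h σ ⟨0, hq⟩ = 0 := by
  obtain ⟨j, hj⟩ := σ.surjective 0
  by_cases hjp : j.val < p
  · left
    refine ⟨hσ.1, hσ.2, by omega, ?_⟩
    have h1 : shLeft h σ ⟨j.val, hjp⟩ = 0 := hj
    have h2 := hσ.1.monotone (show (⟨0, by omega⟩ : Fin p) ≤ ⟨j.val, hjp⟩ from Nat.zero_le _)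
    rw [h1] at h2
    exact Nat.le_zero.mp h2
  · right
    have hjq : j.val - p < q := by omega
    have h1 : shRight h σ ⟨j.val - p, hjq⟩ = 0 := by
      rw [← hj, shRight]
      congr 1
      apply Fin.ext
      simp
      omega
    refine ⟨by omega, ?_⟩
    have h2 := hσ.2.monotone (show (⟨0, by omega⟩ : Fin q) ≤ ⟨j.val - p, hjq⟩ from Nat.zero_le _)
    rw [h1] at h2
    exact Fin.le_zero_iff.mp h2

theorem IsHalfShuffle.isShuffle {h : p + q = n} {σ : Equiv.Perm (Fin n)}
    (hσ : IsHalfShuffle h σ) : IsShuffle h σ := ⟨hσ.1, hσ.2.1⟩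

theorem not_isHalfShuffle_of_shRight {h : p + q = n + 1} {σ : Equiv.Perm (Fin (n + 1))}
    (hq : 0 < q) (h0 : shRight h σ ⟨0, hq⟩ = 0) : ¬ IsHalfShuffle h σ := by
  rintro ⟨-, -, hp, h1⟩
  have h2 : shLeft h σ ⟨0, hp⟩ = shRight h σ ⟨0, hq⟩ := by rw [h0]; exact Fin.ext h1
  have h3 := congrArg Fin.val (σ.injective h2)
  simp at h3
  omega

open Classical in
theorem sum_halfShuffle {M : Type w} [AddCommMonoid M] (h : p + 1 + q = n + 1) (h' : p + q = n)
    (f : Equiv.Perm (Fin (n + 1)) → M) :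
    ∑ σ with IsHalfShuffle h σ, f σ = ∑ e with IsShuffle h' e, f (consPerm e) := by
  refine (Finset.sum_nbij consPerm (fun e he => ?_) consPerm_injective.injOn (fun σ hσ => ?_)
    fun _ _ => rfl).symm
  · simpa [isHalfShuffle_consPerm h h'] using he
  · have hσ' : IsHalfShuffle h σ := by simpa using hσ
    obtain ⟨e, rfl⟩ := exists_consPerm σ (Fin.ext hσ'.2.2.2)
    exact ⟨e, by simpa [isHalfShuffle_consPerm h h'] using hσ', rfl⟩

open Classical in
theorem sum_shuffle_not_half {M : Type w} [AddCommMonoid M] (h : p + (q + 1) = n + 1)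
    (h' : p + q = n) (f : Equiv.Perm (Fin (n + 1)) → M) :
    ∑ σ with IsShuffle h σ ∧ ¬ IsHalfShuffle h σ, f σ =
      ∑ e with IsShuffle h' e, f (insertPerm ⟨p, by omega⟩ e) := by
  refine (Finset.sum_nbij (insertPerm ⟨p, by omega⟩) (fun e he => ?_)
    (insertPerm_injective _).injOn (fun σ hσ => ?_) fun _ _ => rfl).symm
  · have he' : IsShuffle h' e := by simpa using he
    simp only [Finset.mem_filter, Finset.mem_univ, true_and]
    exact ⟨(isShuffle_insertPerm h h' e).mpr he',
      not_isHalfShuffle_of_shRight (Nat.succ_pos q) (shRight_insertPerm_zero h e)⟩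
  · simp only [Finset.coe_filter, Finset.mem_univ, true_and, Set.mem_ofPred_eq] at hσ
    obtain ⟨hq, h0⟩ := hσ.1.half_or.resolve_left hσ.2
    obtain ⟨e, he⟩ := exists_insertPerm ⟨p, by omega⟩ σ h0
    have hσ' := hσ.1
    rw [← he] at hσ'
    exact ⟨e, by simpa [isShuffle_insertPerm h h'] using hσ', he⟩

/-! ### Iterated faces of the split-off coordinate -/

variable (X : CubicalSet.{u})

theorem iterFace_succ_index (ε : Bool) (r : ℕ) : ∀ (i j : Fin r → ℕ) {m n : ℕ}
    (h : m + 1 + r = n + 1) (h' : m + r = n) (x : X.obj (n + 1)), StrictMono i →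
    (∀ a, i a < n) → (∀ a, j a = i a + 1) →
    iterFace X r j (fun _ => ε) h x =
      ofShift (iterFace (shift X) r i (fun _ => ε) h' (toShift x)) := by
  induction r with
  | zero =>
    intro i j m n h h' x _ _ _
    subst h'
    rfl
  | succ r ih =>
    intro i j m n h h' x hi hn hj
    cases n with
    | zero => exact absurd (hn (Fin.last r)) (Nat.not_lt_zero _)
    | succ n =>
      have e : Fin.ofNat (n + 2) (j (Fin.last r)) = (Fin.ofNat (n + 1) (i (Fin.last r))).succ := by
        have := hn (Fin.last r)
        apply Fin.ext
        rw [hj]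
        simp only [Fin.val_ofNat, Fin.val_succ]
        rw [Nat.mod_eq_of_lt (by omega), Nat.mod_eq_of_lt this]
      simp only [iterFace]
      rw [ih (fun a => i a.castSucc) (fun a => j a.castSucc) (by omega) (by omega) _
        (fun a b hab => hi (Fin.castSucc_lt_castSucc_iff.mpr hab))
        (fun a => by
          have h1 := hi (Fin.castSucc_lt_last a)
          have h2 := hn (Fin.last r)
          omega) (fun a => hj _), e]
      rfl

theorem iterFace_zero_index (ε : Bool) (r : ℕ) : ∀ (i : Fin r → ℕ) (j : Fin (r + 1) → ℕ) {m n : ℕ}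
    (h : m + (r + 1) = n + 1) (h' : m + r = n) (x : X.obj (n + 1)), StrictMono i →
    (∀ a, i a < n) → j 0 = 0 → (∀ a : Fin r, j a.succ = i a + 1) →
    iterFace X (r + 1) j (fun _ => ε) h x =
      X.d 0 ε (ofShift (iterFace (shift X) r i (fun _ => ε) h' (toShift x))) := by
  induction r with
  | zero =>
    intro i j m n h h' x _ _ hj _
    subst h'
    have e : Fin.ofNat (m + 1) (j (Fin.last 0)) = 0 := by
      rw [show Fin.last 0 = 0 from rfl, hj]
      rfl
    simp only [iterFace]
    rw [e]
    rfl
  | succ r ih =>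
    intro i j m n h h' x hi hn hj0 hj
    cases n with
    | zero => exact absurd (hn (Fin.last r)) (Nat.not_lt_zero _)
    | succ n =>
      have e : Fin.ofNat (n + 2) (j (Fin.last (r + 1))) =
          (Fin.ofNat (n + 1) (i (Fin.last r))).succ := by
        have := hn (Fin.last r)
        apply Fin.ext
        rw [← Fin.succ_last, hj]
        simp only [Fin.val_ofNat, Fin.val_succ]
        rw [Nat.mod_eq_of_lt (by omega), Nat.mod_eq_of_lt this]
      rw [iterFace, ih (fun a => i a.castSucc) (fun a => j a.castSucc) (by omega) (by omega) _
        (fun a b hab => hi (Fin.castSucc_lt_castSucc_iff.mpr hab))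
        (fun a => by
          have h1 := hi (Fin.castSucc_lt_last a)
          have h2 := hn (Fin.last r)
          omega) hj0 (fun a => by rw [← Fin.succ_castSucc]; exact hj _), e]
      rfl

end Shuffles

section ShuffleSum

variable (k : Type v) [Field k] (X : CubicalSet.{u})

/-- The summand of the Serre diagonal that belongs to the shuffle `σ`. -/
def shuffleTerm {n p q : ℕ} (h : p + q = n) (x : X.obj n) (σ : Equiv.Perm (Fin n)) :
    Chain k X p ⊗[k] Chain k X q :=
  ((Equiv.Perm.sign σ : ℤ) : k) •
    (cube k X (iterFace X q (fun b => (shRight h σ b).val) (fun _ => false) h x) ⊗ₜ[k]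
      cube k X (iterFace X p (fun a => (shLeft h σ a).val) (fun _ => true)
        ((add_comm q p).trans h) x))

variable {k X} {n p q : ℕ}

theorem shuffleTerm_consPerm (h : p + 1 + q = n + 1) (h' : p + q = n) (x : X.obj (n + 1))
    {e : Equiv.Perm (Fin n)} (he : IsShuffle h' e) :
    shuffleTerm k X h x (consPerm e) =
      TensorProduct.map (chainSusp k X p) (chainMap k (firstFace X true) q)
        (shuffleTerm k (shift X) h' (toShift x) e) := by
  rw [shuffleTerm, shuffleTerm, sign_consPerm, map_smul, TensorProduct.map_tmul, chainSusp_cube,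
    chainMap_cube, iterFace_succ_index X false q (fun b => (shRight h' e b).val) _ h h' x
      (fun a b hab => he.2 hab) (fun a => Fin.is_lt _)
      (fun b => by rw [shRight_consPerm h h']; rfl),
    iterFace_zero_index X true p (fun a => (shLeft h' e a).val) _ _ ((add_comm q p).trans h') x
      (fun a b hab => he.1 hab) (fun a => Fin.is_lt _)
      (by rw [shLeft_consPerm_zero h]; rfl)
      (fun a => by rw [shLeft_consPerm_succ h h']; rfl)]
  rfl

theorem shuffleTerm_insertPerm (h : p + (q + 1) = n + 1) (h' : p + q = n) (x : X.obj (n + 1))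
    {e : Equiv.Perm (Fin n)} (he : IsShuffle h' e) :
    shuffleTerm k X h x (insertPerm ⟨p, by omega⟩ e) =
      (-1 : k) ^ p • TensorProduct.map (chainMap k (firstFace X false) p) (chainSusp k X q)
        (shuffleTerm k (shift X) h' (toShift x) e) := by
  rw [shuffleTerm, shuffleTerm, sign_insertPerm, map_smul, TensorProduct.map_tmul, chainSusp_cube,
    chainMap_cube, iterFace_succ_index X true p (fun a => (shLeft h' e a).val) _ _
      ((add_comm q p).trans h') x
      (fun a b hab => he.1 hab) (fun a => Fin.is_lt _)
      (fun a => by rw [shLeft_insertPerm h h']; rfl),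
    iterFace_zero_index X false q (fun b => (shRight h' e b).val) _ h h' x
      (fun a b hab => he.2 hab) (fun a => Fin.is_lt _)
      (by rw [shRight_insertPerm_zero h]; rfl)
      (fun b => by rw [shRight_insertPerm_succ h h']; rfl), smul_smul]
  congr 1
  push_cast
  rfl

open Classical in
/-- The Serre diagonal is the sum over all shuffles. -/
theorem sum_shuffleTerm (X : CubicalSet.{u}) (n p q : ℕ) (h : p + q = n) (x : X.obj n) :
    ∑ σ with IsShuffle h σ, shuffleTerm k X h x σ =
      toBichain k X p q (serre k X (totCube k x)) := by
  induction n generalizing X p q with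
  | zero =>
    obtain rfl : p = 0 := by omega
    obtain rfl : q = 0 := by omega
    have h1 : ∀ σ : Equiv.Perm (Fin 0), IsShuffle h σ :=
      fun σ => ⟨fun a => a.elim0, fun a => a.elim0⟩
    rw [Finset.filter_true_of_mem fun σ _ => h1 σ, Fintype.sum_unique, serre_vertex, toBichain_tmul,
      toChain_totCube, shuffleTerm]
    simp [iterFace]
  | succ n ih =>
    have split : ∑ σ with IsShuffle h σ, shuffleTerm k X h x σ =
        ∑ σ with IsHalfShuffle h σ, shuffleTerm k X h x σ +
          ∑ σ with IsShuffle h σ ∧ ¬ IsHalfShuffle h σ, shuffleTerm k X h x σ := by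
      rw [← Finset.sum_filter_add_sum_filter_not _ (fun σ => IsHalfShuffle h σ),
        Finset.filter_filter, Finset.filter_filter]
      congr 2
      ext σ
      simp only [Finset.mem_filter, Finset.mem_univ, true_and, and_iff_right_iff_imp]
      exact fun hσ => hσ.isShuffle
    rw [split, totCube_eq_susp, serre_susp, serreStep, LinearMap.add_apply, map_add]
    congr 1
    · cases p with
      | zero =>
        rw [toBichain_zero_leftStep, Finset.filter_false_of_mem, Finset.sum_empty]
        rintro σ - ⟨-, -, hp, -⟩
        exact absurd hp (lt_irrefl 0)
      | succ p =>
        have h' : p + q = n := by omega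
        rw [sum_halfShuffle h h', toBichain_succ_leftStep, ← ih (shift X) p q h', map_sum]
        exact Finset.sum_congr rfl fun e he => shuffleTerm_consPerm h h' x (by simpa using he)
    · cases q with
      | zero =>
        rw [toBichain_zero_rightStep, Finset.filter_false_of_mem, Finset.sum_empty]
        rintro σ - ⟨h1, h2⟩
        obtain ⟨hq, -⟩ := h1.half_or.resolve_left h2
        exact absurd hq (lt_irrefl 0)
      | succ q =>
        have h' : p + q = n := by omega
        rw [sum_shuffle_not_half h h', toBichain_succ_rightStep, ← ih (shift X) p q h', map_sum,
          Finset.smul_sum]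
        exact Finset.sum_congr rfl fun e he => shuffleTerm_insertPerm h h' x (by simpa using he)

/-- The left half of the Serre diagonal is the sum over the half-shuffles. -/
theorem halfShuffleFaces_single (X : CubicalSet.{u}) (p q : ℕ) (h : p + q = n) (x : X.obj n)
    (hn : 0 < n) : halfShuffleFaces k X p q h (Finsupp.single x 1) =
      toBichain k X p q (leftHalf k X (totCube k x)) := by
  classical
  obtain ⟨n, rfl⟩ := Nat.exists_eq_succ_of_ne_zero hn.ne'
  rw [halfShuffleFaces, Finsupp.linearCombination_single, one_smul]
  change ∑ σ with IsHalfShuffle h σ, shuffleTerm k X h x σ = _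
  rw [totCube_eq_susp, leftHalf_susp]
  cases p with
  | zero =>
    rw [toBichain_zero_leftStep, Finset.filter_false_of_mem, Finset.sum_empty]
    rintro σ - ⟨-, -, hp, -⟩
    exact absurd hp (lt_irrefl 0)
  | succ p =>
    have h' : p + q = n := by omega
    rw [sum_halfShuffle h h', toBichain_succ_leftStep, ← sum_shuffleTerm (shift X) n p q h',
      map_sum]
    exact Finset.sum_congr rfl fun e he => shuffleTerm_consPerm h h' x (by simpa using he)

end ShuffleSum

/-! ### Iterated faces of the nerve of a rack -/

section RackFaces

variable {X : PRack.{u}}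

/-- The effect of the face `d_{i,ε}` on an entry `y` to the left of the entry `g`. -/
def faceAct {X : Type u} [PointedRack X] (ε : Bool) (y g : X) : X :=
  if ε = true then ract y g else y

theorem faceAct_faceAct {X : Type u} [PointedRack X] (ε : Bool) (y h g : X) :
    faceAct ε (faceAct ε y h) g = faceAct ε (faceAct ε y g) (faceAct ε h g) := by
  cases ε
  · rfl
  · exact ract_ract y h g

theorem foldl_faceAct {X : Type u} [PointedRack X] (ε : Bool) (xs xs' : ℕ → X) (g : X)
    (l : List ℕ) (h : ∀ j ∈ l, xs' j = faceAct ε (xs j) g) (y : X) :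
    l.foldl (fun y j => faceAct ε y (xs' j)) (faceAct ε y g) =
      faceAct ε (l.foldl (fun y j => faceAct ε y (xs j)) y) g := by
  induction l generalizing y with
  | nil => rfl
  | cons a l ih =>
    rw [List.foldl_cons, List.foldl_cons, h a (List.mem_cons_self ..), ← faceAct_faceAct,
      ih fun j hj => h j (List.mem_cons_of_mem a hj)]

theorem strictMono_fin_eq {m : ℕ} {c : Fin m → ℕ} (hc : StrictMono c) (hm : ∀ b, c b < m)
    (b : Fin m) : c b = b := by
  let f : Fin m → Fin m := fun b => ⟨c b, hm b⟩
  have hf : StrictMono f := fun a b hab => hc hab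
  exact Fin.coe_orderIso_apply
    (hf.orderIsoOfSurjective f (Finite.surjective_of_injective hf.injective)) b

/-- The iterated faces of a cube in the nerve of a rack. Here `i` enumerates the removed
coordinates, and `c` the others; an entry is acted upon by the removed entries to its right, in
their order from left to right. -/
theorem iterFace_rackNerve (ε : Bool) (r : ℕ) : ∀ (i : Fin r → ℕ) {m n : ℕ} (h : m + r = n)
    (c : Fin m → ℕ) (xs : ℕ → X.carrier), StrictMono i → (∀ a, i a < n) → StrictMono c →
    (∀ b, c b < n) → (∀ a b, i a ≠ c b) →
    iterFace (rackNerveObj X) r i (fun _ => ε) h (fun j : Fin n => xs j) =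
      fun b : Fin m => ((List.ofFn i).filter fun j => decide (c b < j)).foldl
        (fun y j => faceAct ε y (xs j)) (xs (c b)) := by
  induction r with
  | zero =>
    intro i m n h c xs _ _ hc hcn _
    subst h
    funext b
    rw [strictMono_fin_eq hc hcn, List.ofFn_zero]
    rfl
  | succ r ih =>
    intro i m n h c xs hi hin hc hcn hic
    cases n with
    | zero => exact absurd (hin 0) (Nat.not_lt_zero _)
    | succ n =>
      set I := i (Fin.last r) with hI
      have hIn : I < n + 1 := hin _
      have hiI : ∀ a : Fin r, i a.castSucc < I := fun a => hi (Fin.castSucc_lt_last a)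
      have hcI : ∀ b, I ≠ c b := fun b => hic _ b
      have hval : (Fin.ofNat (n + 1) I : Fin (n + 1)).val = I := Nat.mod_eq_of_lt hIn
      let xs' : ℕ → X.carrier := fun j => if j < I then faceAct ε (xs j) (xs I) else xs (j + 1)
      let c' : Fin m → ℕ := fun b => if c b < I then c b else c b - 1
      have hface : (rackNerveObj X).d (Fin.ofNat (n + 1) I) ε (fun j : Fin (n + 1) => xs j) =
          fun j : Fin n => xs' j := by
        funext j
        change rackFace _ _ _ _ = _
        rw [rackFace_apply, hval]
        rfl
      have step : iterFace (rackNerveObj X) (r + 1) i (fun _ => ε) h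
          (fun j : Fin (n + 1) => xs j) =
          iterFace (rackNerveObj X) r (fun a => i a.castSucc) (fun _ => ε) (by omega)
            ((rackNerveObj X).d (Fin.ofNat (n + 1) I) ε (fun j : Fin (n + 1) => xs j)) := rfl
      rw [step, hface, ih (fun a => i a.castSucc) (by omega) c' xs'
        (fun a b hab => hi (Fin.castSucc_lt_castSucc_iff.mpr hab))
        (fun a => by have := hiI a; omega)
        (fun a b hab => by
          have h1 := hc hab
          have h2 := hcI a
          have h3 := hcI b
          simp only [c']
          split_ifs <;> omega)
        (fun b => by
          have h1 := hcn b
          have h2 := hcI b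
          simp only [c']
          split_ifs <;> omega)
        (fun a b => by
          have h1 := hic a.castSucc b
          have h2 := hcI b
          have h3 := hiI a
          simp only [c']
          split_ifs <;> omega)]
      funext b
      rw [List.ofFn_succ', List.concat_eq_append, List.filter_append, List.foldl_append, ← hI]
      rcases lt_or_gt_of_ne (hcI b) with hb | hb
      · have h1 : ∀ j ∈ List.ofFn i, j < c b := by
          intro j hj
          obtain ⟨a, rfl⟩ := List.mem_ofFn.mp hj
          exact lt_of_le_of_lt (hi.monotone (Fin.le_last a)) hb
        have hc' : c' b = c b - 1 := if_neg (by omega)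
        have e1 : (List.ofFn fun a : Fin r => i a.castSucc).filter (fun j => decide (c b < j)) =
            [] := by
          rw [List.filter_eq_nil_iff]
          intro j hj
          obtain ⟨a, rfl⟩ := List.mem_ofFn.mp hj
          have := hiI a
          simp
          omega
        have e2 : (List.ofFn fun a : Fin r => i a.castSucc).filter (fun j => decide (c' b < j)) =
            [] := by
          rw [List.filter_eq_nil_iff]
          intro j hj
          obtain ⟨a, rfl⟩ := List.mem_ofFn.mp hj
          have := hiI a
          simp [hc']
          omega
        have e3 : [I].filter (fun j => decide (c b < j)) = [] := by
          simp
          omega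
        have e4 : xs' (c' b) = xs (c b) := by
          have h3 : ¬ c b - 1 < I := by omega
          have h4 : c b - 1 + 1 = c b := by omega
          simp only [xs', hc', if_neg h3, h4]
        rw [e1, e2, e3, e4]
        rfl
      · have hc' : c' b = c b := if_pos hb
        have e3 : [I].filter (fun j => decide (c b < j)) = [I] := by
          simpa using hb
        have e4 : xs' (c b) = faceAct ε (xs (c b)) (xs I) := if_pos hb
        rw [hc', e3, e4, foldl_faceAct ε xs xs' (xs I)]
        · rfl
        · intro j hj
          obtain ⟨a, rfl⟩ := List.mem_ofFn.mp (List.mem_of_mem_filter hj)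
          exact if_pos (hiI a)

theorem foldl_faceAct_false {X : Type u} [PointedRack X] (xs : ℕ → X) (l : List ℕ) (y : X) :
    l.foldl (fun y j => faceAct false y (xs j)) y = y := by
  induction l generalizing y with
  | nil => rfl
  | cons a l ih => exact ih y

variable {n p q : ℕ}

theorem shLeft_ne_shRight (h : p + q = n) (σ : Equiv.Perm (Fin n)) (a : Fin p) (b : Fin q) :
    shLeft h σ a ≠ shRight h σ b := by
  intro e
  have := congrArg Fin.val (σ.injective e)
  simp at this
  omega

theorem IsShuffle.iterFace_false {h : p + q = n} {σ : Equiv.Perm (Fin n)} (hσ : IsShuffle h σ)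
    (x : Fin n → X.carrier) :
    iterFace (rackNerveObj X) q (fun b => (shRight h σ b).val) (fun _ => false) h x =
      fun a => x (shLeft h σ a) := by
  let xs : ℕ → X.carrier := fun j => if hj : j < n then x ⟨j, hj⟩ else PointedRack.pt
  have hx : x = fun j : Fin n => xs j := by
    funext j
    simp [xs]
  conv_lhs => rw [hx]
  rw [iterFace_rackNerve false q (fun b => (shRight h σ b).val) h
    (fun a => (shLeft h σ a).val) xs (fun a b hab => hσ.2 hab) (fun a => Fin.is_lt _)
    (fun a b hab => hσ.1 hab) (fun a => Fin.is_lt _)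
    (fun b a e => shLeft_ne_shRight h σ a b (Fin.ext e.symm))]
  funext a
  rw [foldl_faceAct_false]
  simp [xs]

theorem IsShuffle.filter_finRange {h : p + q = n} {σ : Equiv.Perm (Fin n)} (hσ : IsShuffle h σ) :
    (List.finRange n).filter (fun j => decide (∃ a : Fin p, shLeft h σ a = j)) =
      List.ofFn (shLeft h σ) := by
  refine List.SortedLT.eq_of_mem_iff
    (((List.sortedLT_finRange n).pairwise.filter _).sortedLT) (List.sortedLT_ofFn_iff.mpr hσ.1) ?_
  intro j
  simp [List.mem_ofFn]

theorem IsShuffle.iterFace_true {h : p + q = n} {σ : Equiv.Perm (Fin n)} (hσ : IsShuffle h σ)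
    (x : Fin n → X.carrier) :
    iterFace (rackNerveObj X) p (fun a => (shLeft h σ a).val) (fun _ => true)
        ((add_comm q p).trans h) x =
      fun b => twistedEntry h σ x b := by
  let xs : ℕ → X.carrier := fun j => if hj : j < n then x ⟨j, hj⟩ else PointedRack.pt
  have hxs : ∀ j : Fin n, xs j = x j := by
    intro j
    simp [xs]
  have hx : x = fun j : Fin n => xs j := funext fun j => (hxs j).symm
  conv_lhs => rw [hx]
  rw [iterFace_rackNerve true p (fun a => (shLeft h σ a).val) ((add_comm q p).trans h)
    (fun b => (shRight h σ b).val) xs (fun a b hab => hσ.1 hab) (fun a => Fin.is_lt _)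
    (fun a b hab => hσ.2 hab) (fun a => Fin.is_lt _)
    (fun a b e => shLeft_ne_shRight h σ a b (Fin.ext e))]
  funext b
  have e1 : (List.finRange n).filter (fun j =>
      decide ((∃ a : Fin p, shLeft h σ a = j) ∧ shRight h σ b < j)) =
      (List.ofFn (shLeft h σ)).filter (fun j => decide (shRight h σ b < j)) := by
    rw [← hσ.filter_finRange, List.filter_filter]
    refine List.filter_congr fun j _ => ?_
    rw [Bool.decide_and, Bool.and_comm]
  have e2 : (List.ofFn fun a => (shLeft h σ a).val) = (List.ofFn (shLeft h σ)).map Fin.val := by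
    rw [List.map_ofFn]
    rfl
  rw [twistedEntry, e1, e2, List.filter_map, List.foldl_map, hxs]
  refine congrArg (fun f => List.foldl f _ _) ?_
  funext y j
  rw [hxs]
  rfl

theorem halfShuffleRack_eq_halfShuffleFaces (k : Type v) [Field k] (X : PRack.{u}) (h : p + q = n) :
    halfShuffleRack k X p q h = halfShuffleFaces k (rackNerve.obj X) p q h := by
  classical
  refine congrArg (Finsupp.linearCombination k) ?_
  funext x
  refine Finset.sum_congr (by congr) fun σ hσ => ?_
  have hσ' : IsShuffle h σ := IsHalfShuffle.isShuffle (by simpa using hσ)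
  have e1 := hσ'.iterFace_false (X := X) x
  have e2 := hσ'.iterFace_true (X := X) x
  change _ = _ • (cube k (rackNerveObj X) (iterFace (rackNerveObj X) _ _ _ _ x) ⊗ₜ[k]
    cube k (rackNerveObj X) (iterFace (rackNerveObj X) _ _ _ _ x))
  rw [e1, e2]
  rfl

end RackFaces

/-! ### Functors from a cube to a group -/

section GroupCubes

variable {G : Type u} [Group G] {n : ℕ}

/-- The element of `G` which a functor assigns to the relation `a ≤ b` between vertices. -/
def edge (F : Cube n ⥤ SingleObj Gᵐᵒᵖ) {a b : Cube n} (h : a ≤ b) : G :=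
  MulOpposite.unop (show Gᵐᵒᵖ from F.map (homOfLE h))

theorem edge_refl (F : Cube n ⥤ SingleObj Gᵐᵒᵖ) (a : Cube n) : edge F (le_refl a) = 1 :=
  congrArg MulOpposite.unop (F.map_id a)

theorem edge_trans (F : Cube n ⥤ SingleObj Gᵐᵒᵖ) {a b c : Cube n} (h : a ≤ b) (h' : b ≤ c) :
    edge F (h.trans h') = edge F h * edge F h' :=
  congrArg MulOpposite.unop (F.map_comp (homOfLE h) (homOfLE h'))

theorem edge_congr (F : Cube n ⥤ SingleObj Gᵐᵒᵖ) {a b a' b' : Cube n} (h : a ≤ b) (h' : a' ≤ b')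
    (ha : a = a') (hb : b = b') : edge F h = edge F h' := by
  subst ha hb
  rfl

theorem cubeFunctor_ext {F F' : Cube n ⥤ SingleObj Gᵐᵒᵖ}
    (h : ∀ (a b : Cube n) (hab : a ≤ b), edge F hab = edge F' hab) : F = F' :=
  Functor.hext (fun _ => rfl) fun a b f =>
    heq_of_eq (MulOpposite.unop_injective (h a b (leOfHom f)))

/-- The product `∏ x_i^{a_i}`: the value on `0 ≤ a` of the functor that corresponds to `x`. -/
def vertexProd : ∀ {n : ℕ}, (Fin n → G) → (Fin n → Bool) → G
  | 0, _, _ => 1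
  | _ + 1, x, a => (if a 0 = true then x 0 else 1) *
      vertexProd (fun i => x i.succ) (fun i => a i.succ)

theorem vertexProd_succ (x : Fin (n + 1) → G) (a : Fin (n + 1) → Bool) :
    vertexProd x a = (if a 0 = true then x 0 else 1) *
      vertexProd (fun i => x i.succ) (fun i => a i.succ) := rfl

theorem map_vertexProd {H : Type u} [Group H] (f : G →* H) (x : Fin n → G) (a : Fin n → Bool) :
    f (vertexProd x a) = vertexProd (fun i => f (x i)) a := by
  induction n with
  | zero => exact map_one f
  | succ n ih =>
    rw [vertexProd_succ, vertexProd_succ, map_mul, ih]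
    split_ifs <;> simp

theorem vertexProd_false (x : Fin n → G) : vertexProd x (fun _ => false) = 1 := by
  induction n with
  | zero => rfl
  | succ n ih => simp [vertexProd_succ, ih]

theorem vertexProd_unit (x : Fin n → G) (i : Fin n) :
    vertexProd x (fun j => decide (j = i)) = x i := by
  induction n with
  | zero => exact i.elim0
  | succ n ih =>
    rw [vertexProd_succ]
    induction i using Fin.cases with
    | zero => simp [Fin.succ_ne_zero, vertexProd_false]
    | succ i => simp [(Fin.succ_ne_zero _).symm, Fin.succ_inj, ih]

theorem ins_zero_zero {α : Type u} (e : α) (x : Fin n → α) : ins 0 e x 0 = e := by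
  simp [ins_apply]

theorem ins_zero_succ {α : Type u} (e : α) (x : Fin n → α) (j : Fin n) :
    ins 0 e x j.succ = x j := by
  simp [ins_apply]

theorem ins_succ_zero {α : Type u} (i : Fin (n + 1)) (e : α) (x : Fin (n + 1) → α) :
    ins i.succ e x 0 = x 0 := by
  simp [ins_apply]

theorem ins_succ_succ {α : Type u} (i : Fin (n + 1)) (e : α) (x : Fin (n + 1) → α)
    (j : Fin (n + 1)) : ins i.succ e x j.succ = ins i e (fun l => x l.succ) j := by
  induction j using Fin.succAboveCases i with
  | x =>
    rw [ins, ins, Fin.insertNth_apply_same, Fin.insertNth_apply_same]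
  | p j =>
    rw [ins, ins, Fin.insertNth_apply_succAbove, ← Fin.succ_succAbove_succ,
      Fin.insertNth_apply_succAbove]

theorem conj_rackFace_apply (i : Fin (n + 1)) (ε : Bool) (x : Fin (n + 1) → G) (j : Fin n) :
    @rackFace G (conjPointedRack G) n i ε x j = if j.val < i.val then
      (if ε = true then (x i)⁻¹ * x j.castSucc * x i else x j.castSucc) else x j.succ :=
  @rackFace_apply G (conjPointedRack G) n i ε x j

/-- The face `x_i = ε` of the product of a tuple. The factor `x_i` is moved to the front, which
conjugates the factors to its left. -/
theorem vertexProd_ins (i : Fin (n + 1)) (ε : Bool) (x : Fin (n + 1) → G) (a : Fin n → Bool) :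
    vertexProd x (ins i ε a) = (if ε = true then x i else 1) *
      vertexProd (@rackFace G (conjPointedRack G) n i ε x) a := by
  induction n with
  | zero =>
    obtain rfl : i = 0 := Fin.fin_one_eq_zero i
    rw [vertexProd_succ, ins_zero_zero]
    rfl
  | succ n ih =>
    induction i using Fin.cases with
    | zero =>
      have e : @rackFace G (conjPointedRack G) (n + 1) 0 ε x = fun j => x j.succ := by
        funext j
        simp [conj_rackFace_apply]
      rw [vertexProd_succ, ins_zero_zero, e]
      simp only [ins_zero_succ]
    | succ i =>
      have e0 : @rackFace G (conjPointedRack G) (n + 1) i.succ ε x 0 =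
          if ε = true then (x i.succ)⁻¹ * x 0 * x i.succ else x 0 := by
        simp [conj_rackFace_apply]
      have e1 : (fun j : Fin n => @rackFace G (conjPointedRack G) (n + 1) i.succ ε x j.succ) =
          @rackFace G (conjPointedRack G) n i ε (fun j => x j.succ) := by
        funext j
        simp [conj_rackFace_apply, ← Fin.succ_castSucc]
      rw [vertexProd_succ x, ins_succ_zero,
        vertexProd_succ (@rackFace G (conjPointedRack G) (n + 1) i.succ ε x), e0, e1]
      simp only [ins_succ_succ]
      rw [ih]
      cases ε <;> cases a 0 <;> simp [mul_assoc]

theorem vertexProd_del (i : Fin (n + 1)) (x : Fin n → G) (a : Fin (n + 1) → Bool) :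
    vertexProd (ins i 1 x) a = vertexProd x (del i a) := by
  induction n with
  | zero =>
    obtain rfl : i = 0 := Fin.fin_one_eq_zero i
    rw [vertexProd_succ, ins_zero_zero]
    simp [vertexProd]
  | succ n ih =>
    induction i using Fin.cases with
    | zero =>
      rw [vertexProd_succ, ins_zero_zero]
      simp only [ins_zero_succ, ite_self, one_mul]
      congr 1
    | succ i =>
      rw [vertexProd_succ, ins_succ_zero, vertexProd_succ x]
      simp only [ins_succ_succ]
      rw [ih]
      have e0 : del i.succ a 0 = a 0 := by simp [del_apply]
      have e1 : (fun j : Fin n => del i.succ a j.succ) = del i (fun j => a j.succ) := by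
        funext j
        simp [del_apply, ← Fin.succ_castSucc]
      rw [e0, e1]

/-- The cube of the nerve of `G` that corresponds to a tuple `x`: the functor which sends `a ≤ b`
to the quotient of the products of `x` at `a` and `b`. -/
def tupleFunctor (x : Fin n → G) : Cube n ⥤ SingleObj Gᵐᵒᵖ where
  obj _ := SingleObj.star _
  map {a b} _ := MulOpposite.op ((vertexProd x a)⁻¹ * vertexProd x b)
  map_id a := by
    rw [inv_mul_cancel]
    rfl
  map_comp {a b c} f g := by
    rw [SingleObj.comp_as_mul, ← MulOpposite.op_mul]
    congr 1
    group

theorem edge_tupleFunctor (x : Fin n → G) {a b : Cube n} (h : a ≤ b) :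
    edge (tupleFunctor x) h = (vertexProd x a)⁻¹ * vertexProd x b := rfl

theorem d_tupleFunctor (i : Fin (n + 1)) (ε : Bool) (x : Fin (n + 1) → G) :
    cubeδ i ε ⋙ tupleFunctor x = tupleFunctor (@rackFace G (conjPointedRack G) n i ε x) := by
  refine cubeFunctor_ext fun a b hab => ?_
  refine (congrArg₂ (fun u v : G => u⁻¹ * v) (vertexProd_ins i ε x a)
    (vertexProd_ins i ε x b)).trans ?_
  rw [edge_tupleFunctor]
  group

theorem s_tupleFunctor (i : Fin (n + 1)) (x : Fin n → G) :
    cubeσ i ⋙ tupleFunctor x = tupleFunctor (ins i 1 x) := by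
  refine cubeFunctor_ext fun a b hab => ?_
  exact congrArg₂ (fun u v : G => u⁻¹ * v) (vertexProd_del i x a).symm
    (vertexProd_del i x b).symm

theorem isLCube_tupleFunctor (x : Fin n → G) :
    IsLCube (cubicalNerveObj (SingleObj Gᵐᵒᵖ)) n (tupleFunctor x) := by
  induction n with
  | zero => exact isLCube_zero _ _
  | succ n ih =>
    have key : ∀ ε, (cubicalNerveObj (SingleObj Gᵐᵒᵖ)).d 0 ε (tupleFunctor x) =
        tupleFunctor (fun j => x j.succ) := by
      intro ε
      refine (d_tupleFunctor 0 ε x).trans (congrArg tupleFunctor ?_)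
      funext j
      simp [conj_rackFace_apply]
    refine (isLCube_succ _ n _).mpr
      ⟨fun ε ε' => (key ε).trans (key ε').symm, fun ε => ?_⟩
    exact (congrArg (IsLCube _ n) (key ε)).mpr (ih _)

/-- The initial vertex of a cube. -/
def initialVertex (n : ℕ) : Cube n := fun _ => false

/-- The vertex whose only nonzero coordinate is `i`. -/
def unitVertex (i : Fin n) : Cube n := fun j => decide (j = i)

theorem initialVertex_le (a : Cube n) : initialVertex n ≤ a := fun _ => Bool.false_le _

/-- The values of a functor on the edges from the initial vertex. -/
def edgeTuple (F : Cube n ⥤ SingleObj Gᵐᵒᵖ) (i : Fin n) : G :=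
  edge F (initialVertex_le (unitVertex i))

theorem edgeTuple_tupleFunctor (x : Fin n → G) : edgeTuple (tupleFunctor x) = x := by
  funext i
  refine (congrArg₂ (fun u v : G => u⁻¹ * v) (vertexProd_false x) (vertexProd_unit x i)).trans ?_
  rw [inv_one, one_mul]

theorem ins_zero_tail {α : Type u} (a : Fin (n + 1) → α) :
    ins 0 (a 0) (fun j => a j.succ) = a := by
  funext j
  induction j using Fin.cases with
  | zero => exact ins_zero_zero _ _
  | succ j => exact ins_zero_succ _ _ j

theorem ins_zero_initialVertex :
    (ins 0 false (initialVertex n) : Cube (n + 1)) = initialVertex (n + 1) :=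
  ins_zero_tail (fun _ : Fin (n + 1) => false)

theorem ins_zero_unitVertex (i : Fin n) :
    (ins 0 false (unitVertex i) : Cube (n + 1)) = unitVertex i.succ := by
  refine Eq.trans ?_ (ins_zero_tail (fun j : Fin (n + 1) => decide (j = i.succ)))
  simp only [(Fin.succ_ne_zero _).symm, Fin.succ_inj, decide_false]
  rfl

theorem ins_zero_true_initialVertex :
    (ins 0 true (initialVertex n) : Cube (n + 1)) = unitVertex 0 := by
  refine Eq.trans ?_ (ins_zero_tail (fun j : Fin (n + 1) => decide (j = 0)))
  simp only [Fin.succ_ne_zero, decide_false, decide_true]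
  rfl

theorem edgeTuple_face (F : Cube (n + 1) ⥤ SingleObj Gᵐᵒᵖ) :
    edgeTuple (cubeδ 0 false ⋙ F) = fun i => edgeTuple F i.succ :=
  funext fun i => edge_congr F (ins_monotone 0 false (initialVertex_le (unitVertex i))) _
    ins_zero_initialVertex (ins_zero_unitVertex i)

/-- An `L`-cube is determined by its edges at the initial vertex. -/
theorem edge_eq_vertexProd (F : Cube n ⥤ SingleObj Gᵐᵒᵖ)
    (hF : IsLCube (cubicalNerveObj (SingleObj Gᵐᵒᵖ)) n F) (a : Cube n) :
    edge F (initialVertex_le a) = vertexProd (edgeTuple F) a := by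
  induction n with
  | zero =>
    have : initialVertex 0 = a := funext fun i => i.elim0
    subst this
    exact edge_refl F _
  | succ n ih =>
    have hF' := (isLCube_succ _ n _).mp hF
    have hface : cubeδ 0 (a 0) ⋙ F = cubeδ 0 false ⋙ F := hF'.1 (a 0) false
    -- the path from the initial vertex to `a` goes along the first edge, then in the face `a 0`
    let a' : Cube n := fun j => a j.succ
    have e0 : (ins 0 (a 0) a' : Cube (n + 1)) = a := ins_zero_tail a
    have h1 : (ins 0 (a 0) (initialVertex n) : Cube (n + 1)) ≤ ins 0 (a 0) a' :=
      ins_monotone 0 (a 0) (initialVertex_le a')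
    have h2 := edge_trans F (initialVertex_le _) h1
    have h3 : edge F h1 = vertexProd (fun i => edgeTuple F i.succ) a' := by
      have h4 : edge F h1 = edge (cubeδ 0 (a 0) ⋙ F) (initialVertex_le a') := rfl
      have h6 : edge (cubeδ 0 false ⋙ F) (initialVertex_le a') =
          vertexProd (edgeTuple (cubeδ 0 false ⋙ F)) a' :=
        ih (cubeδ 0 false ⋙ F) (hF'.2 false) a'
      rw [h4, hface]
      exact h6.trans (congrArg (fun y => vertexProd y a') (edgeTuple_face F))
    have h5 : edge F (initialVertex_le (ins 0 (a 0) (initialVertex n) : Cube (n + 1))) =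
        if a 0 = true then edgeTuple F 0 else 1 := by
      cases a 0 with
      | false =>
        exact (edge_congr F _ (le_refl _) rfl ins_zero_initialVertex).trans (edge_refl F _)
      | true => exact edge_congr F _ _ rfl ins_zero_true_initialVertex
    rw [edge_congr F _ (initialVertex_le a) rfl e0, h3, h5] at h2
    exact h2

theorem tupleFunctor_edgeTuple (F : Cube n ⥤ SingleObj Gᵐᵒᵖ)
    (hF : IsLCube (cubicalNerveObj (SingleObj Gᵐᵒᵖ)) n F) : tupleFunctor (edgeTuple F) = F := by
  refine cubeFunctor_ext fun a b hab => ?_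
  have h := edge_trans F (initialVertex_le a) hab
  rw [edge_tupleFunctor, ← edge_eq_vertexProd F hF, ← edge_eq_vertexProd F hF,
    edge_congr F (initialVertex_le b) ((initialVertex_le a).trans hab) rfl rfl, h,
    inv_mul_cancel_left]

end GroupCubes

/-! ### The comparison of rack homology and `L`-homology -/

/-- A morphism of cubical sets with a levelwise inverse is an isomorphism. -/
def cubicalIso {X Y : CubicalSet.{u}} (f : X ⟶ Y) (g : ∀ n, Y.obj n → X.obj n)
    (hgf : ∀ n x, g n (f.app n x) = x) (hfg : ∀ n y, f.app n (g n y) = y) : X ≅ Y where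
  hom := f
  inv :=
    { app := g
      app_d := fun {m} i ε y => by
        conv_lhs => rw [← hfg (m + 1) y, ← f.app_d, hgf]
      app_s := fun {m} i y => by
        conv_lhs => rw [← hfg m y, ← f.app_s, hgf] }
  hom_inv_id := CubicalHom.ext (funext fun n => funext fun x => hgf n x)
  inv_hom_id := CubicalHom.ext (funext fun n => funext fun y => hfg n y)

/-- The map from the nerve of the conjugation rack of `G` to the `L`-cubes of the nerve of `G`. -/
def nerveComparison (G : GrpCat.{u}) :
    (conj ⋙ rackNerve).obj G ⟶ (groupNerve ⋙ LFunctor).obj G where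
  app _ x := ⟨tupleFunctor (G := G) x, isLCube_tupleFunctor (G := G) x⟩
  app_d i ε x := Subtype.ext (d_tupleFunctor (G := G) i ε x).symm
  app_s i x := Subtype.ext (s_tupleFunctor (G := G) i x).symm

/-- The natural isomorphism between the nerve of the conjugation rack of a group and the
`L`-cubes of its cubical nerve. -/
def nerveIso : conj.{u} ⋙ rackNerve ≅ groupNerve ⋙ LFunctor :=
  NatIso.ofComponents
    (fun G => cubicalIso (nerveComparison G) (fun _ F => edgeTuple (G := G) F.1)
      (fun _ x => edgeTuple_tupleFunctor (G := G) x)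
      (fun _ F => Subtype.ext (tupleFunctor_edgeTuple (G := G) F.1 F.2)))
    (fun {G H} f => CubicalHom.ext (funext fun m => funext fun x => Subtype.ext
      (cubeFunctor_ext (G := H) fun a b hab => by
        have h : ∀ a : Cube m, f.hom (vertexProd (G := G) x a) =
            vertexProd (G := H) (fun i => f.hom (x i)) a := map_vertexProd f.hom x
        change (vertexProd (G := H) (fun i => f.hom (x i)) a)⁻¹ *
          vertexProd (G := H) (fun i => f.hom (x i)) b =
            f.hom ((vertexProd (G := G) x a)⁻¹ * vertexProd (G := G) x b)
        rw [map_mul, map_inv, h, h])))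

theorem isReduced_rackNerve (X : PRack.{u}) : IsReduced (rackNerve.obj X) where
  equalFirstFaces n x := by
    funext j
    exact (rackFace_ge (i := 0) (ε := true) (x := x) (j := j) (Nat.zero_le _)).trans
      (rackFace_ge (i := 0) (ε := false) (x := x) (j := j) (Nat.zero_le _)).symm
  existsUnique_vertex := ⟨fun i => i.elim0, fun _ => funext fun i => i.elim0⟩

theorem isReduced_groupNerve (G : GrpCat.{u}) : IsReduced ((groupNerve ⋙ LFunctor).obj G) where
  equalFirstFaces n x := Subtype.ext (((isLCube_succ _ n x.1).mp x.2).1 true false)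
  existsUnique_vertex := by
    refine ⟨⟨tupleFunctor (G := G) fun i => i.elim0, isLCube_tupleFunctor (G := G) _⟩,
      fun x => Subtype.ext ?_⟩
    rw [← tupleFunctor_edgeTuple (G := G) x.1 x.2]
    exact congrArg (tupleFunctor (G := G)) (funext fun i => i.elim0)

/-- An isomorphism of reduced cubical sets induces an isomorphism of coZinbiel coalgebras. -/
def homologyIso (k : Type v) [Field k] {X Y : CubicalSet.{u}} (hX : IsReduced X)
    (hY : IsReduced Y) (φ : X ≅ Y) :
    ({ carrier := Homology k X, str := homologyCoZinbiel k hX } : CoZinb.{v, max u v} k) ≅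
      { carrier := Homology k Y, str := homologyCoZinbiel k hY } where
  hom := { map := homologyMap k φ.hom, isHom := isCoZinbielHom_homologyMap hX hY φ.hom }
  inv := { map := homologyMap k φ.inv, isHom := isCoZinbielHom_homologyMap hY hX φ.inv }
  hom_inv_id := CoZinbHom.ext (funext fun n => by
    change homologyMap k φ.inv n ∘ₗ homologyMap k φ.hom n = LinearMap.id
    rw [← homologyMap_comp, φ.hom_inv_id, homologyMap_id])
  inv_hom_id := CoZinbHom.ext (funext fun n => by
    change homologyMap k φ.hom n ∘ₗ homologyMap k φ.inv n = LinearMap.id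
    rw [← homologyMap_comp, φ.inv_hom_id, homologyMap_id])

end

end RackHomology

open RackHomology

theorem mainTheorem3 (k : Type v) [Field k] :
    ∃ (δ : ∀ X : PRack.{u},
          CoZinbiel k (HR k X))
      (hδ : ∀ (X Y : PRack.{u}) (f : X ⟶ Y),
          IsCoZinbielHom (δ X) (δ Y)
            (fun n => homologyMap k (rackNerve.map f) n)),
      (∀ X : PRack.{u},
          IsInducedBy k (rackNerve.obj X)
            (halfShuffleRack k X) (δ X)) ∧
      ∃ (δL : ∀ G : GrpCat.{u},
            CoZinbiel k (HL k G))
        (hδL : ∀ (G H : GrpCat.{u}) (f : G ⟶ H),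
            IsCoZinbielHom (δL G) (δL H)
              (fun n => homologyMap k
                ((groupNerve ⋙ LFunctor).map f) n)),
        (∀ G : GrpCat.{u},
            IsInducedBy k ((groupNerve ⋙ LFunctor).obj G)
              (halfShuffleFaces k
                ((groupNerve ⋙ LFunctor).obj G)) (δL G)) ∧
        ∃ (φ : conj.{u} ⋙ rackNerve ≅
              groupNerve ⋙ LFunctor)
          (e : conj.{u} ⋙ coZinbFunctor k rackNerve δ hδ ≅
              coZinbFunctor k (groupNerve ⋙ LFunctor)
                δL hδL),
          ∀ (G : GrpCat.{u}) (n : ℕ),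
            (e.hom.app G).map n = homologyMap k (φ.hom.app G) n := by
  refine ⟨fun X => homologyCoZinbiel k (isReduced_rackNerve X),
    fun X Y f => isCoZinbielHom_homologyMap _ _ _, fun X => ?_,
    fun G => homologyCoZinbiel k (isReduced_groupNerve G),
    fun G H f => isCoZinbielHom_homologyMap _ _ _, fun G => ?_, nerveIso, ?_⟩
  · refine isInducedBy_homologyCoZinbiel _ _ fun p q h x hn => ?_
    rw [halfShuffleRack_eq_halfShuffleFaces]
    exact halfShuffleFaces_single _ p q h x hn
  · exact isInducedBy_homologyCoZinbiel _ _ fun p q h x hn =>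
      halfShuffleFaces_single _ p q h x hn
  · refine ⟨NatIso.ofComponents (fun G => homologyIso k (isReduced_rackNerve (conj.obj G))
      (isReduced_groupNerve G) (nerveIso.app G)) fun {G H} f => CoZinbHom.ext (funext fun n => ?_),
      fun G n => rfl⟩
    change homologyMap k (nerveIso.hom.app H) n ∘ₗ homologyMap k ((conj ⋙ rackNerve).map f) n =
      homologyMap k ((groupNerve ⋙ LFunctor).map f) n ∘ₗ homologyMap k (nerveIso.hom.app G) n
    rw [← homologyMap_comp, ← homologyMap_comp, nerveIso.hom.naturality]
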